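/- Let $\mathcal G$ be a second countable locally compact Hausdorff étale groupoid with unit space $\mathcal G^{(0)}$, range and source maps $r,s$, and isotropy groups $\mathcal G^x_x=r^{-1}(x)\cap s^{-1}(x)$. Let $C^*_r(\mathcal G)$ be its reduced $C^*$-algebra, that is, the completion of the convolution $*$-algebra $C_c(\mathcal G)$ in the norm $\|f\|_r=\sup_{x}\|\pi_x(f)\|$, where $\pi_x$ is the representation on $\ell^2(s^{-1}(x))$ given by $(\pi_x(f)\psi)(g)=\sum_{h\in r^{-1}(r(g))}f(h)\psi(h^{-1}g)$. Let $P:C^*_r(\mathcal G)\to C_0(\mathcal G^{(0)})$ be the conditional expectation extending the restriction map $C_c(\mathcal G)\to C_c(\mathcal G^{(0)})$. Let $c:\mathcal G\to\mathbb R$ be a continuous homomorphism, i.e. $c(gh)=c(g)+c(h)$ when $s(g)=r(h)$, and let $\sigma^c$ be the one-parameter group of automorphisms of $C^*_r(\mathcal G)$ with $\sigma^c_t(f)(g)=e^{itc(g)}f(g)$ for $f\in C_c(\mathcal G)$. Let $\beta\in\mathbb R$. A non-zero regular Borel measure $m$ on $\mathcal G^{(0)}$ (in particular, finite on compact sets)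 is *$(\mathcal G,c)$-conformal with exponent $\beta$* when $$m(s(W))=\int_{r(W)}e^{\beta c(r_W^{-1}(x))}\,dm(x)$$ for every open bisection $W\subseteq\mathcal G$ (an open set on which $r$ and $s$ are injective), where $r_W^{-1}$ is the inverse of $r:W\to r(W)$. A *weight* on a $C^*$-algebra $A$ is a map $\psi:A_+\to[0,\infty]$ with $\psi(a+b)=\psi(a)+\psi(b)$ and $\psi(\lambda a)=\lambda\psi(a)$ for $a,b\in A_+$, $\lambda>0$. It is *proper* when it is non-zero, $\{a\in A_+:\psi(a)<\infty\}$ is dense in $A_+$, and $\{a\in A_+:\psi(a)\le\alpha\}$ is closed for all $\alpha\ge0$. Put $\mathcal N_\psi=\{a\in A:\psi(a^*a)<\infty\}$; a proper weight $\psi$ extends uniquely to a linear functional, again denoted $\psi$, on $\mathcal N_\psi^*\mathcal N_\psi=\operatorname{Span}\{a^*b:a,b\in\mathcal N_\psi\}$. A proper weight $\psi$ is a *$\beta$-KMS weight* for a pointwise norm-continuous one-parameter group $\alpha$ of automorphisms of $A$ when $\psi\circ\alpha_t=\psi$ on $A_+$ for all $t\in\mathbb R$, and for all $a,b\in\mathcal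 N_\psi\cap\mathcal N_\psi^*$ there is a continuous bounded function $F$ on the closed strip of all $z\in\mathbb C$ whose imaginary part lies between $0$ and $\beta$, holomorphic in the interior of the strip, such that $F(t)=\psi(a\alpha_t(b))$ and $F(t+i\beta)=\psi(\alpha_t(b)a)$ for all $t\in\mathbb R$. Suppose that $\ker c\cap\mathcal G^x_x=\{x\}$ for all $x\in\mathcal G^{(0)}$ and that $\ker c=\{g\in\mathcal G:c(g)=0\}$ is open in $\mathcal G$. Then the map $m\mapsto\varphi_m$, where $$\varphi_m(a)=\int_{\mathcal G^{(0)}}P(a)\,dm\qquad(a\in C^*_r(\mathcal G)_+),$$ is a bijection from the set of $(\mathcal G,c)$-conformal measures on $\mathcal G^{(0)}$ with exponent $\beta$ onto the set of $\beta$-KMS weights for $\sigma^c$ on $C^*_r(\mathcal G)$. -/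

import Mathlib

open scoped ENNReal CompactlySupported ZeroAtInfty

noncomputable section

/-- An étale topological groupoid with space of arrows `G` and unit space `X`: range and source
maps `r, s : G → X`, units `unit x`, inverses, and a product `mul g h` which is only meaningful when
`s g = r h`.  All structure maps are continuous and `r`, `s` are local homeomorphisms. The map
`unit` identifies `X` with the subspace of units of `G`. -/
structure EtaleGroupoid (G X : Type*) [TopologicalSpace G] [TopologicalSpace X] where
  /-- the range map -/
  r : G → X
  /-- the source map -/
  s : G → X
  /-- the unit at a point -/
  unit : X → G
  /-- the product, only meaningful on composable pairs -/
  mul : G → G → G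
  /-- the inverse -/
  inv : G → G
  r_unit : ∀ x, r (unit x) = x
  s_unit : ∀ x, s (unit x) = x
  r_mul : ∀ g h, s g = r h → r (mul g h) = r g
  s_mul : ∀ g h, s g = r h → s (mul g h) = s h
  mul_assoc : ∀ g h k, s g = r h → s h = r k → mul (mul g h) k = mul g (mul h k)
  unit_mul : ∀ g, mul (unit (r g)) g = g
  mul_unit : ∀ g, mul g (unit (s g)) = g
  r_inv : ∀ g, r (inv g) = s g
  s_inv : ∀ g, s (inv g) = r g
  inv_mul : ∀ g, mul (inv g) g = unit (s g)
  mul_inv : ∀ g, mul g (inv g) = unit (r g)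
  continuous_unit : Continuous unit
  continuousOn_mul : ContinuousOn (fun p : G × G => mul p.1 p.2) {p | s p.1 = r p.2}
  continuous_inv : Continuous inv
  isLocalHomeomorph_r : IsLocalHomeomorph r
  isLocalHomeomorph_s : IsLocalHomeomorph s

namespace EtaleGroupoid

section Groupoid

variable {G X : Type*} [TopologicalSpace G] [TopologicalSpace X] (𝒢 : EtaleGroupoid G X)

theorem inv_mul_cancel_left {g h : G} (e : 𝒢.s g = 𝒢.r h) :
    𝒢.mul (𝒢.inv g) (𝒢.mul g h) = h := by
  rw [← 𝒢.mul_assoc _ _ _ (𝒢.s_inv g) e, 𝒢.inv_mul, e, 𝒢.unit_mul]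

theorem mul_inv_cancel_left {g h : G} (e : 𝒢.r g = 𝒢.r h) :
    𝒢.mul g (𝒢.mul (𝒢.inv g) h) = h := by
  rw [← 𝒢.mul_assoc _ _ _ (𝒢.r_inv g).symm ((𝒢.s_inv g).trans e), 𝒢.mul_inv, e, 𝒢.unit_mul]

theorem mul_inv_cancel_right {g h : G} (e : 𝒢.s g = 𝒢.r h) :
    𝒢.mul (𝒢.mul g h) (𝒢.inv h) = g := by
  rw [𝒢.mul_assoc _ _ _ e (𝒢.r_inv h).symm, 𝒢.mul_inv, ← e, 𝒢.mul_unit]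

theorem inv_mul_cancel_right {g h : G} (e : 𝒢.s g = 𝒢.s h) :
    𝒢.mul (𝒢.mul g (𝒢.inv h)) h = g := by
  rw [𝒢.mul_assoc _ _ _ (e.trans (𝒢.r_inv h).symm) (𝒢.s_inv h), 𝒢.inv_mul, ← e, 𝒢.mul_unit]

theorem inv_unique {g h : G} (e : 𝒢.s g = 𝒢.r h) (e' : 𝒢.mul g h = 𝒢.unit (𝒢.s h)) :
    g = 𝒢.inv h := by
  have := 𝒢.mul_inv_cancel_right e
  rw [e', ← 𝒢.r_inv, 𝒢.unit_mul] at this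
  exact this.symm

theorem inv_inv (g : G) : 𝒢.inv (𝒢.inv g) = g :=
  (𝒢.inv_unique (𝒢.r_inv g).symm (by rw [𝒢.mul_inv, 𝒢.s_inv])).symm

theorem inv_mul_rev {g h : G} (e : 𝒢.s g = 𝒢.r h) :
    𝒢.inv (𝒢.mul g h) = 𝒢.mul (𝒢.inv h) (𝒢.inv g) := by
  have e1 : 𝒢.s (𝒢.inv h) = 𝒢.r (𝒢.inv g) := by rw [𝒢.s_inv, 𝒢.r_inv, e]
  refine (𝒢.inv_unique ?_ ?_).symm
  · rw [𝒢.s_mul _ _ e1, 𝒢.s_inv, 𝒢.r_mul _ _ e]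
  · rw [𝒢.mul_assoc _ _ _ e1 (by rw [𝒢.s_inv, 𝒢.r_mul _ _ e]), 𝒢.inv_mul_cancel_left e, 𝒢.inv_mul,
      𝒢.s_mul _ _ e]

theorem continuous_r : Continuous 𝒢.r := 𝒢.isLocalHomeomorph_r.continuous

theorem continuous_s : Continuous 𝒢.s := 𝒢.isLocalHomeomorph_s.continuous

theorem s_inv_mul {h g : G} (e : 𝒢.r h = 𝒢.r g) : 𝒢.s (𝒢.mul (𝒢.inv h) g) = 𝒢.s g :=
  𝒢.s_mul _ _ ((𝒢.s_inv h).trans e)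

theorem r_inv_mul {h g : G} (e : 𝒢.r h = 𝒢.r g) : 𝒢.r (𝒢.mul (𝒢.inv h) g) = 𝒢.s h := by
  rw [𝒢.r_mul _ _ ((𝒢.s_inv h).trans e), 𝒢.r_inv]

/-- A compactly supported function is supported on at most `N` points of each fibre of a local
homeomorphism. -/
theorem exists_fibre_bound {p : G → X} (hp : IsLocalHomeomorph p) (f : C_c(G, ℂ)) :
    ∃ N : ℕ, ∀ x, {h : G | p h = x ∧ f h ≠ 0}.Finite ∧ {h : G | p h = x ∧ f h ≠ 0}.ncard ≤ N := by
  have hK : IsCompact (tsupport f) := f.hasCompactSupport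
  have hloc : ∀ g : G, ∃ U : Set G, IsOpen U ∧ g ∈ U ∧ Set.InjOn p U := by
    intro g
    obtain ⟨e, he, rfl⟩ := hp g
    exact ⟨e.source, e.open_source, he, e.injOn⟩
  choose U hUo hgU hUi using hloc
  obtain ⟨t, ht⟩ := hK.elim_finite_subcover U hUo fun g _ => Set.mem_iUnion.2 ⟨g, hgU g⟩
  refine ⟨t.card, fun x => ?_⟩
  have hsub : {h : G | p h = x ∧ f h ≠ 0} ⊆ ⋃ g ∈ t, {h | h ∈ U g ∧ p h = x} := by
    rintro h ⟨h1, h2⟩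
    obtain ⟨g, hg, hgh⟩ := Set.mem_iUnion₂.1 (ht (subset_tsupport f h2))
    exact Set.mem_iUnion₂.2 ⟨g, hg, hgh, h1⟩
  have hss : ∀ g, {h | h ∈ U g ∧ p h = x}.Subsingleton := fun g a ha b hb =>
    hUi g ha.1 hb.1 (ha.2.trans hb.2.symm)
  have hfin : (⋃ g ∈ t, {h | h ∈ U g ∧ p h = x}).Finite :=
    t.finite_toSet.biUnion fun g _ => (hss g).finite
  refine ⟨hfin.subset hsub, (Set.ncard_le_ncard hsub hfin).trans ?_⟩
  have hle1 : ∀ g, {h | h ∈ U g ∧ p h = x}.ncard ≤ 1 := fun g => by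
    rcases (hss g).eq_empty_or_singleton with e | ⟨a, e⟩ <;> rw [e] <;> simp
  refine (Finset.set_ncard_biUnion_le t _).trans ?_
  calc ∑ g ∈ t, {h | h ∈ U g ∧ p h = x}.ncard ≤ ∑ _g ∈ t, 1 :=
        Finset.sum_le_sum fun g _ => hle1 g
    _ = t.card := by simp

theorem finite_fibre (f : C_c(G, ℂ)) (x : X) : {h : G | 𝒢.r h = x ∧ f h ≠ 0}.Finite := by
  obtain ⟨N, hN⟩ := exists_fibre_bound 𝒢.isLocalHomeomorph_r f
  exact (hN x).1

theorem finite_fibre' (f : C_c(G, ℂ)) (x : X) : {h : {h : G // 𝒢.r h = x} | f h ≠ 0}.Finite :=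
  Set.Finite.of_finite_image (f := Subtype.val)
    ((𝒢.finite_fibre f x).subset (by rintro _ ⟨h, hh, rfl⟩; exact ⟨h.2, hh⟩))
    Subtype.val_injective.injOn

theorem summable_fibre (f : C_c(G, ℂ)) (x : X) (F : {h : G // 𝒢.r h = x} → ℂ) :
    Summable fun h : {h : G // 𝒢.r h = x} => f h * F h :=
  summable_of_hasFiniteSupport ((𝒢.finite_fibre' f x).subset fun h hh => by
    simp only [Function.mem_support] at hh
    exact left_ne_zero_of_mul hh)

end Groupoid

section Representation

variable {G X : Type*} [TopologicalSpace G] [TopologicalSpace X] (𝒢 : EtaleGroupoid G X)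

/-- The Hilbert space `ℓ²(G_x)`, where `G_x` is the fibre of the source map over `x`. -/
abbrev Ell2 (x : X) : Type _ := lp (fun _ : {g : G // 𝒢.s g = x} => ℂ) 2

/-- The formula `(π_x(f)ψ)(g) = ∑_{h ∈ r⁻¹(r(g))} f(h) ψ(h⁻¹g)` for a function `ψ` on `G_x`. -/
def regFun (f : C_c(G, ℂ)) (x : X) (ψ : {g : G // 𝒢.s g = x} → ℂ) (g : {g : G // 𝒢.s g = x}) : ℂ :=
  ∑' h : {h : G // 𝒢.r h = 𝒢.r g},
    f h * ψ ⟨𝒢.mul (𝒢.inv h) g, (𝒢.s_inv_mul h.2).trans g.2⟩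

/-- The change of variables `h ↦ h⁻¹g`. -/
def fibreEquiv (x : X) (g : {g : G // 𝒢.s g = x}) :
    {h : G // 𝒢.r h = 𝒢.r g} ≃ {k : G // 𝒢.s k = x} where
  toFun h := ⟨𝒢.mul (𝒢.inv h) g, (𝒢.s_inv_mul h.2).trans g.2⟩
  invFun k := ⟨𝒢.mul g (𝒢.inv k), 𝒢.r_mul _ _ (by rw [𝒢.r_inv, g.2, k.2])⟩
  left_inv := by
    rintro ⟨h, hh⟩
    refine Subtype.ext ?_
    simp only
    have e : 𝒢.s (𝒢.inv h) = 𝒢.r g := (𝒢.s_inv h).trans hh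
    rw [𝒢.inv_mul_rev e, 𝒢.inv_inv, 𝒢.mul_inv_cancel_left hh.symm]
  right_inv := by
    rintro ⟨k, hk⟩
    refine Subtype.ext ?_
    simp only
    have e : 𝒢.s (g : G) = 𝒢.r (𝒢.inv k) := by rw [𝒢.r_inv, g.2, hk]
    rw [𝒢.inv_mul_rev e, 𝒢.inv_inv, 𝒢.inv_mul_cancel_right (hk.trans g.2.symm)]

theorem regFun_eq (f : C_c(G, ℂ)) (x : X) (ψ : {g : G // 𝒢.s g = x} → ℂ)
    (g : {g : G // 𝒢.s g = x}) :
    𝒢.regFun f x ψ g = ∑' k : {k : G // 𝒢.s k = x}, f (𝒢.mul g (𝒢.inv k)) * ψ k := by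
  rw [← (𝒢.fibreEquiv x g).tsum_eq]
  refine tsum_congr fun h => ?_
  congr 2
  exact congrArg Subtype.val ((𝒢.fibreEquiv x g).left_inv h).symm

theorem finite_row (f : C_c(G, ℂ)) (x : X) (g : {g : G // 𝒢.s g = x}) :
    {k : {k : G // 𝒢.s k = x} | f (𝒢.mul g (𝒢.inv k)) ≠ 0}.Finite :=
  (𝒢.finite_fibre' f (𝒢.r g)).preimage ((𝒢.fibreEquiv x g).symm.injective.injOn)

theorem regFun_eq_sum (f : C_c(G, ℂ)) (x : X) (ψ : {g : G // 𝒢.s g = x} → ℂ)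
    (g : {g : G // 𝒢.s g = x}) :
    𝒢.regFun f x ψ g = ∑ k ∈ (𝒢.finite_row f x g).toFinset, f (𝒢.mul g (𝒢.inv k)) * ψ k := by
  rw [𝒢.regFun_eq]
  refine tsum_eq_sum fun k hk => ?_
  simp only [Set.Finite.mem_toFinset, Set.mem_ofPred_eq, not_not] at hk
  rw [hk, zero_mul]

theorem exists_row_bound (f : C_c(G, ℂ)) :
    ∃ N : ℕ, ∀ x g, (𝒢.finite_row f x g).toFinset.card ≤ N := by
  obtain ⟨N, hN⟩ := exists_fibre_bound 𝒢.isLocalHomeomorph_r f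
  refine ⟨N, fun x g => ?_⟩
  rw [← Set.ncard_coe_finset, Set.Finite.coe_toFinset]
  refine le_trans ?_ (hN (𝒢.r g)).2
  refine Set.ncard_le_ncard_of_injOn (fun k => 𝒢.mul g (𝒢.inv k)) (fun k hk => ⟨?_, hk⟩) ?_
    (hN (𝒢.r g)).1
  · exact ((𝒢.fibreEquiv x g).symm k).2
  · intro k _ k' _ hkk
    exact (𝒢.fibreEquiv x g).symm.injective (Subtype.ext hkk)

theorem exists_col_bound (f : C_c(G, ℂ)) :
    ∃ N : ℕ, ∀ x (k : {k : G // 𝒢.s k = x}) (S : Finset {g : G // 𝒢.s g = x}),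
      (∀ g ∈ S, f (𝒢.mul g (𝒢.inv k)) ≠ 0) → S.card ≤ N := by
  obtain ⟨N, hN⟩ := exists_fibre_bound 𝒢.isLocalHomeomorph_s f
  refine ⟨N, fun x k S hS => ?_⟩
  rw [← Set.ncard_coe_finset]
  have e : ∀ g : {g : G // 𝒢.s g = x}, 𝒢.s (g : G) = 𝒢.r (𝒢.inv k) := fun g => by
    rw [𝒢.r_inv, g.2, k.2]
  refine le_trans ?_ (hN (𝒢.r k)).2
  refine Set.ncard_le_ncard_of_injOn (fun g => 𝒢.mul g (𝒢.inv k)) (fun g hg => ⟨?_, hS g hg⟩) ?_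
    (hN (𝒢.r k)).1
  · rw [𝒢.s_mul _ _ (e g), 𝒢.s_inv]
  · intro g _ g' _ hgg
    refine Subtype.ext ?_
    have h1 := 𝒢.inv_mul_cancel_right (g.2.trans k.2.symm)
    have h2 := 𝒢.inv_mul_cancel_right (g'.2.trans k.2.symm)
    simp only at hgg
    rw [← h1, ← h2, hgg]

/-- Each `f` acts by operators that are bounded uniformly in `x`. -/
theorem exists_bound (f : C_c(G, ℂ)) :
    ∃ C : ℝ, 0 ≤ C ∧ ∀ (x : X) (ψ : 𝒢.Ell2 x) (S : Finset {g : G // 𝒢.s g = x}),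
      ∑ g ∈ S, ‖𝒢.regFun f x ψ g‖ ^ (2 : ENNReal).toReal ≤
        (C * ‖ψ‖) ^ (2 : ENNReal).toReal := by
  obtain ⟨N, hN⟩ := 𝒢.exists_row_bound f
  obtain ⟨N', hN'⟩ := 𝒢.exists_col_bound f
  obtain ⟨M, hM⟩ := f.hasCompactSupport.exists_bound_of_continuous f.continuous
  refine ⟨√(N * M ^ 2 * N'), Real.sqrt_nonneg _, fun x ψ S => ?_⟩
  classical
  have h2 : ∀ a : ℝ, a ^ (2 : ENNReal).toReal = a ^ 2 := fun a => by simp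
  simp only [h2, mul_pow]
  rw [Real.sq_sqrt (by positivity)]
  set F : {g : G // 𝒢.s g = x} → Finset {g : G // 𝒢.s g = x} :=
    fun g => (𝒢.finite_row f x g).toFinset with hF
  have hrow : ∀ g, ‖𝒢.regFun f x ψ g‖ ^ 2 ≤ N * M ^ 2 * ∑ k ∈ F g, ‖ψ k‖ ^ 2 := by
    intro g
    rw [𝒢.regFun_eq_sum]
    calc ‖∑ k ∈ F g, f (𝒢.mul g (𝒢.inv k)) * ψ k‖ ^ 2
        ≤ (∑ k ∈ F g, M * ‖ψ k‖) ^ 2 := by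
          gcongr
          refine (norm_sum_le _ _).trans (Finset.sum_le_sum fun k _ => ?_)
          rw [norm_mul]
          gcongr
          exact hM _
      _ ≤ (F g).card * ∑ k ∈ F g, (M * ‖ψ k‖) ^ 2 := sq_sum_le_card_mul_sum_sq
      _ ≤ N * ∑ k ∈ F g, (M * ‖ψ k‖) ^ 2 := by
          gcongr
          exact hN x g
      _ = N * M ^ 2 * ∑ k ∈ F g, ‖ψ k‖ ^ 2 := by
          simp only [mul_pow, ← Finset.mul_sum]
          ring
  calc ∑ g ∈ S, ‖𝒢.regFun f x ψ g‖ ^ 2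
      ≤ ∑ g ∈ S, N * M ^ 2 * ∑ k ∈ F g, ‖ψ k‖ ^ 2 := Finset.sum_le_sum fun g _ => hrow g
    _ = N * M ^ 2 * ∑ g ∈ S, ∑ k ∈ F g, ‖ψ k‖ ^ 2 := by rw [Finset.mul_sum]
    _ = N * M ^ 2 * ∑ k ∈ S.biUnion F, ∑ g ∈ S with k ∈ F g, ‖ψ k‖ ^ 2 := by
        congr 1
        refine Finset.sum_comm' fun g k => ?_
        simp only [Finset.mem_filter, Finset.mem_biUnion]
        tauto
    _ ≤ N * M ^ 2 * ∑ k ∈ S.biUnion F, N' * ‖ψ k‖ ^ 2 := by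
        gcongr with k hk
        rw [Finset.sum_const, nsmul_eq_mul]
        gcongr
        refine hN' x k _ fun g hg => ?_
        simpa [hF] using (Finset.mem_filter.1 hg).2
    _ = N * M ^ 2 * N' * ∑ k ∈ S.biUnion F, ‖ψ k‖ ^ 2 := by
        rw [← Finset.mul_sum, ← _root_.mul_assoc]
    _ ≤ N * M ^ 2 * N' * ‖ψ‖ ^ 2 := by
        gcongr
        have := lp.sum_rpow_le_norm_rpow (p := 2) (by simp) ψ (S.biUnion F)
        simpa only [h2] using this

/-- The representation `π_x` of `C_c(G)` on `ℓ²(G_x)`. -/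
def regRep (f : C_c(G, ℂ)) (x : X) : 𝒢.Ell2 x →L[ℂ] 𝒢.Ell2 x :=
  LinearMap.mkContinuousOfExistsBound
    { toFun := fun ψ => ⟨𝒢.regFun f x ψ, memℓp_gen' ((𝒢.exists_bound f).choose_spec.2 x ψ)⟩
      map_add' := fun φ ψ => by
        refine lp.ext (funext fun g => ?_)
        simp only [lp.coeFn_add, Pi.add_apply, 𝒢.regFun_eq_sum, mul_add, Finset.sum_add_distrib]
      map_smul' := fun c ψ => by
        refine lp.ext (funext fun g => ?_)
        simp only [lp.coeFn_smul, Pi.smul_apply, 𝒢.regFun_eq_sum, smul_eq_mul, Finset.mul_sum,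
          RingHom.id_apply]
        exact Finset.sum_congr rfl fun k _ => by ring }
    ⟨(𝒢.exists_bound f).choose, fun ψ => lp.norm_le_of_forall_sum_le (by simp)
      (mul_nonneg (𝒢.exists_bound f).choose_spec.1 (norm_nonneg _))
      ((𝒢.exists_bound f).choose_spec.2 x ψ)⟩

theorem regRep_apply (f : C_c(G, ℂ)) (x : X) (ψ : 𝒢.Ell2 x) (g : {g : G // 𝒢.s g = x}) :
    𝒢.regRep f x ψ g = 𝒢.regFun f x ψ g := rfl

theorem norm_regRep_le (f : C_c(G, ℂ)) (x : X) :
    ‖𝒢.regRep f x‖ ≤ (𝒢.exists_bound f).choose :=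
  ContinuousLinearMap.opNorm_le_bound _ (𝒢.exists_bound f).choose_spec.1 fun ψ =>
    lp.norm_le_of_forall_sum_le (by simp)
      (mul_nonneg (𝒢.exists_bound f).choose_spec.1 (norm_nonneg _))
      ((𝒢.exists_bound f).choose_spec.2 x ψ)

/-- The C*-algebra of bounded families `(T_x)` of operators on the Hilbert spaces `ℓ²(G_x)`, with
norm `sup_x ‖T_x‖`. -/
def BddFam : Type _ := lp (fun x : X => 𝒢.Ell2 x →L[ℂ] 𝒢.Ell2 x) ∞

instance : NonUnitalCStarAlgebra 𝒢.BddFam :=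
  inferInstanceAs (NonUnitalCStarAlgebra (lp (fun x : X => 𝒢.Ell2 x →L[ℂ] 𝒢.Ell2 x) ∞))

variable {𝒢} in
/-- The operator at `x` of a bounded family. -/
def BddFam.op (T : 𝒢.BddFam) (x : X) : 𝒢.Ell2 x →L[ℂ] 𝒢.Ell2 x :=
  (show lp (fun x : X => 𝒢.Ell2 x →L[ℂ] 𝒢.Ell2 x) ∞ from T) x

namespace BddFam

variable {𝒢} (S T : 𝒢.BddFam) (x : X)

theorem ext {S T : 𝒢.BddFam} (h : ∀ x, S.op x = T.op x) : S = T := lp.ext (funext h)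

theorem op_add : (S + T).op x = S.op x + T.op x := rfl

theorem op_sub : (S - T).op x = S.op x - T.op x := rfl

theorem op_smul (a : ℂ) : (a • T).op x = a • T.op x := rfl

theorem op_mul : (S * T).op x = S.op x * T.op x := rfl

theorem op_star : (star T).op x = star (T.op x) := rfl

theorem norm_eq : ‖T‖ = ⨆ x, ‖T.op x‖ := rfl

theorem norm_op_le : ‖T.op x‖ ≤ ‖T‖ := lp.norm_apply_le_norm (by simp) _ x

end BddFam

/-- The family `(π_x(f))_x`. Its norm is the reduced norm `sup_x ‖π_x(f)‖` of `f`. -/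
def regFam (f : C_c(G, ℂ)) : 𝒢.BddFam :=
  (⟨fun x => 𝒢.regRep f x, memℓp_infty ⟨_, by rintro _ ⟨x, rfl⟩; exact 𝒢.norm_regRep_le f x⟩⟩ :
    lp (fun x : X => 𝒢.Ell2 x →L[ℂ] 𝒢.Ell2 x) ∞)

theorem regFam_op (f : C_c(G, ℂ)) (x : X) : (𝒢.regFam f).op x = 𝒢.regRep f x := rfl

theorem norm_regFam (f : C_c(G, ℂ)) : ‖𝒢.regFam f‖ = ⨆ x, ‖𝒢.regRep f x‖ := rfl

open Classical in
/-- The basis vector `δ_k` of `ℓ²(G_x)`. -/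
def delta (x : X) (k : {k : G // 𝒢.s k = x}) : 𝒢.Ell2 x := lp.single 2 k (1 : ℂ)

theorem regRep_delta (f : C_c(G, ℂ)) (x : X) (k g : {k : G // 𝒢.s k = x}) :
    𝒢.regRep f x (𝒢.delta x k) g = f (𝒢.mul g (𝒢.inv k)) := by
  classical
  rw [regRep_apply, regFun_eq, tsum_eq_single k]
  · simp [delta]
  · intro k' hk'
    simp [delta, lp.single_apply, hk']

theorem inner_delta (x : X) (k : {k : G // 𝒢.s k = x}) (ψ : 𝒢.Ell2 x) :
    inner ℂ (𝒢.delta x k) ψ = ψ k := by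
  simp [delta, lp.inner_single_left]

/-- Operators on `ℓ²(G_x)` are determined by their matrix coefficients. -/
theorem clm_ext {x : X} {S T : 𝒢.Ell2 x →L[ℂ] 𝒢.Ell2 x}
    (h : ∀ k g, S (𝒢.delta x k) g = T (𝒢.delta x k) g) : S = T := by
  classical
  refine lp.ext_continuousLinearMap (by simp) fun k => ?_
  refine ContinuousLinearMap.ext_ring ?_
  refine lp.ext (funext fun g => ?_)
  have := h k g
  simp only [delta] at this
  exact this

theorem regFam_add (f₁ f₂ : C_c(G, ℂ)) : 𝒢.regFam (f₁ + f₂) = 𝒢.regFam f₁ + 𝒢.regFam f₂ := by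
  refine BddFam.ext fun x => 𝒢.clm_ext fun k g => ?_
  change 𝒢.regRep (f₁ + f₂) x (𝒢.delta x k) g =
    𝒢.regRep f₁ x (𝒢.delta x k) g + 𝒢.regRep f₂ x (𝒢.delta x k) g
  simp only [regRep_delta, CompactlySupportedContinuousMap.add_apply]

theorem regFam_smul (a : ℂ) (f : C_c(G, ℂ)) : 𝒢.regFam (a • f) = a • 𝒢.regFam f := by
  refine BddFam.ext fun x => 𝒢.clm_ext fun k g => ?_
  change 𝒢.regRep (a • f) x (𝒢.delta x k) g = a • 𝒢.regRep f x (𝒢.delta x k) g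
  simp only [regRep_delta, CompactlySupportedContinuousMap.smul_apply]

theorem regFam_zero : 𝒢.regFam 0 = 0 := by
  simpa using 𝒢.regFam_smul 0 0

end Representation

section Convolution

variable {G X : Type*} [TopologicalSpace G] [TopologicalSpace X] (𝒢 : EtaleGroupoid G X)

/-- The convolution `(f₁ * f₂)(g) = ∑_{h ∈ r⁻¹(r(g))} f₁(h) f₂(h⁻¹g)`. -/
def convFun (f₁ f₂ : G → ℂ) (g : G) : ℂ :=
  ∑' h : {h : G // 𝒢.r h = 𝒢.r g}, f₁ h * f₂ (𝒢.mul (𝒢.inv h) g)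

variable [T2Space G]

theorem t2Space_units (𝒢 : EtaleGroupoid G X) : T2Space X :=
  T2Space.of_injective_continuous (Function.LeftInverse.injective 𝒢.r_unit) 𝒢.continuous_unit

theorem continuous_convFun_aux {F f : G → ℂ} (hF : Continuous F) (hFc : HasCompactSupport F)
    (hf : Continuous f) (e : OpenPartialHomeomorph G X) (he : 𝒢.r = e)
    (hs : tsupport F ⊆ e.source) : Continuous (𝒢.convFun F f) := by
  have := 𝒢.t2Space_units
  rw [continuous_iff_continuousAt]
  intro g₀
  by_cases hg : 𝒢.r g₀ ∈ e.target
  · have hO : IsOpen (𝒢.r ⁻¹' e.target) := e.open_target.preimage 𝒢.continuous_r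
    have hre : ∀ g ∈ 𝒢.r ⁻¹' e.target, 𝒢.r (e.symm (𝒢.r g)) = 𝒢.r g := fun g hg => by
      have h1 := e.right_inv hg
      rwa [← he] at h1
    have hsec : ContinuousOn (fun g => e.symm (𝒢.r g)) (𝒢.r ⁻¹' e.target) :=
      e.continuousOn_symm.comp 𝒢.continuous_r.continuousOn fun g hg => hg
    have h1 : ContinuousOn
        (fun g => F (e.symm (𝒢.r g)) * f (𝒢.mul (𝒢.inv (e.symm (𝒢.r g))) g))
        (𝒢.r ⁻¹' e.target) := by
      refine (hF.comp_continuousOn hsec).mul (hf.comp_continuousOn ?_)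
      refine 𝒢.continuousOn_mul.comp
        ((𝒢.continuous_inv.comp_continuousOn hsec).prodMk continuousOn_id) fun g hg => ?_
      change 𝒢.s (𝒢.inv (e.symm (𝒢.r g))) = 𝒢.r g
      rw [𝒢.s_inv, hre g hg]
    refine (h1.continuousAt (hO.mem_nhds hg)).congr ?_
    filter_upwards [hO.mem_nhds hg] with g hg
    refine Eq.symm ?_
    rw [convFun]
    refine tsum_eq_single (⟨e.symm (𝒢.r g), hre g hg⟩ : {h : G // 𝒢.r h = 𝒢.r g}) fun h hne => ?_
    by_cases hFh : F h = 0
    · rw [hFh, zero_mul]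
    · refine absurd (Subtype.ext ?_) hne
      have hh : (h : G) ∈ e.source := hs (subset_tsupport F hFh)
      have := e.left_inv hh
      rw [← he, h.2] at this
      exact this.symm
  · have hO : IsOpen (𝒢.r ⁻¹' (𝒢.r '' tsupport F)ᶜ) :=
      (IsCompact.image hFc 𝒢.continuous_r).isClosed.isOpen_compl.preimage 𝒢.continuous_r
    have hmem : g₀ ∈ 𝒢.r ⁻¹' (𝒢.r '' tsupport F)ᶜ := by
      rintro ⟨h, hh, hr⟩
      refine hg (hr ▸ ?_)
      rw [he]
      exact e.map_source (hs hh)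
    refine (continuousAt_const (y := (0 : ℂ))).congr ?_
    filter_upwards [hO.mem_nhds hmem] with g hg
    rw [convFun]
    refine Eq.symm ?_
    convert tsum_zero with h
    by_contra hne
    exact hg ⟨h, subset_tsupport F (left_ne_zero_of_mul hne), h.2⟩

theorem hasCompactSupport_convFun (f₁ f₂ : C_c(G, ℂ)) : HasCompactSupport (𝒢.convFun f₁ f₂) := by
  have hcl : IsClosed {p : G × G | 𝒢.s p.1 = 𝒢.r p.2} := by
    have := 𝒢.t2Space_units
    exact isClosed_eq (𝒢.continuous_s.comp continuous_fst) (𝒢.continuous_r.comp continuous_snd)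
  have hK : IsCompact ((tsupport f₁ ×ˢ tsupport f₂) ∩ {p : G × G | 𝒢.s p.1 = 𝒢.r p.2}) :=
    (IsCompact.prod f₁.hasCompactSupport f₂.hasCompactSupport).inter_right hcl
  refine HasCompactSupport.intro
    (hK.image_of_continuousOn (𝒢.continuousOn_mul.mono Set.inter_subset_right)) fun g hg => ?_
  rw [convFun]
  convert tsum_zero with h
  by_contra hne
  refine hg ⟨(h, 𝒢.mul (𝒢.inv h) g), ⟨⟨subset_tsupport _ (left_ne_zero_of_mul hne),
    subset_tsupport _ (right_ne_zero_of_mul hne)⟩, ?_⟩, 𝒢.mul_inv_cancel_left h.2⟩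
  exact (𝒢.r_inv_mul h.2).symm

theorem hasCompactSupport_invol (f : C_c(G, ℂ)) :
    HasCompactSupport fun g => starRingEnd ℂ (f (𝒢.inv g)) := by
  refine HasCompactSupport.intro (IsCompact.image f.hasCompactSupport 𝒢.continuous_inv)
    fun g hg => ?_
  by_contra hne
  refine hg ⟨𝒢.inv g, subset_tsupport _ fun h0 => hne (by simp [h0]), 𝒢.inv_inv g⟩

/-- The involution `f*(g) = conj (f(g⁻¹))` of `C_c(G)`. -/
def invol (f : C_c(G, ℂ)) : C_c(G, ℂ) :=
  ⟨⟨fun g => starRingEnd ℂ (f (𝒢.inv g)),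
    Complex.continuous_conj.comp (f.continuous.comp 𝒢.continuous_inv)⟩,
    𝒢.hasCompactSupport_invol f⟩

theorem regFam_invol (f : C_c(G, ℂ)) : 𝒢.regFam (𝒢.invol f) = star (𝒢.regFam f) := by
  refine BddFam.ext fun x => 𝒢.clm_ext fun k g => ?_
  change 𝒢.regRep (𝒢.invol f) x (𝒢.delta x k) g =
    (ContinuousLinearMap.adjoint (𝒢.regRep f x)) (𝒢.delta x k) g
  rw [← 𝒢.inner_delta x g (ContinuousLinearMap.adjoint _ _), ContinuousLinearMap.adjoint_inner_right,
    ← inner_conj_symm, 𝒢.inner_delta, regRep_delta, regRep_delta]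
  have e : 𝒢.s (g : G) = 𝒢.r (𝒢.inv k) := by rw [𝒢.r_inv, g.2, k.2]
  change starRingEnd ℂ (f (𝒢.inv _)) = _
  rw [𝒢.inv_mul_rev e, 𝒢.inv_inv]

variable [LocallyCompactSpace G]

theorem continuous_convFun (f₁ f₂ : C_c(G, ℂ)) : Continuous (𝒢.convFun f₁ f₂) := by
  choose e hge her using 𝒢.isLocalHomeomorph_r
  have hK : IsCompact (tsupport f₁) := f₁.hasCompactSupport
  obtain ⟨t, ht⟩ := hK.elim_finite_subcover (fun g => (e g).source) (fun g => (e g).open_source)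
    fun g _ => Set.mem_iUnion.2 ⟨g, hge g⟩
  have ht' : tsupport f₁ ⊆ ⋃ i : Fin t.card, (e (t.equivFin.symm i)).source := by
    intro h hh
    obtain ⟨g, hg, hgh⟩ := Set.mem_iUnion₂.1 (ht hh)
    refine Set.mem_iUnion.2 ⟨t.equivFin ⟨g, hg⟩, ?_⟩
    simpa using hgh
  obtain ⟨ρ, hρs, hρ1, -, -⟩ := exists_continuous_sum_one_of_isOpen_isCompact
    (fun i : Fin t.card => (e (t.equivFin.symm i)).open_source) hK ht'
  have hsum : ∀ h, f₁ h = ∑ i, (ρ i h : ℂ) * f₁ h := by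
    intro h
    rw [← Finset.sum_mul]
    by_cases hh : f₁ h = 0
    · simp [hh]
    · have h1 := hρ1 (subset_tsupport f₁ hh)
      simp only [Finset.sum_apply, Pi.one_apply] at h1
      rw [← Complex.ofReal_sum, h1]
      simp
  have hconv : 𝒢.convFun f₁ f₂ = fun g => ∑ i, 𝒢.convFun (fun h => (ρ i h : ℂ) * f₁ h) f₂ g := by
    funext g
    simp only [convFun]
    rw [← Summable.tsum_finsetSum]
    · refine tsum_congr fun h => ?_
      conv_lhs => rw [hsum h]
      rw [Finset.sum_mul]
    · intro i _
      refine (𝒢.summable_fibre f₁ (𝒢.r g)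
        fun h => (ρ i h : ℂ) * f₂ (𝒢.mul (𝒢.inv h) g)).congr fun h => ?_
      ring
  rw [hconv]
  refine continuous_finsetSum _ fun i _ => ?_
  refine 𝒢.continuous_convFun_aux ?_ ?_ f₂.continuous (e (t.equivFin.symm i)) (her _) ?_
  · exact (Complex.continuous_ofReal.comp (ρ i).continuous).mul f₁.continuous
  · exact f₁.hasCompactSupport.mul_left
  · refine subset_trans (closure_mono fun h hh => ?_) (hρs i)
    simp only [Function.mem_support] at hh ⊢
    exact fun h0 => hh (by simp [h0])

/-- The convolution product of `C_c(G)`. -/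
def conv (f₁ f₂ : C_c(G, ℂ)) : C_c(G, ℂ) :=
  ⟨⟨𝒢.convFun f₁ f₂, 𝒢.continuous_convFun f₁ f₂⟩, 𝒢.hasCompactSupport_convFun f₁ f₂⟩

theorem regFam_conv (f₁ f₂ : C_c(G, ℂ)) :
    𝒢.regFam (𝒢.conv f₁ f₂) = 𝒢.regFam f₁ * 𝒢.regFam f₂ := by
  refine BddFam.ext fun x => 𝒢.clm_ext fun k g => ?_
  change 𝒢.regRep (𝒢.conv f₁ f₂) x (𝒢.delta x k) g =
    𝒢.regRep f₁ x (𝒢.regRep f₂ x (𝒢.delta x k)) g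
  have e : 𝒢.s (g : G) = 𝒢.r (𝒢.inv k) := by rw [𝒢.r_inv, g.2, k.2]
  rw [regRep_delta, regRep_apply]
  change 𝒢.convFun f₁ f₂ _ = _
  rw [convFun, regFun]
  simp only [regRep_delta]
  rw [𝒢.r_mul _ _ e]
  refine tsum_congr fun h => ?_
  rw [𝒢.mul_assoc _ _ _ ((𝒢.s_inv _).trans h.2) e]

end Convolution

section Diagonal

variable {G X : Type*} [TopologicalSpace G] [TopologicalSpace X] (𝒢 : EtaleGroupoid G X)

/-- The unit at `x` as a point of the fibre `G_x`. -/
def unitPt (x : X) : {g : G // 𝒢.s g = x} := ⟨𝒢.unit x, 𝒢.s_unit x⟩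

/-- The diagonal coefficient `⟨δ_x, T_x δ_x⟩`. -/
def diagCoeff (T : 𝒢.BddFam) (x : X) : ℂ :=
  inner ℂ (𝒢.delta x (𝒢.unitPt x)) (T.op x (𝒢.delta x (𝒢.unitPt x)))

theorem norm_delta (x : X) (k : {g : G // 𝒢.s g = x}) : ‖𝒢.delta x k‖ = 1 := by
  simp [delta, lp.norm_single]

theorem diagCoeff_sub (S T : 𝒢.BddFam) (x : X) :
    𝒢.diagCoeff (S - T) x = 𝒢.diagCoeff S x - 𝒢.diagCoeff T x := by
  simp only [diagCoeff, BddFam.op_sub, sub_apply, inner_sub_right]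

theorem norm_diagCoeff_le (T : 𝒢.BddFam) (x : X) : ‖𝒢.diagCoeff T x‖ ≤ ‖T‖ := by
  refine (norm_inner_le_norm _ _).trans ?_
  rw [norm_delta, one_mul]
  refine ((T.op x).le_opNorm _).trans ?_
  rw [norm_delta, mul_one]
  exact T.norm_op_le x

theorem diagCoeff_regFam (f : C_c(G, ℂ)) (x : X) : 𝒢.diagCoeff (𝒢.regFam f) x = f (𝒢.unit x) := by
  rw [diagCoeff, inner_delta, regFam_op, regRep_delta, unitPt]
  congr 1
  have h := 𝒢.mul_inv (𝒢.unit x)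
  rwa [𝒢.r_unit] at h

theorem isClosedEmbedding_unit [T2Space G] : Topology.IsClosedEmbedding 𝒢.unit := by
  have h : Topology.IsEmbedding 𝒢.unit :=
    Topology.IsEmbedding.of_leftInverse 𝒢.r_unit 𝒢.continuous_r 𝒢.continuous_unit
  refine ⟨h, ?_⟩
  have : Set.range 𝒢.unit = {g | 𝒢.unit (𝒢.r g) = g} := by
    ext g
    exact ⟨by rintro ⟨x, rfl⟩; exact congrArg _ (𝒢.r_unit x), fun hg => ⟨_, hg⟩⟩
  rw [this]
  exact isClosed_eq (𝒢.continuous_unit.comp 𝒢.continuous_r) continuous_id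

end Diagonal

section ReducedAlgebra

variable {G X : Type*} [TopologicalSpace G] [TopologicalSpace X] [T2Space G] [LocallyCompactSpace G]
  (𝒢 : EtaleGroupoid G X)

/-- The image of the convolution `*`-algebra `C_c(G)` under `⊕_x π_x`. -/
def convAlg : NonUnitalStarSubalgebra ℂ 𝒢.BddFam where
  carrier := Set.range 𝒢.regFam
  add_mem' := by
    rintro _ _ ⟨f₁, rfl⟩ ⟨f₂, rfl⟩
    exact ⟨f₁ + f₂, 𝒢.regFam_add f₁ f₂⟩
  zero_mem' := ⟨0, 𝒢.regFam_zero⟩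
  mul_mem' := by
    rintro _ _ ⟨f₁, rfl⟩ ⟨f₂, rfl⟩
    exact ⟨𝒢.conv f₁ f₂, 𝒢.regFam_conv f₁ f₂⟩
  smul_mem' := by
    rintro a _ ⟨f, rfl⟩
    exact ⟨a • f, 𝒢.regFam_smul a f⟩
  star_mem' := by
    rintro _ ⟨f, rfl⟩
    exact ⟨𝒢.invol f, 𝒢.regFam_invol f⟩

/-- The reduced groupoid C*-algebra `C*_r(G)`: the completion of `C_c(G)` in the reduced norm
`sup_x ‖π_x(f)‖`, realised as the closure of the image of `C_c(G)` in the C*-algebra of bounded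
families of operators on the Hilbert spaces `ℓ²(G_x)`. -/
def ReducedCStar : Type _ := 𝒢.convAlg.topologicalClosure

instance : NonUnitalCStarAlgebra 𝒢.ReducedCStar :=
  NonUnitalStarSubalgebra.nonUnitalCStarAlgebra 𝒢.convAlg.topologicalClosure
    (h_closed := 𝒢.convAlg.isClosed_topologicalClosure)

/-- The order of the C*-algebra `C*_r(G)`: `a ≤ b` when `b - a` is self-adjoint with non-negative
spectrum. -/
instance : PartialOrder 𝒢.ReducedCStar := CStarAlgebra.spectralOrder _

instance : StarOrderedRing 𝒢.ReducedCStar := CStarAlgebra.spectralOrderedRing _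

/-- The inclusion of `C*_r(G)` in the bounded families of operators. -/
def toFam : 𝒢.ReducedCStar →⋆ₙₐ[ℂ] 𝒢.BddFam :=
  NonUnitalStarSubalgebraClass.subtype 𝒢.convAlg.topologicalClosure

theorem toFam_injective : Function.Injective 𝒢.toFam := Subtype.val_injective

theorem norm_toFam (a : 𝒢.ReducedCStar) : ‖𝒢.toFam a‖ = ‖a‖ := rfl

theorem toFam_mem (a : 𝒢.ReducedCStar) : 𝒢.toFam a ∈ closure (Set.range 𝒢.regFam) := a.2

/-- The canonical map of `C_c(G)` to `C*_r(G)`. -/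
def ofCc (f : C_c(G, ℂ)) : 𝒢.ReducedCStar :=
  (⟨𝒢.regFam f, subset_closure ⟨f, rfl⟩⟩ : 𝒢.convAlg.topologicalClosure)

theorem toFam_ofCc (f : C_c(G, ℂ)) : 𝒢.toFam (𝒢.ofCc f) = 𝒢.regFam f := rfl

theorem norm_ofCc (f : C_c(G, ℂ)) : ‖𝒢.ofCc f‖ = ⨆ x, ‖𝒢.regRep f x‖ := rfl

theorem denseRange_ofCc : DenseRange 𝒢.ofCc := by
  intro a
  rw [Metric.mem_closure_range_iff]
  intro ε hε
  obtain ⟨f, hf⟩ := Metric.mem_closure_range_iff.1 (𝒢.toFam_mem a) ε hε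
  exact ⟨f, hf⟩

theorem ofCc_conv (f₁ f₂ : C_c(G, ℂ)) : 𝒢.ofCc (𝒢.conv f₁ f₂) = 𝒢.ofCc f₁ * 𝒢.ofCc f₂ :=
  𝒢.toFam_injective (𝒢.regFam_conv f₁ f₂)

theorem ofCc_invol (f : C_c(G, ℂ)) : 𝒢.ofCc (𝒢.invol f) = star (𝒢.ofCc f) :=
  𝒢.toFam_injective (𝒢.regFam_invol f)

theorem exists_approx (a : 𝒢.ReducedCStar) {ε : ℝ} (hε : 0 < ε) :
    ∃ f : C_c(G, ℂ), ∀ x, dist (𝒢.diagCoeff (𝒢.toFam a) x) (f (𝒢.unit x)) < ε := by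
  obtain ⟨f, hf⟩ := Metric.mem_closure_range_iff.1 (𝒢.toFam_mem a) ε hε
  refine ⟨f, fun x => lt_of_le_of_lt ?_ hf⟩
  rw [dist_eq_norm, dist_eq_norm, ← 𝒢.diagCoeff_regFam, ← 𝒢.diagCoeff_sub]
  exact 𝒢.norm_diagCoeff_le _ x

/-- The conditional expectation `P : C*_r(G) → C₀(X)`, given by `P(a)(x) = ⟨δ_x, a_x δ_x⟩`. It is the
continuous extension of the restriction of functions `C_c(G) → C_c(X)`. -/
def condExp (a : 𝒢.ReducedCStar) : C₀(X, ℂ) where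
  toFun := 𝒢.diagCoeff (𝒢.toFam a)
  continuous_toFun := by
    refine continuous_of_uniform_approx_of_continuous fun u hu => ?_
    obtain ⟨ε, hε, hu⟩ := Metric.mem_uniformity_dist.1 hu
    obtain ⟨f, hf⟩ := 𝒢.exists_approx a hε
    exact ⟨fun x => f (𝒢.unit x), f.continuous.comp 𝒢.continuous_unit, fun x => hu (hf x)⟩
  zero_at_infty' := by
    rw [Metric.tendsto_nhds]
    intro ε hε
    obtain ⟨f, hf⟩ := 𝒢.exists_approx a hε
    have hK : IsCompact (𝒢.unit ⁻¹' tsupport f) :=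
      𝒢.isClosedEmbedding_unit.isCompact_preimage f.hasCompactSupport
    filter_upwards [hK.compl_mem_cocompact] with x hx
    have h0 : f (𝒢.unit x) = 0 := image_eq_zero_of_notMem_tsupport hx
    have := hf x
    rwa [h0] at this

theorem condExp_ofCc (f : C_c(G, ℂ)) (x : X) : 𝒢.condExp (𝒢.ofCc f) x = f (𝒢.unit x) :=
  𝒢.diagCoeff_regFam f x

theorem norm_condExp_apply_le (a : 𝒢.ReducedCStar) (x : X) : ‖𝒢.condExp a x‖ ≤ ‖a‖ :=
  𝒢.norm_diagCoeff_le (𝒢.toFam a) x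

end ReducedAlgebra

/-- A continuous homomorphism `c : G → ℝ`. -/
structure RealHom {G X : Type*} [TopologicalSpace G] [TopologicalSpace X]
    (𝒢 : EtaleGroupoid G X) where
  /-- the underlying function -/
  toFun : G → ℝ
  continuous_toFun : Continuous toFun
  map_mul : ∀ g h, 𝒢.s g = 𝒢.r h → toFun (𝒢.mul g h) = toFun g + toFun h

section Action

variable {G X : Type*} [TopologicalSpace G] [TopologicalSpace X]
  {𝒢 : EtaleGroupoid G X} (c : 𝒢.RealHom)

instance : CoeFun 𝒢.RealHom fun _ => G → ℝ := ⟨RealHom.toFun⟩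

theorem RealHom.map_mul_inv {g k : G} (e : 𝒢.s g = 𝒢.s k) : c (𝒢.mul g (𝒢.inv k)) = c g - c k := by
  have h := c.map_mul (𝒢.mul g (𝒢.inv k)) k
    (by rw [𝒢.s_mul _ _ (e.trans (𝒢.r_inv k).symm), 𝒢.s_inv])
  rw [𝒢.inv_mul_cancel_right e] at h
  linarith

/-- The function `g ↦ e^{itc(g)}`. -/
def phase (t : ℝ) (g : G) : ℂ := Complex.exp (Complex.I * t * c g)

theorem norm_phase (t : ℝ) (g : G) : ‖phase c t g‖ = 1 := by
  rw [phase, Complex.norm_exp]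
  simp

theorem phase_neg (t : ℝ) (g : G) : phase c (-t) g = starRingEnd ℂ (phase c t g) := by
  rw [phase, phase, ← Complex.exp_conj]
  simp

theorem phase_neg_mul (t : ℝ) (g : G) : phase c (-t) g * phase c t g = 1 := by
  rw [phase, phase, ← Complex.exp_add]
  simp

/-- The function `e^{itc} f` for `f ∈ C_c(G)`. -/
def twist (t : ℝ) (f : C_c(G, ℂ)) : C_c(G, ℂ) where
  toFun g := phase c t g * f g
  continuous_toFun := by
    have := c.continuous_toFun
    have := f.continuous
    unfold phase
    fun_prop
  hasCompactSupport' := f.hasCompactSupport.mul_left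

/-- The unitary `u_t` on `ℓ²(G_x)` given by multiplication with `e^{itc}`. -/
def unitaryOp (t : ℝ) (x : X) : 𝒢.Ell2 x →L[ℂ] 𝒢.Ell2 x :=
  LinearMap.mkContinuous
    { toFun := fun ψ => ⟨fun g => phase c t g * ψ g, memℓp_gen (by
        simpa only [norm_mul, norm_phase, one_mul] using (lp.memℓp ψ).summable (by simp))⟩
      map_add' := fun φ ψ => lp.ext (funext fun g => mul_add _ _ _)
      map_smul' := fun a ψ => lp.ext (funext fun g => mul_left_comm _ _ _) }
    1 fun ψ => lp.norm_le_of_forall_sum_le (by simp) (by positivity) fun S => by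
      rw [one_mul]
      refine le_trans (le_of_eq ?_) (lp.sum_rpow_le_norm_rpow (by simp) ψ S)
      refine Finset.sum_congr rfl fun g _ => ?_
      change ‖phase c t g * ψ g‖ ^ _ = _
      rw [norm_mul, norm_phase, one_mul]

theorem unitaryOp_apply (t : ℝ) (x : X) (ψ : 𝒢.Ell2 x) (g : {g : G // 𝒢.s g = x}) :
    unitaryOp c t x ψ g = phase c t g * ψ g := rfl

/-- The family `(u_t)_x` of unitaries. -/
def unitaryFam (t : ℝ) : 𝒢.BddFam :=
  (⟨fun x => unitaryOp c t x, memℓp_infty ⟨1, by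
    rintro _ ⟨x, rfl⟩
    exact LinearMap.mkContinuous_norm_le _ zero_le_one _⟩⟩ :
    lp (fun x : X => 𝒢.Ell2 x →L[ℂ] 𝒢.Ell2 x) ∞)

theorem unitaryFam_op (t : ℝ) (x : X) : (unitaryFam c t).op x = unitaryOp c t x := rfl

theorem unitaryFam_neg_mul (t : ℝ) (T : 𝒢.BddFam) : unitaryFam c (-t) * (unitaryFam c t * T) = T := by
  refine BddFam.ext fun x => ContinuousLinearMap.ext fun ψ => lp.ext (funext fun g => ?_)
  change phase c (-t) g * (phase c t g * T.op x ψ g) = T.op x ψ g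
  rw [← _root_.mul_assoc, phase_neg_mul, one_mul]

theorem mul_unitaryFam_neg (t : ℝ) (T : 𝒢.BddFam) : T * unitaryFam c t * unitaryFam c (-t) = T := by
  refine BddFam.ext fun x => ContinuousLinearMap.ext fun ψ => ?_
  change T.op x (unitaryOp c t x (unitaryOp c (-t) x ψ)) = T.op x ψ
  congr 1
  refine lp.ext (funext fun g => ?_)
  change phase c t g * (phase c (-t) g * ψ g) = ψ g
  rw [mul_left_comm, ← _root_.mul_assoc, phase_neg_mul, one_mul]

theorem conj_neg_conj (t : ℝ) (T : 𝒢.BddFam) :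
    unitaryFam c (-t) * (unitaryFam c t * T * unitaryFam c (-t)) * unitaryFam c (- -t) = T := by
  rw [_root_.mul_assoc (unitaryFam c t), unitaryFam_neg_mul, mul_unitaryFam_neg]

theorem star_unitaryFam (t : ℝ) : star (unitaryFam c t) = unitaryFam c (-t) := by
  refine BddFam.ext fun x => 𝒢.clm_ext fun k g => ?_
  change (ContinuousLinearMap.adjoint (unitaryOp c t x)) (𝒢.delta x k) g =
    unitaryOp c (-t) x (𝒢.delta x k) g
  rw [← 𝒢.inner_delta x g (ContinuousLinearMap.adjoint _ _), ContinuousLinearMap.adjoint_inner_right,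
    ← inner_conj_symm, 𝒢.inner_delta, unitaryOp_apply, unitaryOp_apply, map_mul, phase_neg]
  classical
  by_cases h : g = k
  · subst h
    simp [delta]
  · simp [delta, lp.single_apply, h, Ne.symm h]

theorem regFam_twist (t : ℝ) (f : C_c(G, ℂ)) :
    𝒢.regFam (twist c t f) = unitaryFam c t * 𝒢.regFam f * unitaryFam c (-t) := by
  refine BddFam.ext fun x => 𝒢.clm_ext fun k g => ?_
  have h1 : unitaryOp c (-t) x (𝒢.delta x k) = phase c (-t) k • 𝒢.delta x k := by
    refine lp.ext (funext fun g => ?_)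
    rw [unitaryOp_apply, lp.coeFn_smul, Pi.smul_apply, smul_eq_mul]
    classical
    by_cases h : g = k
    · rw [h]
    · simp [delta, lp.single_apply, h]
  change 𝒢.regRep (twist c t f) x (𝒢.delta x k) g =
    phase c t g * 𝒢.regRep f x (unitaryOp c (-t) x (𝒢.delta x k)) g
  rw [h1, map_smul, lp.coeFn_smul, Pi.smul_apply, smul_eq_mul, regRep_delta, regRep_delta]
  change phase c t _ * f _ = _
  rw [← _root_.mul_assoc]
  congr 1
  rw [phase, phase, phase, ← Complex.exp_add, c.map_mul_inv (g.2.trans k.2.symm)]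
  congr 1
  push_cast
  ring

variable [T2Space G] [LocallyCompactSpace G]

theorem conj_mem (t : ℝ) (a : 𝒢.ReducedCStar) :
    unitaryFam c t * 𝒢.toFam a * unitaryFam c (-t) ∈ 𝒢.convAlg.topologicalClosure :=
  map_mem_closure (f := fun T => unitaryFam c t * T * unitaryFam c (-t)) (by fun_prop)
    (𝒢.toFam_mem a) (by rintro _ ⟨f, rfl⟩; exact ⟨twist c t f, regFam_twist c t f⟩)

/-- The automorphism `σ^c_t` of `C*_r(G)`, implemented in each representation `π_x` by the unitary
`u_t`; it is the continuous extension of the map `f ↦ e^{itc} f` of `C_c(G)`. -/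
def sigma (t : ℝ) : 𝒢.ReducedCStar ≃⋆ₐ[ℂ] 𝒢.ReducedCStar where
  toFun a := (⟨_, conj_mem c t a⟩ : 𝒢.convAlg.topologicalClosure)
  invFun a := (⟨_, conj_mem c (-t) a⟩ : 𝒢.convAlg.topologicalClosure)
  left_inv a := 𝒢.toFam_injective (conj_neg_conj c t (𝒢.toFam a))
  right_inv a := 𝒢.toFam_injective <| by
    have h := conj_neg_conj c (-t) (𝒢.toFam a)
    rw [neg_neg] at h
    change unitaryFam c t * (unitaryFam c (-t) * 𝒢.toFam a * unitaryFam c (- -t)) *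
      unitaryFam c (-t) = 𝒢.toFam a
    rwa [neg_neg]
  map_mul' a b := 𝒢.toFam_injective <| by
    change unitaryFam c t * (𝒢.toFam a * 𝒢.toFam b) * unitaryFam c (-t) =
      (unitaryFam c t * 𝒢.toFam a * unitaryFam c (-t)) *
        (unitaryFam c t * 𝒢.toFam b * unitaryFam c (-t))
    simp only [_root_.mul_assoc, unitaryFam_neg_mul]
  map_add' a b := 𝒢.toFam_injective <| by
    change unitaryFam c t * (𝒢.toFam a + 𝒢.toFam b) * unitaryFam c (-t) =
      unitaryFam c t * 𝒢.toFam a * unitaryFam c (-t) +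
        unitaryFam c t * 𝒢.toFam b * unitaryFam c (-t)
    rw [_root_.mul_add, _root_.add_mul]
  map_star' a := 𝒢.toFam_injective <| by
    change unitaryFam c t * star (𝒢.toFam a) * unitaryFam c (-t) =
      star (unitaryFam c t * 𝒢.toFam a * unitaryFam c (-t))
    rw [star_mul, star_mul, star_unitaryFam, star_unitaryFam, neg_neg, _root_.mul_assoc]
  map_smul' z a := 𝒢.toFam_injective <| by
    change unitaryFam c t * (z • 𝒢.toFam a) * unitaryFam c (-t) =
      z • (unitaryFam c t * 𝒢.toFam a * unitaryFam c (-t))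
    rw [mul_smul_comm, smul_mul_assoc]

theorem sigma_ofCc (t : ℝ) (f : C_c(G, ℂ)) : sigma c t (𝒢.ofCc f) = 𝒢.ofCc (twist c t f) :=
  𝒢.toFam_injective (regFam_twist c t f).symm

end Action

section Measures

variable {G X : Type*} [TopologicalSpace G] [TopologicalSpace X]

/-- The inverse `r_W⁻¹ : r(W) → W` of the restriction of `r` to a set `W` on which `r` is
injective (with the value `unit x` at points `x` outside `r(W)`). -/
def rInv (𝒢 : EtaleGroupoid G X) (W : Set G) (x : X) : G :=
  open Classical in if h : ∃ g ∈ W, 𝒢.r g = x then h.choose else 𝒢.unit x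

theorem rInv_apply (𝒢 : EtaleGroupoid G X) {W : Set G} (hW : Set.InjOn 𝒢.r W) {g : G}
    (hg : g ∈ W) : 𝒢.rInv W (𝒢.r g) = g := by
  have h : ∃ g' ∈ W, 𝒢.r g' = 𝒢.r g := ⟨g, hg, rfl⟩
  rw [rInv, dif_pos h]
  exact hW h.choose_spec.1 hg h.choose_spec.2

/-- A measure `m` on the unit space is `(G, c)`-conformal with exponent `β` when
`m(s(W)) = ∫_{r(W)} exp(β c(r_W⁻¹(x))) dm(x)` for every open bisection `W`, that is, for every
open `W ⊆ G` on which `r` and `s` are injective. Both sides may be infinite. -/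
def IsConformal {𝒢 : EtaleGroupoid G X} (c : 𝒢.RealHom) (β : ℝ) [MeasurableSpace X]
    (m : MeasureTheory.Measure X) : Prop :=
  ∀ W : Set G, IsOpen W → Set.InjOn 𝒢.r W → Set.InjOn 𝒢.s W →
    m (𝒢.s '' W) = ∫⁻ x in 𝒢.r '' W, ENNReal.ofReal (Real.exp (β * c (𝒢.rInv W x))) ∂m

/-- The weight `φ_m(a) = ∫ P(a) dm` on the positive elements of `C*_r(G)`. -/
def weightOf [T2Space G] [LocallyCompactSpace G] [MeasurableSpace X] (𝒢 : EtaleGroupoid G X)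
    (m : MeasureTheory.Measure X) (a : {a : 𝒢.ReducedCStar // 0 ≤ a}) : ℝ≥0∞ :=
  ∫⁻ x, ENNReal.ofReal (𝒢.condExp a x).re ∂m

end Measures

end EtaleGroupoid

section Weights

variable {A : Type*} [NonUnitalCStarAlgebra A] [PartialOrder A] [StarOrderedRing A]

/-- A proper weight on a C*-algebra: a non-zero, densely defined, lower semi-continuous weight
`ψ : A₊ → [0, ∞]`. -/
structure IsProperWeight (ψ : {a : A // 0 ≤ a} → ℝ≥0∞) : Prop where
  map_add : ∀ a b : {a : A // 0 ≤ a}, ψ ⟨a + b, add_nonneg a.2 b.2⟩ = ψ a + ψ b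
  map_smul : ∀ (r : ℝ) (hr : 0 < r) (a : {a : A // 0 ≤ a}),
    ψ ⟨r • (a : A), smul_nonneg hr.le a.2⟩ = ENNReal.ofReal r * ψ a
  nonzero : ∃ a, ψ a ≠ 0
  denselyDefined : Dense {a | ψ a < ∞}
  lowerSemicontinuous : ∀ r : ℝ, 0 ≤ r → IsClosed {a | ψ a ≤ ENNReal.ofReal r}

/-- The set `𝒩_ψ = {a ∈ A | ψ(a*a) < ∞}`. -/
def weightN (ψ : {a : A // 0 ≤ a} → ℝ≥0∞) : Set A :=
  {a | ψ ⟨star a * a, star_mul_self_nonneg a⟩ < ∞}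

/-- The linear span `𝒩_ψ* 𝒩_ψ` of the products `a*b` with `a, b ∈ 𝒩_ψ`. -/
def weightDomain (ψ : {a : A // 0 ≤ a} → ℝ≥0∞) : Submodule ℂ A :=
  Submodule.span ℂ {x | ∃ a ∈ weightN ψ, ∃ b ∈ weightN ψ, x = star a * b}

theorem mul_mem_weightDomain {ψ : {a : A // 0 ≤ a} → ℝ≥0∞} {a b : A} (ha : star a ∈ weightN ψ)
    (hb : b ∈ weightN ψ) : a * b ∈ weightDomain ψ :=
  Submodule.subset_span ⟨star a, ha, b, hb, by rw [star_star]⟩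

/-- Invariance of `ψ : A₊ → [0, ∞]` under all the automorphisms `α_t`. -/
def IsInvariantWeight (ψ : {a : A // 0 ≤ a} → ℝ≥0∞) (α : ℝ → A ≃⋆ₐ[ℂ] A) : Prop :=
  ∀ (t : ℝ) (a : {a : A // 0 ≤ a}), ψ ⟨α t a, map_nonneg (α t) a.2⟩ = ψ a

theorem IsInvariantWeight.apply_mem {ψ : {a : A // 0 ≤ a} → ℝ≥0∞} {α : ℝ → A ≃⋆ₐ[ℂ] A}
    (h : IsInvariantWeight ψ α) (t : ℝ) {b : A} (hb : b ∈ weightN ψ) : α t b ∈ weightN ψ := by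
  have h1 := h t ⟨star b * b, star_mul_self_nonneg b⟩
  simp only [map_mul, map_star] at h1
  exact (congrArg (· < ∞) h1).mpr hb

theorem IsInvariantWeight.star_apply_mem {ψ : {a : A // 0 ≤ a} → ℝ≥0∞} {α : ℝ → A ≃⋆ₐ[ℂ] A}
    (h : IsInvariantWeight ψ α) (t : ℝ) {b : A} (hb : star b ∈ weightN ψ) :
    star (α t b) ∈ weightN ψ := by
  rw [← map_star]
  exact h.apply_mem t hb

/-- `L` is the linear extension of `ψ` to `𝒩_ψ* 𝒩_ψ`: it is finite on and agrees with `ψ` at the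
positive elements of that space. -/
def IsWeightExtension (ψ : {a : A // 0 ≤ a} → ℝ≥0∞) (L : weightDomain ψ →ₗ[ℂ] ℂ) : Prop :=
  ∀ (x : weightDomain ψ) (hx : 0 ≤ (x : A)), ψ ⟨x, hx⟩ < ∞ ∧ L x = ((ψ ⟨x, hx⟩).toReal : ℂ)

/-- The closed strip of all `z ∈ ℂ` whose imaginary part lies between `0` and `β`. -/
def closedStrip (β : ℝ) : Set ℂ := {z | z.im ∈ Set.uIcc 0 β}

/-- `β`-KMS weights for a one-parameter group `α` of automorphisms of `A`: proper weights `ψ` that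
are `α`-invariant and such that for all `a, b ∈ 𝒩_ψ ∩ 𝒩_ψ*` there is a continuous bounded function
`F` on the closed strip between `0` and `iβ`, holomorphic in its interior, with
`F(t) = ψ(a α_t(b))` and `F(t + iβ) = ψ(α_t(b) a)` for all real `t`. Here `ψ` is extended linearly
to `𝒩_ψ* 𝒩_ψ`; this extension `L` exists and is unique for every proper weight. -/
structure IsKMSWeight (ψ : {a : A // 0 ≤ a} → ℝ≥0∞) (α : ℝ → A ≃⋆ₐ[ℂ] A) (β : ℝ) : Prop where
  proper : IsProperWeight ψ
  invariant : IsInvariantWeight ψ α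
  kms : ∃ L : weightDomain ψ →ₗ[ℂ] ℂ, IsWeightExtension ψ L ∧
    ∀ (a b : A) (ha : a ∈ weightN ψ) (ha' : star a ∈ weightN ψ) (hb : b ∈ weightN ψ)
      (hb' : star b ∈ weightN ψ),
      ∃ F : ℂ → ℂ, ContinuousOn F (closedStrip β) ∧ (∃ C : ℝ, ∀ z ∈ closedStrip β, ‖F z‖ ≤ C) ∧
        DifferentiableOn ℂ F (interior (closedStrip β)) ∧
        ∀ t : ℝ, F t = L ⟨a * α t b, mul_mem_weightDomain ha' (invariant.apply_mem t hb)⟩ ∧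
          F (t + Complex.I * β) =
            L ⟨α t b * a, mul_mem_weightDomain (invariant.star_apply_mem t hb') ha⟩

end Weights

end

/-! An element `a` of the reduced algebra is treated as a function on the groupoid, through its
matrix coefficients `coef a g`. The basic identity is `P(a*b)(x) = ∑ conj a(g) b(g)`, summed over
the source fibre of `x` (`hasSum_condExp_star_mul`). Integrated against `m`, it says that `φ_m(a*b)`
is the inner product of `a` and `b` in `L²(μ)`, where `μ` is the integral over `m` of the counting
measures of the source fibres. Conformality of `m` is equivalent to the statement that inversion
carries `μ` to `e^{-βc} μ` (`isConformal_iff`).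

From measures to weights: for conformal `m` the KMS function of `a, b` is `F(z) = ∫ e^{izc(g)}
conj(a*(g)) b(g) dμ(g)`. On the real line it is `φ_m(a σ_t(b))`; at `t + iβ` the factor `e^{-βc}` is
absorbed by inversion, which exchanges the order of the product (`isKMSWeight_weightOf`).

From weights to measures: let `ψ` be a KMS weight. Elements of `𝒩_ψ ∩ 𝒩_ψ*` fixed by `σ^c` commute
with everything there under `ψ`, because their KMS function is constant on one edge of the strip and
hence on the other. Since `ker c` is open, time averages of any orbit converge in norm to a fixed
element (`exists_tendsto_orbitAvg`), so fixed elements of finite weight are plentiful. Together with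
the commutation property and lower semicontinuity this forces `C_c(X) ⊆ 𝒩_ψ`
(`diagElt_mem_weightN`), and Riesz representation yields a regular measure `m`.

To see that `ψ` factors through `P` on `C_c(G)`, localise around an arrow `g`
(`apply_ofCc_eq_integral`). If `r g ≠ s g`, commuting with a bump function kills the value; if `c g
≠ 0`, averaging does; otherwise `g` is isotropy in `ker c`, hence a unit, and the value is an
integral against `m` by construction. On compressions `p a p` with `p ∈ C_c(X)` the weights `ψ` and
`φ_m` therefore agree. Each of the two decreases under compression by `0 ≤ p ≤ 1` and is lower
semicontinuous, so they agree everywhere (`eq_weightOf`). Finally `F` and the explicit integral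
above coincide on the real line, hence at `iβ`, and this equality is conformality of `m`
(`integral_norm_sq_inv`). Injectivity holds because `φ_m` determines the integrals of functions in
`C_c(X)` (`weightOf_injOn_regular`). -/

/-! ### Uniqueness of bounded holomorphic functions in a strip -/

section StripUniqueness

open Complex

/-- A bounded continuous function on the closed strip that is holomorphic in the interior and
vanishes on the real line also vanishes on the other edge of the strip. -/
theorem eq_zero_on_edge_of_eq_zero_on_real {β : ℝ} {F : ℂ → ℂ}
    (hc : ContinuousOn F (closedStrip β)) (hb : ∃ C : ℝ, ∀ z ∈ closedStrip β, ‖F z‖ ≤ C)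
    (hd : DifferentiableOn ℂ F (interior (closedStrip β))) (h0 : ∀ t : ℝ, F t = 0) (t : ℝ) :
    F (t + I * β) = 0 := by
  rcases eq_or_ne β 0 with rfl | hβ
  · simpa using h0 t
  obtain ⟨C, hC⟩ := hb
  -- An affine map from the vertical strip `0 ≤ Re w ≤ 1` to `closedStrip β`, valid for either sign
  -- of `β`: the line `Re w = 0` goes to the real axis and `w = 1` to `t + iβ`.
  set e : ℂ → ℂ := fun w => t + I * β * w with he
  have hec : Continuous e := by fun_prop
  have him : ∀ w, (e w).im = β * w.re := fun w => by simp [he]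
  have hmaps : Set.MapsTo e (HadamardThreeLines.verticalClosedStrip 0 1) (closedStrip β) := by
    intro w hw
    obtain ⟨h1, h2⟩ : 0 ≤ w.re ∧ w.re ≤ 1 := hw
    change (e w).im ∈ Set.uIcc 0 β
    rw [him, Set.mem_uIcc]
    rcases le_total 0 β with h | h
    · exact Or.inl ⟨by positivity, by nlinarith⟩
    · exact Or.inr ⟨by nlinarith, by nlinarith⟩
  have hopen : IsOpen {z : ℂ | z.im ∈ Set.Ioo (min 0 β) (max 0 β)} :=
    isOpen_Ioo.preimage continuous_im
  have hint : {z : ℂ | z.im ∈ Set.Ioo (min 0 β) (max 0 β)} ⊆ interior (closedStrip β) :=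
    interior_maximal (fun z hz => Set.Ioo_subset_Icc_self hz) hopen
  have hmaps' : Set.MapsTo e (HadamardThreeLines.verticalStrip 0 1)
      (interior (closedStrip β)) := by
    intro w hw
    obtain ⟨h1, h2⟩ : 0 < w.re ∧ w.re < 1 := hw
    refine hint ?_
    change (e w).im ∈ Set.Ioo (min 0 β) (max 0 β)
    rw [him]
    rcases lt_or_gt_of_ne hβ with h | h
    · rw [min_eq_right h.le, max_eq_left h.le]
      exact ⟨by nlinarith, by nlinarith⟩
    · rw [min_eq_left h.le, max_eq_right h.le]
      exact ⟨by positivity, by nlinarith⟩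
  have hcl : closure (HadamardThreeLines.verticalStrip 0 1) =
      HadamardThreeLines.verticalClosedStrip 0 1 := by
    rw [HadamardThreeLines.verticalClosedStrip, ← closure_Ioo zero_ne_one, ← closure_preimage_re]
    rfl
  have hdiff : DiffContOnCl ℂ (F ∘ e) (HadamardThreeLines.verticalStrip 0 1) := by
    refine ⟨hd.comp (by fun_prop) hmaps', ?_⟩
    rw [hcl]
    exact hc.comp hec.continuousOn hmaps
  have hbdd : BddAbove ((norm ∘ (F ∘ e)) '' HadamardThreeLines.verticalClosedStrip 0 1) :=
    ⟨C, by rintro _ ⟨w, hw, rfl⟩; exact hC _ (hmaps hw)⟩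
  have hre : ∀ w : ℂ, w.re = 0 → F (e w) = 0 := by
    intro w hw
    have h1 : e w = ((t - β * w.im : ℝ) : ℂ) := by
      apply Complex.ext
      · simp [he, sub_eq_add_neg]
      · rw [him, hw]; simp
    rw [h1, h0]
  -- The three lines theorem bounds the norm by `0^(1-x) * C^x`, which vanishes only for `x < 1`;
  -- the edge `x = 1` is then reached by continuity.
  have hhalf : ∀ x : ℝ, 0 ≤ x → x < 1 → F (e x) = 0 := by
    intro x hx0 hx1
    have hmem : (x : ℂ) ∈ HadamardThreeLines.verticalClosedStrip 0 1 := ⟨by simpa, by simpa using hx1.le⟩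
    have h2 := HadamardThreeLines.norm_le_interp_of_mem_verticalClosedStrip₀₁' (F ∘ e)
      (a := 0) (b := C) hmem hdiff hbdd
      (fun w hw => by simp [Function.comp, hre w hw])
      (fun w hw => hC _ (hmaps ⟨by rw [show w.re = 1 from hw]; norm_num,
        by rw [show w.re = 1 from hw]⟩))
    rw [ofReal_re, Real.zero_rpow (by linarith), zero_mul] at h2
    exact norm_le_zero_iff.1 h2
  have hcx : ContinuousOn (fun x : ℝ => F (e x)) (Set.Icc 0 1) :=
    hc.comp (hec.comp continuous_ofReal).continuousOn
      fun x hx => hmaps ⟨by simpa using hx.1, by simpa using hx.2⟩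
  have hlim : Filter.Tendsto (fun x : ℝ => F (e x)) (nhdsWithin 1 (Set.Ico 0 1))
      (nhds (F (e (1 : ℝ)))) :=
    ((hcx 1 (by simp)).mono Set.Ico_subset_Icc_self)
  have hne : (nhdsWithin (1 : ℝ) (Set.Ico 0 1)).NeBot := by
    rw [← mem_closure_iff_nhdsWithin_neBot, closure_Ico zero_ne_one]
    simp
  have hlim0 : Filter.Tendsto (fun x : ℝ => F (e x)) (nhdsWithin 1 (Set.Ico 0 1)) (nhds 0) :=
    tendsto_const_nhds.congr' (by
      filter_upwards [self_mem_nhdsWithin] with x hx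
      exact (hhalf x hx.1 hx.2).symm)
  have := tendsto_nhds_unique hlim hlim0
  simpa [he] using this

end StripUniqueness

/-! ### Weights, the left ideal `𝒩_ψ` and linear extensions -/

section Weights

variable {A : Type*} [NonUnitalCStarAlgebra A] [PartialOrder A] [StarOrderedRing A]
  {ψ : {a : A // 0 ≤ a} → ℝ≥0∞}

open Classical in
/-- The extension of a weight to the whole algebra by the value `∞` off the positive cone. -/
noncomputable def posExt (ψ : {a : A // 0 ≤ a} → ℝ≥0∞) (a : A) : ℝ≥0∞ :=
  if h : 0 ≤ a then ψ ⟨a, h⟩ else ∞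

omit [StarOrderedRing A] in
theorem posExt_of_nonneg {a : A} (h : 0 ≤ a) : posExt ψ a = ψ ⟨a, h⟩ := dif_pos h

omit [StarOrderedRing A] in
theorem nonneg_of_posExt_lt {a : A} (h : posExt ψ a < ∞) : 0 ≤ a := by
  by_contra hn
  rw [posExt, dif_neg hn] at h
  exact lt_irrefl _ h

theorem mem_weightN {a : A} : a ∈ weightN ψ ↔ posExt ψ (star a * a) < ∞ := by
  rw [posExt_of_nonneg (star_mul_self_nonneg a)]
  rfl

namespace IsProperWeight

variable (hψ : IsProperWeight ψ)
include hψ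

theorem posExt_add {a b : A} (ha : 0 ≤ a) (hb : 0 ≤ b) :
    posExt ψ (a + b) = posExt ψ a + posExt ψ b := by
  rw [posExt_of_nonneg ha, posExt_of_nonneg hb, posExt_of_nonneg (add_nonneg ha hb)]
  exact hψ.map_add ⟨a, ha⟩ ⟨b, hb⟩

theorem posExt_smul {r : ℝ} (hr : 0 < r) {a : A} (ha : 0 ≤ a) :
    posExt ψ (r • a) = ENNReal.ofReal r * posExt ψ a := by
  rw [posExt_of_nonneg ha, posExt_of_nonneg (smul_nonneg hr.le ha)]
  exact hψ.map_smul r hr ⟨a, ha⟩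

theorem posExt_zero : posExt ψ 0 = 0 := by
  have : Nonempty {a : A // 0 ≤ a} := ⟨⟨0, le_rfl⟩⟩
  obtain ⟨⟨a, ha⟩, hfin⟩ := hψ.denselyDefined.nonempty
  have h := hψ.posExt_add ha le_rfl
  rw [add_zero, posExt_of_nonneg ha] at h
  have hne : ψ ⟨a, ha⟩ ≠ ∞ := ne_of_lt hfin
  exact (ENNReal.add_right_inj hne).1 (by rw [← h, add_zero])

theorem posExt_mono {a b : A} (ha : 0 ≤ a) (hab : a ≤ b) : posExt ψ a ≤ posExt ψ b := by
  have h := hψ.posExt_add ha (sub_nonneg.2 hab)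
  rw [add_sub_cancel] at h
  rw [h]
  exact le_self_add

theorem posExt_smul_lt {r : ℝ} (hr : 0 ≤ r) {a : A} (ha : posExt ψ a < ∞) :
    posExt ψ (r • a) < ∞ := by
  rcases hr.eq_or_lt with rfl | hr
  · rw [zero_smul, hψ.posExt_zero]; simp
  · rw [hψ.posExt_smul hr (nonneg_of_posExt_lt ha)]
    exact ENNReal.mul_lt_top ENNReal.ofReal_lt_top ha

theorem posExt_smul_le {r : ℝ} (hr : 0 ≤ r) {a : A} (ha : 0 ≤ a) :
    posExt ψ (r • a) ≤ ENNReal.ofReal r * posExt ψ a := by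
  rcases hr.eq_or_lt with rfl | hr
  · rw [zero_smul, hψ.posExt_zero]; simp
  · rw [hψ.posExt_smul hr ha]

/-- The value `∞` off the cone keeps finite sublevel sets inside the closed set `A₊`, so closedness
in `A₊` passes to closedness in `A`. Limits can then be taken in `A` without tracking positivity. -/
theorem isClosed_posExt_le {r : ℝ≥0∞} (hr : r ≠ ∞) : IsClosed {a : A | posExt ψ a ≤ r} := by
  have h1 := hψ.lowerSemicontinuous r.toReal ENNReal.toReal_nonneg
  rw [ENNReal.ofReal_toReal hr] at h1
  have h2 := (CStarAlgebra.isClosed_nonneg (A := A)).isClosedEmbedding_subtypeVal.isClosedMap _ h1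
  convert h2 using 1
  ext a
  constructor
  · intro (h : posExt ψ a ≤ r)
    have ha := nonneg_of_posExt_lt (h.trans_lt hr.lt_top)
    exact ⟨⟨a, ha⟩, by rwa [posExt_of_nonneg ha] at h, rfl⟩
  · rintro ⟨⟨a, ha⟩, h, rfl⟩
    change posExt ψ a ≤ r
    rwa [posExt_of_nonneg ha]

theorem posExt_le_of_tendsto {u : ℕ → A} {a : A} (hu : Filter.Tendsto u Filter.atTop (nhds a))
    {r : ℝ≥0∞} (h : ∀ n, posExt ψ (u n) ≤ r) : posExt ψ a ≤ r := by
  rcases eq_or_ne r ∞ with rfl | hr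
  · exact le_top
  · exact (hψ.isClosed_posExt_le hr).mem_of_tendsto hu (Filter.Eventually.of_forall h)

-- Conjugating `a*a ≤ ‖a*a‖` by `b`; this is what makes `𝒩_ψ` a left ideal.
omit hψ in
theorem star_mul_self_mul_le (a b : A) :
    star (a * b) * (a * b) ≤ ‖star a * a‖ • (star b * b) := by
  have := CStarAlgebra.star_left_conjugate_le_norm_smul (a := b) (b := star a * a)
    (IsSelfAdjoint.star_mul_self a)
  simpa [mul_assoc] using this

theorem mul_mem_weightN (a : A) {b : A} (hb : b ∈ weightN ψ) : a * b ∈ weightN ψ := by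
  rw [mem_weightN] at hb ⊢
  exact (hψ.posExt_mono (star_mul_self_nonneg _) (star_mul_self_mul_le a b)).trans_lt
    (hψ.posExt_smul_lt (norm_nonneg _) hb)

/-- The difference `2(a*a + b*b) - (a+b)*(a+b)` is the positive element `(a-b)*(a-b)`. -/
theorem posExt_parallelogram_le (a b : A) : posExt ψ (star (a + b) * (a + b)) ≤
    2 * (posExt ψ (star a * a) + posExt ψ (star b * b)) := by
  have h0 := add_nonneg (star_mul_self_nonneg a) (star_mul_self_nonneg b)
  have h1 : star (a + b) * (a + b) ≤ (2 : ℝ) • (star a * a + star b * b) := by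
    rw [← sub_nonneg]
    convert star_mul_self_nonneg (a - b) using 1
    simp only [star_add, star_sub, mul_add, add_mul, mul_sub, sub_mul, two_smul]
    abel
  refine (hψ.posExt_mono (star_mul_self_nonneg _) h1).trans_eq ?_
  rw [hψ.posExt_smul two_pos h0, hψ.posExt_add (star_mul_self_nonneg a) (star_mul_self_nonneg b)]
  simp

theorem add_mem_weightN {a b : A} (ha : a ∈ weightN ψ) (hb : b ∈ weightN ψ) :
    a + b ∈ weightN ψ := by
  rw [mem_weightN] at ha hb ⊢
  refine (hψ.posExt_parallelogram_le a b).trans_lt (ENNReal.mul_lt_top (by simp) ?_)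
  exact ENNReal.add_lt_top.2 ⟨ha, hb⟩

omit hψ [PartialOrder A] [StarOrderedRing A] in
theorem star_smul_mul_smul (z : ℂ) (a : A) :
    star (z • a) * (z • a) = (‖z‖ ^ 2 : ℝ) • (star a * a) := by
  rw [star_smul, smul_mul_assoc, mul_smul_comm, smul_smul]
  have : star z * z = ((‖z‖ ^ 2 : ℝ) : ℂ) := by
    rw [mul_comm]
    have := Complex.mul_conj' z
    push_cast
    exact this
  rw [this]
  exact Complex.coe_smul _ _

theorem smul_mem_weightN (z : ℂ) {a : A} (ha : a ∈ weightN ψ) : z • a ∈ weightN ψ := by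
  rw [mem_weightN, star_smul_mul_smul] at *
  exact hψ.posExt_smul_lt (by positivity) ha

theorem sub_mem_weightN {a b : A} (ha : a ∈ weightN ψ) (hb : b ∈ weightN ψ) :
    a - b ∈ weightN ψ := by
  have := hψ.add_mem_weightN ha (hψ.smul_mem_weightN (-1) hb)
  rwa [neg_one_smul, ← sub_eq_add_neg] at this

/-- A positive element of finite weight belongs to `𝒩_ψ`. -/
theorem mem_weightN_of_posExt_lt {a : A} (ha : posExt ψ a < ∞) : a ∈ weightN ψ := by
  -- With `a = b*b` of finite weight, `b` lies in `𝒩_ψ`, and so does `b* b` by the left ideal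
  -- property.
  obtain ⟨b, rfl⟩ := CStarAlgebra.nonneg_iff_eq_star_mul_self.1 (nonneg_of_posExt_lt ha)
  exact hψ.mul_mem_weightN _ (mem_weightN.2 ha)

omit hψ in
theorem mem_weightDomain_of_posExt_lt {a : A} (ha : posExt ψ a < ∞) : a ∈ weightDomain ψ := by
  obtain ⟨b, rfl⟩ := CStarAlgebra.nonneg_iff_eq_star_mul_self.1 (nonneg_of_posExt_lt ha)
  exact Submodule.subset_span ⟨b, mem_weightN.2 ha, b, mem_weightN.2 ha, rfl⟩

end IsProperWeight

/-- A linear functional on the whole algebra that extends `ψ` on `𝒩_ψ* 𝒩_ψ`. -/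
def IsWeightFunctional (ψ : {a : A // 0 ≤ a} → ℝ≥0∞) (Λ : A →ₗ[ℂ] ℂ) : Prop :=
  ∀ x, posExt ψ x < ∞ → Λ x = ((posExt ψ x).toReal : ℂ)

-- Expresses every product `a*b` by four positive elements, so that values of a linear extension on
-- `𝒩_ψ* 𝒩_ψ` are computed from the weight alone.
omit [PartialOrder A] [StarOrderedRing A] in
theorem polarization (a b : A) : (4 : ℂ) • (star a * b) =
    star (a + b) * (a + b) - star (a + (-1 : ℂ) • b) * (a + (-1 : ℂ) • b)
      - Complex.I • (star (a + Complex.I • b) * (a + Complex.I • b))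
      + Complex.I • (star (a + (-Complex.I) • b) * (a + (-Complex.I) • b)) := by
  simp only [star_add, star_smul, mul_add, add_mul, smul_mul_assoc, mul_smul_comm, smul_smul,
    smul_add]
  match_scalars <;> simp
  ring

namespace IsWeightFunctional

variable {Λ : A →ₗ[ℂ] ℂ} (hΛ : IsWeightFunctional ψ Λ) (hψ : IsProperWeight ψ)
include hΛ hψ

theorem apply_star_mul_eq {a b : A} (ha : a ∈ weightN ψ) (hb : b ∈ weightN ψ) :
    4 * Λ (star a * b) =
      ((posExt ψ (star (a + b) * (a + b))).toReal : ℂ)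
      - ((posExt ψ (star (a + (-1 : ℂ) • b) * (a + (-1 : ℂ) • b))).toReal : ℂ)
      - Complex.I * ((posExt ψ (star (a + Complex.I • b) * (a + Complex.I • b))).toReal : ℂ)
      + Complex.I * ((posExt ψ (star (a + (-Complex.I) • b) * (a + (-Complex.I) • b))).toReal : ℂ) := by
  have h : ∀ z : ℂ, posExt ψ (star (a + z • b) * (a + z • b)) < ∞ := fun z =>
    mem_weightN.1 (hψ.add_mem_weightN ha (hψ.smul_mem_weightN z hb))
  have h1 := congrArg Λ (polarization a b)
  have h2 := h 1
  rw [one_smul] at h2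
  simp only [map_add, map_sub, map_smul, smul_eq_mul] at h1
  rw [h1, hΛ _ h2, hΛ _ (h _), hΛ _ (h _), hΛ _ (h _)]

/-- A crude substitute for the Cauchy–Schwarz inequality: each of the four polarization terms is
controlled by the parallelogram estimate. -/
theorem norm_apply_star_mul_le {a b : A} (ha : a ∈ weightN ψ) (hb : b ∈ weightN ψ) :
    ‖Λ (star a * b)‖ ≤
      2 * ((posExt ψ (star a * a)).toReal + (posExt ψ (star b * b)).toReal) := by
  have ha' := mem_weightN.1 ha
  have hb' := mem_weightN.1 hb
  have h : ∀ z : ℂ, ‖z‖ = 1 → (posExt ψ (star (a + z • b) * (a + z • b))).toReal ≤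
      2 * ((posExt ψ (star a * a)).toReal + (posExt ψ (star b * b)).toReal) := by
    intro z hz
    have h1 := hψ.posExt_parallelogram_le a (z • b)
    rw [IsProperWeight.star_smul_mul_smul, hz, one_pow, one_smul] at h1
    have h2 := ENNReal.toReal_mono
      (ENNReal.mul_lt_top (by simp) (ENNReal.add_lt_top.2 ⟨ha', hb'⟩)).ne h1
    rwa [ENNReal.toReal_mul, ENNReal.toReal_add ha'.ne hb'.ne] at h2
  have key := hΛ.apply_star_mul_eq hψ ha hb
  have h4 : 4 * ‖Λ (star a * b)‖ ≤ 4 * (2 * ((posExt ψ (star a * a)).toReal +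
      (posExt ψ (star b * b)).toReal)) := by
    have h5 : 4 * ‖Λ (star a * b)‖ = ‖4 * Λ (star a * b)‖ := by simp
    rw [h5, key]
    have e1 := h 1 (by simp)
    rw [one_smul] at e1
    have e2 := h (-1) (by simp)
    have e3 := h Complex.I (by simp)
    have e4 := h (-Complex.I) (by simp)
    refine (norm_add_le _ _).trans ?_
    refine (add_le_add_left ((norm_sub_le _ _).trans
      (add_le_add_left (norm_sub_le _ _) _)) _).trans ?_
    simp only [norm_mul, Complex.norm_I, one_mul, Complex.norm_real, Real.norm_eq_abs,
      ENNReal.abs_toReal]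
    linarith
  linarith

/-- For `a*, b ∈ 𝒩_ψ` the functional `c ↦ ψ(a c b)` is bounded. -/
theorem exists_norm_apply_le {a b : A} (ha : star a ∈ weightN ψ) (hb : b ∈ weightN ψ) :
    ∃ C : ℝ, ∀ c : A, ‖Λ (a * c * b)‖ ≤ C * ‖c‖ := by
  set K := 2 * ((posExt ψ (star (star a) * star a)).toReal + (posExt ψ (star b * b)).toReal) with hK
  refine ⟨K, fun c => ?_⟩
  rcases eq_or_ne c 0 with rfl | hc
  · simp
  -- The available estimate is a sum rather than a product, hence not homogeneous in `c`;
  -- normalising `c` first makes the bound linear in `‖c‖`.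
  set d : A := ((‖c‖⁻¹ : ℝ) : ℂ) • c with hd
  have hcn : 0 < ‖c‖ := norm_pos_iff.2 hc
  have hdn : ‖d‖ = 1 := by
    rw [hd, norm_smul, Complex.norm_real, norm_inv, norm_norm, inv_mul_cancel₀ hcn.ne']
  have hcd : c = (‖c‖ : ℂ) • d := by
    rw [hd, smul_smul, ← Complex.ofReal_mul, mul_inv_cancel₀ hcn.ne', Complex.ofReal_one, one_smul]
  have h1 := hΛ.norm_apply_star_mul_le hψ ha (hψ.mul_mem_weightN d hb)
  rw [star_star, ← mul_assoc] at h1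
  have h2 : posExt ψ (star (d * b) * (d * b)) ≤ posExt ψ (star b * b) := by
    have := IsProperWeight.star_mul_self_mul_le d b
    rw [CStarRing.norm_star_mul_self, hdn, one_mul, one_smul] at this
    exact hψ.posExt_mono (star_mul_self_nonneg _) this
  have h3 : ‖Λ (a * d * b)‖ ≤ K := by
    refine h1.trans ?_
    rw [hK, star_star]
    gcongr
    exact (mem_weightN.1 hb).ne
  rw [hcd, mul_smul_comm, smul_mul_assoc, map_smul, norm_smul, Complex.norm_real, norm_norm]
  rw [norm_smul, hdn, Complex.norm_real, norm_norm, mul_one, mul_comm]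
  gcongr

end IsWeightFunctional

/-! ### The KMS condition and the centralizer -/

section KMS

variable {α : ℝ → A ≃⋆ₐ[ℂ] A} {β : ℝ}

theorem IsInvariantWeight.posExt_apply (h : IsInvariantWeight ψ α) (t : ℝ) {a : A} (ha : 0 ≤ a) :
    posExt ψ (α t a) = posExt ψ a := by
  rw [posExt_of_nonneg ha, posExt_of_nonneg (map_nonneg (α t) ha)]
  exact h t ⟨a, ha⟩

theorem IsWeightFunctional.apply_star_mul_invariant {Λ : A →ₗ[ℂ] ℂ} (hΛ : IsWeightFunctional ψ Λ)
    (hψ : IsProperWeight ψ) (h : IsInvariantWeight ψ α) (t : ℝ) {a b : A} (ha : a ∈ weightN ψ)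
    (hb : b ∈ weightN ψ) : Λ (α t (star a * b)) = Λ (star a * b) := by
  have h1 := hΛ.apply_star_mul_eq hψ (h.apply_mem t ha) (h.apply_mem t hb)
  have h2 := hΛ.apply_star_mul_eq hψ ha hb
  simp only [← map_smul, ← map_add, ← map_star, ← map_mul,
    h.posExt_apply t (star_mul_self_nonneg _)] at h1
  rw [← h2] at h1
  exact mul_left_cancel₀ (by norm_num : (4 : ℂ) ≠ 0) h1

/-- The KMS condition for a functional on the whole algebra. -/
def IsKMSFunctional (ψ : {a : A // 0 ≤ a} → ℝ≥0∞) (α : ℝ → A ≃⋆ₐ[ℂ] A) (β : ℝ)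
    (Λ : A →ₗ[ℂ] ℂ) : Prop :=
  ∀ a b : A, a ∈ weightN ψ → star a ∈ weightN ψ → b ∈ weightN ψ → star b ∈ weightN ψ →
    ∃ F : ℂ → ℂ, ContinuousOn F (closedStrip β) ∧ (∃ C : ℝ, ∀ z ∈ closedStrip β, ‖F z‖ ≤ C) ∧
      DifferentiableOn ℂ F (interior (closedStrip β)) ∧
      ∀ t : ℝ, F t = Λ (a * α t b) ∧ F (t + Complex.I * β) = Λ (α t b * a)

/-- Any algebraic extension of the functional from `𝒩_ψ* 𝒩_ψ` to `A` serves, and no continuity is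
claimed. Its values elsewhere are arbitrary; the extension only removes membership proofs from later
formulas. -/
theorem IsKMSWeight.exists_functional (h : IsKMSWeight ψ α β) :
    ∃ Λ : A →ₗ[ℂ] ℂ, IsWeightFunctional ψ Λ ∧ IsKMSFunctional ψ α β Λ := by
  obtain ⟨L, hL, hkms⟩ := h.kms
  obtain ⟨Λ, hΛ⟩ := LinearMap.exists_extend L
  have hΛ' : ∀ x : weightDomain ψ, Λ x = L x := fun x => congrArg (fun f => f x) hΛ
  refine ⟨Λ, fun x hx => ?_, fun a b ha ha' hb hb' => ?_⟩
  · have h0 := nonneg_of_posExt_lt hx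
    have h1 := hL ⟨x, IsProperWeight.mem_weightDomain_of_posExt_lt hx⟩ h0
    rw [← hΛ'] at h1
    rw [posExt_of_nonneg h0]
    exact h1.2
  · obtain ⟨F, h1, h2, h3, h4⟩ := hkms a b ha ha' hb hb'
    refine ⟨F, h1, h2, h3, fun t => ?_⟩
    rw [(h4 t).1, (h4 t).2, ← hΛ', ← hΛ']
    exact ⟨rfl, rfl⟩

/-- Elements of `𝒩_ψ ∩ 𝒩_ψ*` that are fixed by `α` are in the centralizer of the functional. -/
theorem IsKMSFunctional.apply_mul_comm {Λ : A →ₗ[ℂ] ℂ} (h : IsKMSFunctional ψ α β Λ) {a b : A}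
    (ha : a ∈ weightN ψ) (ha' : star a ∈ weightN ψ) (hb : b ∈ weightN ψ) (hb' : star b ∈ weightN ψ)
    (hfix : ∀ t, α t b = b) : Λ (a * b) = Λ (b * a) := by
  obtain ⟨F, h1, ⟨C, h2⟩, h3, h4⟩ := h a b ha ha' hb hb'
  simp only [hfix] at h4
  -- As `b` is fixed, `F` is the constant `Λ (a * b)` on the real line; after subtraction of this
  -- constant, uniqueness gives the value on the other edge, which is `Λ (b * a)`.
  have := eq_zero_on_edge_of_eq_zero_on_real (F := fun z => F z - Λ (a * b))
    (h1.sub continuousOn_const)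
    ⟨C + ‖Λ (a * b)‖, fun z hz => (norm_sub_le _ _).trans (by gcongr; exact h2 z hz)⟩
    (h3.sub (differentiableOn_const _)) (fun t => by simp [(h4 t).1]) 0
  simp only [(h4 0).2] at this
  exact (sub_eq_zero.1 this).symm

end KMS

end Weights

/-! ### Fourier–Laplace integrals on a strip -/

section StripTransform

open MeasureTheory Complex

/-- The modulus is `e^{-x Im z}` with `Im z` between `0` and `β`, so it lies between `1` and
`e^{-βx}`, whatever the signs of `x` and `β`; the sum of the two dominates. -/
theorem norm_cexp_I_mul_le {β : ℝ} {z : ℂ} (hz : z ∈ closedStrip β) (x : ℝ) :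
    ‖cexp (I * z * x)‖ ≤ 1 + Real.exp (-β * x) := by
  have hre : (I * z * x).re = -z.im * x := by simp
  rw [norm_exp, hre]
  have hz' : z.im ∈ Set.uIcc 0 β := hz
  have h : -z.im * x ≤ 0 ∨ -z.im * x ≤ -β * x := by
    rcases Set.mem_uIcc.1 hz' with ⟨h1, h2⟩ | ⟨h1, h2⟩ <;> rcases le_total 0 x with hx | hx
    · exact Or.inl (by nlinarith)
    · exact Or.inr (by nlinarith)
    · exact Or.inr (by nlinarith)
    · exact Or.inl (by nlinarith)
  rcases h with h | h
  · have := Real.exp_le_one_iff.2 h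
    have := Real.exp_pos (-β * x)
    linarith
  · have := Real.exp_le_exp.2 h
    linarith

/-- The domination needed for differentiating under the integral. The factor `|x|` is at most `(4/ε)
e^{|x|ε/4}`, and this exponential only moves `Im w` by `±ε/4`. Since `w` is within `ε/2` of `z`, the
moved point is still in the strip, where the previous bound applies. -/
theorem norm_mul_cexp_I_mul_le {β : ℝ} {z w : ℂ} {ε : ℝ} (hε : 0 < ε)
    (hz : Metric.ball z ε ⊆ closedStrip β) (hw : w ∈ Metric.ball z (ε / 2)) (x : ℝ) :
    ‖(x : ℂ) * cexp (I * w * x)‖ ≤ 4 / ε * (1 + Real.exp (-β * x)) := by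
  have hmem : ∀ s : ℝ, |s| ≤ ε / 4 → w + s * I ∈ closedStrip β := by
    intro s hs
    refine hz ?_
    rw [Metric.mem_ball, dist_eq_norm] at hw ⊢
    calc ‖w + s * I - z‖ ≤ ‖w - z‖ + ‖s * I‖ := by
          rw [show w + s * I - z = (w - z) + s * I by ring]
          exact norm_add_le _ _
      _ < ε / 2 + ε / 2 := by
          have : ‖(s : ℂ) * I‖ = |s| := by simp
          rw [this]
          linarith
      _ = ε := by ring
  have key : ∀ s : ℝ, |s| ≤ ε / 4 → Real.exp (-w.im * x) * Real.exp (-s * x) ≤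
      1 + Real.exp (-β * x) := by
    intro s hs
    have h1 := norm_cexp_I_mul_le (hmem s hs) x
    rw [norm_exp] at h1
    have h2 : (I * (w + s * I) * x).re = -w.im * x + -s * x := by
      simp
      ring
    rwa [h2, Real.exp_add] at h1
  rw [norm_mul, norm_real, Real.norm_eq_abs, norm_exp]
  have hre : (I * w * x).re = -w.im * x := by simp
  rw [hre]
  have hx : |x| * (ε / 4) ≤ Real.exp (|x| * (ε / 4)) := by
    have := Real.add_one_le_exp (|x| * (ε / 4))
    linarith
  have hs : Real.exp (-w.im * x) * Real.exp (|x| * (ε / 4)) ≤ 1 + Real.exp (-β * x) := by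
    rcases abs_cases x with ⟨h, -⟩ | ⟨h, -⟩
    · have := key (-(ε / 4)) (by rw [abs_neg, abs_of_pos (by positivity)])
      rwa [show - -(ε / 4) * x = |x| * (ε / 4) by rw [h]; ring] at this
    · have := key (ε / 4) (by rw [abs_of_pos (by positivity)])
      rwa [show -(ε / 4) * x = |x| * (ε / 4) by rw [h]; ring] at this
  have hpos := Real.exp_pos (-w.im * x)
  calc |x| * Real.exp (-w.im * x)
      = 4 / ε * (Real.exp (-w.im * x) * (|x| * (ε / 4))) := by field_simp
    _ ≤ 4 / ε * (Real.exp (-w.im * x) * Real.exp (|x| * (ε / 4))) := by gcongr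
    _ ≤ 4 / ε * (1 + Real.exp (-β * x)) := by gcongr

variable {Γ : Type*} [MeasurableSpace Γ] {μ : Measure Γ} {c : Γ → ℝ} {h : Γ → ℂ} {β : ℝ}

theorem integrable_strip_bound (h1 : Integrable h μ)
    (h2 : Integrable (fun g => Real.exp (-β * c g) • h g) μ) :
    Integrable (fun g => (1 + Real.exp (-β * c g)) * ‖h g‖) μ := by
  refine (h1.norm.add h2.norm).congr (Filter.Eventually.of_forall fun g => ?_)
  simp only [Pi.add_apply, norm_smul, Real.norm_eq_abs, Real.abs_exp]
  ring

theorem aestronglyMeasurable_strip (hc : Measurable c) (h1 : Integrable h μ) (z : ℂ) :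
    AEStronglyMeasurable (fun g => cexp (I * z * c g) * h g) μ := by
  refine AEStronglyMeasurable.mul ?_ h1.1
  exact (by fun_prop : Measurable fun g => cexp (I * z * c g)).aestronglyMeasurable

theorem continuousOn_stripTransform (hc : Measurable c) (h1 : Integrable h μ)
    (h2 : Integrable (fun g => Real.exp (-β * c g) • h g) μ) :
    ContinuousOn (fun z => ∫ g, cexp (I * z * c g) * h g ∂μ) (closedStrip β) := by
  refine continuousOn_of_dominated (fun z _ => aestronglyMeasurable_strip hc h1 z)
    (fun z hz => Filter.Eventually.of_forall fun g => ?_) (integrable_strip_bound h1 h2)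
    (Filter.Eventually.of_forall fun g => by fun_prop)
  rw [norm_mul]
  gcongr
  exact norm_cexp_I_mul_le hz _

theorem norm_stripTransform_le (h1 : Integrable h μ)
    (h2 : Integrable (fun g => Real.exp (-β * c g) • h g) μ) {z : ℂ} (hz : z ∈ closedStrip β) :
    ‖∫ g, cexp (I * z * c g) * h g ∂μ‖ ≤ ∫ g, (1 + Real.exp (-β * c g)) * ‖h g‖ ∂μ := by
  refine norm_integral_le_of_norm_le (integrable_strip_bound h1 h2)
    (Filter.Eventually.of_forall fun g => ?_)
  rw [norm_mul]
  gcongr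
  exact norm_cexp_I_mul_le hz _

theorem differentiableOn_stripTransform (hc : Measurable c) (h1 : Integrable h μ)
    (h2 : Integrable (fun g => Real.exp (-β * c g) • h g) μ) :
    DifferentiableOn ℂ (fun z => ∫ g, cexp (I * z * c g) * h g ∂μ)
      (interior (closedStrip β)) := by
  intro z hz
  obtain ⟨ε, hε, hball⟩ := Metric.mem_nhds_iff.1 (mem_interior_iff_mem_nhds.1 hz)
  have hmeas : AEStronglyMeasurable (fun g => (I * c g * cexp (I * z * c g)) * h g) μ := by
    refine AEStronglyMeasurable.mul ?_ h1.1
    exact (by fun_prop : Measurable fun g => I * c g * cexp (I * z * c g)).aestronglyMeasurable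
  have := (hasDerivAt_integral_of_dominated_loc_of_deriv_le (μ := μ)
    (F := fun z g => cexp (I * z * c g) * h g)
    (F' := fun z g => (I * c g * cexp (I * z * c g)) * h g)
    (bound := fun g => 4 / ε * ((1 + Real.exp (-β * c g)) * ‖h g‖))
    (Metric.ball_mem_nhds z (half_pos hε))
    (Filter.Eventually.of_forall fun w => aestronglyMeasurable_strip hc h1 w)
    ((integrable_strip_bound h1 h2).mono' (aestronglyMeasurable_strip hc h1 z)
      (Filter.Eventually.of_forall fun g => by
        rw [norm_mul]
        gcongr
        exact norm_cexp_I_mul_le (interior_subset hz) _))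
    hmeas
    (Filter.Eventually.of_forall fun g w hw => by
      have h3 := norm_mul_cexp_I_mul_le hε hball hw (c g)
      rw [norm_mul, mul_assoc I, norm_mul I, norm_I, one_mul, ← mul_assoc (4 / ε)]
      gcongr)
    ((integrable_strip_bound h1 h2).const_mul _)
    (Filter.Eventually.of_forall fun g w _ => by
      have h4 : HasDerivAt (fun w : ℂ => I * w * c g) (I * c g) w := by
        simpa using ((hasDerivAt_id w).const_mul I).mul_const (c g : ℂ)
      have h5 := h4.cexp.mul_const (h g)
      rwa [mul_comm (cexp _)] at h5)).2
  exact this.differentiableAt.differentiableWithinAt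

end StripTransform

namespace EtaleGroupoid

/-! ### Units, inverses and the cocycle -/

section Units

variable {G X : Type*} [TopologicalSpace G] [TopologicalSpace X] (𝒢 : EtaleGroupoid G X)

theorem mem_range_unit_iff {g : G} : g ∈ Set.range 𝒢.unit ↔ 𝒢.unit (𝒢.r g) = g :=
  ⟨by rintro ⟨x, rfl⟩; exact congrArg _ (𝒢.r_unit x), fun h => ⟨_, h⟩⟩

/-- For `g` near a unit, both `g` and `unit (r g)` lie in one domain of injectivity of `r` and have
the same range, so they coincide. -/
theorem isOpen_range_unit : IsOpen (Set.range 𝒢.unit) := by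
  rw [isOpen_iff_mem_nhds]
  rintro _ ⟨x, rfl⟩
  obtain ⟨e, he, her⟩ := 𝒢.isLocalHomeomorph_r (𝒢.unit x)
  have h1 : e.source ∈ nhds (𝒢.unit x) := e.open_source.mem_nhds he
  have h2 : (fun g => 𝒢.unit (𝒢.r g)) ⁻¹' e.source ∈ nhds (𝒢.unit x) := by
    refine (𝒢.continuous_unit.comp 𝒢.continuous_r).continuousAt ?_
    simpa only [Function.comp, 𝒢.r_unit] using h1
  filter_upwards [h1, h2] with g hg hg'
  refine 𝒢.mem_range_unit_iff.2 (e.injOn hg' hg ?_)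
  rw [← her, 𝒢.r_unit]

theorem unit_inv (x : X) : 𝒢.inv (𝒢.unit x) = 𝒢.unit x := by
  refine (𝒢.inv_unique (by rw [𝒢.s_unit, 𝒢.r_unit]) ?_).symm
  have h := 𝒢.unit_mul (𝒢.unit x)
  rw [𝒢.r_unit] at h
  rw [h, 𝒢.s_unit]

theorem mul_unit_inv (x : X) {g : G} (h : 𝒢.s g = x) : 𝒢.mul g (𝒢.inv (𝒢.unit x)) = g := by
  rw [𝒢.unit_inv, ← h, 𝒢.mul_unit]

theorem inv_bijective : Function.Bijective 𝒢.inv :=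
  Function.Involutive.bijective 𝒢.inv_inv

/-- The inversion as a homeomorphism. -/
def invHomeo : G ≃ₜ G where
  toFun := 𝒢.inv
  invFun := 𝒢.inv
  left_inv := 𝒢.inv_inv
  right_inv := 𝒢.inv_inv
  continuous_toFun := 𝒢.continuous_inv
  continuous_invFun := 𝒢.continuous_inv

variable {𝒢} (c : 𝒢.RealHom)

theorem RealHom.map_unit (x : X) : c (𝒢.unit x) = 0 := by
  have h := c.map_mul (𝒢.unit x) (𝒢.unit x) (by rw [𝒢.s_unit, 𝒢.r_unit])
  have h1 := 𝒢.unit_mul (𝒢.unit x)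
  rw [𝒢.r_unit] at h1
  rw [h1] at h
  linarith

theorem RealHom.map_inv (g : G) : c (𝒢.inv g) = -c g := by
  have h := c.map_mul (𝒢.inv g) g (𝒢.s_inv g)
  rw [𝒢.inv_mul, c.map_unit] at h
  linarith

theorem phase_unit (t : ℝ) (x : X) : phase c t (𝒢.unit x) = 1 := by
  rw [phase, c.map_unit]
  simp

end Units

/-! ### Bump functions on the unit space -/

section Topology

variable {X : Type*} [TopologicalSpace X] [T2Space X] [LocallyCompactSpace X]

/-- Urysohn's lemma in terms of compactly supported functions. -/
theorem exists_bump {K U : Set X} (hK : IsCompact K) (hU : IsOpen U) (hKU : K ⊆ U) :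
    ∃ p : C_c(X, ℝ), (∀ x ∈ K, p x = 1) ∧ tsupport p ⊆ U ∧ ∀ x, 0 ≤ p x ∧ p x ≤ 1 := by
  obtain ⟨f, h1, h2, h3, h4⟩ := exists_continuousMap_one_of_isCompact_subset_isOpen hK hU hKU
  exact ⟨⟨f, h2⟩, h1, h3, h4⟩

end Topology

/-! ### The copy of `C_c(X)` inside the reduced algebra -/

section Diag

variable {G X : Type*} [TopologicalSpace G] [TopologicalSpace X] [T2Space G] [LocallyCompactSpace G]
  (𝒢 : EtaleGroupoid G X)

theorem locallyCompactSpace_units (𝒢 : EtaleGroupoid G X) : LocallyCompactSpace X :=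
  𝒢.isClosedEmbedding_unit.locallyCompactSpace

/-- A compactly supported function on the unit space as a function on the groupoid. -/
noncomputable def diag (p : C_c(X, ℝ)) : C_c(G, ℂ) where
  toFun := (Set.range 𝒢.unit).indicator fun g => (p (𝒢.r g) : ℂ)
  continuous_toFun := by
    have h : IsClopen (Set.range 𝒢.unit) :=
      ⟨𝒢.isClosedEmbedding_unit.isClosed_range, 𝒢.isOpen_range_unit⟩
    have h1 : (Set.range 𝒢.unit).indicator (fun g => (p (𝒢.r g) : ℂ)) =
        fun g => LocallyConstant.charFn ℂ h g * (p (𝒢.r g) : ℂ) := by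
      funext g
      rw [LocallyConstant.coe_charFn]
      by_cases hg : g ∈ Set.range 𝒢.unit <;> simp [hg]
    rw [h1]
    have := (LocallyConstant.charFn ℂ h).continuous
    have := 𝒢.continuous_r
    fun_prop
  hasCompactSupport' := by
    refine HasCompactSupport.intro (p.hasCompactSupport.isCompact.image 𝒢.continuous_unit)
      fun g hg => ?_
    by_cases h : g ∈ Set.range 𝒢.unit
    · obtain ⟨x, rfl⟩ := h
      rw [Set.indicator_of_mem (Set.mem_range_self x), 𝒢.r_unit,
        image_eq_zero_of_notMem_tsupport (fun hx => hg ⟨x, hx, rfl⟩), Complex.ofReal_zero]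
    · exact Set.indicator_of_notMem h _

omit [LocallyCompactSpace G] in
theorem diag_unit (p : C_c(X, ℝ)) (x : X) : 𝒢.diag p (𝒢.unit x) = p x := by
  change (Set.range 𝒢.unit).indicator (fun g => (p (𝒢.r g) : ℂ)) _ = _
  rw [Set.indicator_of_mem (Set.mem_range_self x), 𝒢.r_unit]

omit [LocallyCompactSpace G] in
theorem diag_of_notMem (p : C_c(X, ℝ)) {g : G} (hg : g ∉ Set.range 𝒢.unit) : 𝒢.diag p g = 0 := by
  change (Set.range 𝒢.unit).indicator (fun g => (p (𝒢.r g) : ℂ)) g = 0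
  exact Set.indicator_of_notMem hg _

/-- The embedding of `C_c(X)` in `C*_r(G)`. -/
noncomputable def diagElt (p : C_c(X, ℝ)) : 𝒢.ReducedCStar := 𝒢.ofCc (𝒢.diag p)

-- Only the unit at `r g` contributes to the convolution sum. Hence `C_c(X)` acts by multiplication
-- operators, and the algebraic identities for `diagElt` reduce to pointwise ones.
omit [LocallyCompactSpace G] in
theorem regFun_diag (p : C_c(X, ℝ)) (x : X) (ψ : {g : G // 𝒢.s g = x} → ℂ)
    (g : {g : G // 𝒢.s g = x}) : 𝒢.regFun (𝒢.diag p) x ψ g = p (𝒢.r g) * ψ g := by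
  rw [regFun, tsum_eq_single ⟨𝒢.unit (𝒢.r g), 𝒢.r_unit _⟩]
  · simp only [𝒢.diag_unit]
    congr 2
    exact Subtype.ext ((congrArg (𝒢.mul · g) (𝒢.unit_inv _)).trans (𝒢.unit_mul _))
  · rintro ⟨h, hh⟩ hne
    rw [𝒢.diag_of_notMem, zero_mul]
    rw [𝒢.mem_range_unit_iff, hh]
    exact fun h1 => hne (Subtype.ext h1.symm)

theorem toFam_diagElt_apply (p : C_c(X, ℝ)) (x : X) (ψ : 𝒢.Ell2 x) (g : {g : G // 𝒢.s g = x}) :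
    (𝒢.toFam (𝒢.diagElt p)).op x ψ g = p (𝒢.r g) * ψ g :=
  𝒢.regFun_diag p x ψ g

variable {𝒢} in
theorem reducedCStar_ext {a b : 𝒢.ReducedCStar}
    (h : ∀ x (ψ : 𝒢.Ell2 x) g, (𝒢.toFam a).op x ψ g = (𝒢.toFam b).op x ψ g) : a = b :=
  𝒢.toFam_injective (BddFam.ext fun x => ContinuousLinearMap.ext fun ψ =>
    lp.ext (funext fun g => h x ψ g))

theorem toFam_mul_apply (a b : 𝒢.ReducedCStar) (x : X) (ψ : 𝒢.Ell2 x) :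
    (𝒢.toFam (a * b)).op x ψ = (𝒢.toFam a).op x ((𝒢.toFam b).op x ψ) := rfl

theorem diagElt_mul (p q : C_c(X, ℝ)) : 𝒢.diagElt (p * q) = 𝒢.diagElt p * 𝒢.diagElt q := by
  refine reducedCStar_ext fun x ψ g => ?_
  rw [toFam_mul_apply, toFam_diagElt_apply, toFam_diagElt_apply, toFam_diagElt_apply,
    CompactlySupportedContinuousMap.mul_apply]
  push_cast
  ring

theorem diagElt_add (p q : C_c(X, ℝ)) : 𝒢.diagElt (p + q) = 𝒢.diagElt p + 𝒢.diagElt q := by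
  refine reducedCStar_ext fun x ψ g => ?_
  change _ = (𝒢.toFam (𝒢.diagElt p)).op x ψ g + (𝒢.toFam (𝒢.diagElt q)).op x ψ g
  rw [toFam_diagElt_apply, toFam_diagElt_apply, toFam_diagElt_apply,
    CompactlySupportedContinuousMap.add_apply]
  push_cast
  ring

theorem diagElt_smul (r : ℝ) (p : C_c(X, ℝ)) : 𝒢.diagElt (r • p) = (r : ℂ) • 𝒢.diagElt p := by
  refine reducedCStar_ext fun x ψ g => ?_
  change _ = (r : ℂ) * (𝒢.toFam (𝒢.diagElt p)).op x ψ g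
  rw [toFam_diagElt_apply, toFam_diagElt_apply,
    CompactlySupportedContinuousMap.smul_apply, smul_eq_mul]
  push_cast
  ring

theorem star_diagElt (p : C_c(X, ℝ)) : star (𝒢.diagElt p) = 𝒢.diagElt p := by
  rw [diagElt, ← 𝒢.ofCc_invol]
  congr 1
  refine CompactlySupportedContinuousMap.ext fun g => ?_
  change starRingEnd ℂ (𝒢.diag p (𝒢.inv g)) = _
  by_cases hg : g ∈ Set.range 𝒢.unit
  · obtain ⟨x, rfl⟩ := hg
    rw [𝒢.unit_inv, 𝒢.diag_unit, Complex.conj_ofReal]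
  · rw [𝒢.diag_of_notMem p hg, 𝒢.diag_of_notMem p, map_zero]
    rintro ⟨x, hx⟩
    refine hg ⟨x, ?_⟩
    rw [← 𝒢.inv_inv g, ← hx, 𝒢.unit_inv]

theorem sigma_diagElt (c : 𝒢.RealHom) (t : ℝ) (p : C_c(X, ℝ)) :
    sigma c t (𝒢.diagElt p) = 𝒢.diagElt p := by
  rw [diagElt, sigma_ofCc]
  congr 1
  refine CompactlySupportedContinuousMap.ext fun g => ?_
  change phase c t g * 𝒢.diag p g = _
  by_cases hg : g ∈ Set.range 𝒢.unit
  · obtain ⟨x, rfl⟩ := hg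
    rw [phase_unit, one_mul]
  · rw [𝒢.diag_of_notMem p hg, mul_zero]

theorem norm_le_of_forall_op {a : 𝒢.ReducedCStar} {M : ℝ} (hM : 0 ≤ M)
    (h : ∀ x, ‖(𝒢.toFam a).op x‖ ≤ M) : ‖a‖ ≤ M := by
  rw [← norm_toFam, BddFam.norm_eq]
  exact Real.iSup_le h hM

theorem norm_diagElt_le (p : C_c(X, ℝ)) {M : ℝ} (hM : 0 ≤ M) (h : ∀ x, |p x| ≤ M) :
    ‖𝒢.diagElt p‖ ≤ M := by
  refine 𝒢.norm_le_of_forall_op hM fun x => ContinuousLinearMap.opNorm_le_bound _ hM fun ψ => ?_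
  refine lp.norm_le_of_forall_sum_le (by simp) (by positivity) fun S => ?_
  rw [Real.mul_rpow hM (norm_nonneg _)]
  calc ∑ g ∈ S, ‖(𝒢.toFam (𝒢.diagElt p)).op x ψ g‖ ^ (2 : ENNReal).toReal
      ≤ ∑ g ∈ S, M ^ (2 : ENNReal).toReal * ‖ψ g‖ ^ (2 : ENNReal).toReal := by
        refine Finset.sum_le_sum fun g _ => ?_
        rw [toFam_diagElt_apply, norm_mul, Complex.norm_real, Real.norm_eq_abs,
          Real.mul_rpow (abs_nonneg _) (norm_nonneg _)]
        gcongr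
        exact h _
    _ ≤ M ^ (2 : ENNReal).toReal * ‖ψ‖ ^ (2 : ENNReal).toReal := by
        rw [← Finset.mul_sum]
        gcongr
        exact lp.sum_rpow_le_norm_rpow (by simp) ψ S

end Diag

/-! ### Elements of the reduced algebra as functions on the groupoid -/

section Coef

variable {G X : Type*} [TopologicalSpace G] [TopologicalSpace X] [T2Space G] [LocallyCompactSpace G]
  (𝒢 : EtaleGroupoid G X)

/-- The matrix coefficient `⟨δ_g, a δ_{s(g)}⟩` of an element of `C*_r(G)` as a function on `G`. -/
noncomputable def coef (a : 𝒢.ReducedCStar) (g : G) : ℂ :=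
  (𝒢.toFam a).op (𝒢.s g) (𝒢.delta (𝒢.s g) (𝒢.unitPt (𝒢.s g))) ⟨g, rfl⟩

theorem coef_eq (a : 𝒢.ReducedCStar) (x : X) (g : {g : G // 𝒢.s g = x}) :
    𝒢.coef a g = (𝒢.toFam a).op x (𝒢.delta x (𝒢.unitPt x)) g := by
  obtain ⟨g, rfl⟩ := g
  rfl

theorem coef_ofCc (f : C_c(G, ℂ)) (g : G) : 𝒢.coef (𝒢.ofCc f) g = f g := by
  rw [coef, toFam_ofCc, regFam_op, regRep_delta, unitPt, 𝒢.mul_unit_inv _ rfl]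

theorem coef_sub (a b : 𝒢.ReducedCStar) (g : G) :
    𝒢.coef (a - b) g = 𝒢.coef a g - 𝒢.coef b g := rfl

theorem norm_coef_le (a : 𝒢.ReducedCStar) (g : G) : ‖𝒢.coef a g‖ ≤ ‖a‖ := by
  refine (lp.norm_apply_le_norm (by simp) _ _).trans ?_
  refine ((((𝒢.toFam a).op _).le_opNorm _)).trans ?_
  rw [norm_delta, mul_one]
  exact BddFam.norm_op_le _ _

theorem continuous_coef_left (g : G) : Continuous fun a => 𝒢.coef a g := by
  refine continuous_iff_continuousAt.2 fun a => ?_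
  rw [ContinuousAt, tendsto_iff_norm_sub_tendsto_zero]
  refine squeeze_zero (fun _ => norm_nonneg _) (fun b => ?_)
    (tendsto_iff_norm_sub_tendsto_zero.1 Filter.tendsto_id)
  rw [← coef_sub]
  exact 𝒢.norm_coef_le _ _

theorem continuous_coef (a : 𝒢.ReducedCStar) : Continuous (𝒢.coef a) := by
  refine continuous_of_uniform_approx_of_continuous fun u hu => ?_
  obtain ⟨ε, hε, hu⟩ := Metric.mem_uniformity_dist.1 hu
  obtain ⟨_, ⟨f, rfl⟩, hf⟩ := Metric.mem_closure_iff.1 (𝒢.denseRange_ofCc a) ε hε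
  refine ⟨f, f.continuous, fun g => hu ?_⟩
  rw [← 𝒢.coef_ofCc f, dist_eq_norm, ← coef_sub]
  rw [dist_eq_norm] at hf
  exact (𝒢.norm_coef_le _ _).trans_lt hf

/-- For fixed `g` both sides are norm continuous in `a`, and they agree on the dense image of
`C_c(G)`. -/
theorem coef_star (a : 𝒢.ReducedCStar) (g : G) :
    𝒢.coef (star a) g = starRingEnd ℂ (𝒢.coef a (𝒢.inv g)) := by
  have h := 𝒢.denseRange_ofCc.equalizer (g := fun a => 𝒢.coef (star a) g)
    (h := fun a => starRingEnd ℂ (𝒢.coef a (𝒢.inv g)))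
    ((𝒢.continuous_coef_left g).comp continuous_star)
    (Complex.continuous_conj.comp (𝒢.continuous_coef_left _)) (by
      funext f
      simp only [Function.comp]
      rw [← 𝒢.ofCc_invol, coef_ofCc, coef_ofCc]
      rfl)
  exact congrFun h a

theorem continuous_sigma (c : 𝒢.RealHom) (t : ℝ) : Continuous (sigma c t) :=
  AddMonoidHomClass.continuous_of_bound (sigma c t) 1 fun a => by
    rw [StarAlgEquiv.norm_map, one_mul]

theorem coef_sigma (c : 𝒢.RealHom) (t : ℝ) (a : 𝒢.ReducedCStar) (g : G) :
    𝒢.coef (sigma c t a) g = phase c t g * 𝒢.coef a g := by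
  have h := 𝒢.denseRange_ofCc.equalizer (g := fun a => 𝒢.coef (sigma c t a) g)
    (h := fun a => phase c t g * 𝒢.coef a g)
    ((𝒢.continuous_coef_left g).comp (𝒢.continuous_sigma c t))
    (continuous_const.mul (𝒢.continuous_coef_left _)) (by
      funext f
      simp only [Function.comp]
      rw [sigma_ofCc, coef_ofCc, coef_ofCc]
      rfl)
  exact congrFun h a

theorem condExp_eq_coef (a : 𝒢.ReducedCStar) (x : X) : 𝒢.condExp a x = 𝒢.coef a (𝒢.unit x) := by
  change 𝒢.diagCoeff (𝒢.toFam a) x = _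
  rw [diagCoeff, inner_delta]
  exact (𝒢.coef_eq a x (𝒢.unitPt x)).symm

/-- The value `P(a*b)(x)` is the inner product of `a_x δ_x` and `b_x δ_x`, here expanded in
coordinates. After integration in `x` it turns `φ_m` into an `L²` inner product on `G`. -/
theorem hasSum_condExp_star_mul (a b : 𝒢.ReducedCStar) (x : X) :
    HasSum (fun g : {g : G // 𝒢.s g = x} => starRingEnd ℂ (𝒢.coef a g) * 𝒢.coef b g)
      (𝒢.condExp (star a * b) x) := by
  have h := lp.hasSum_inner (𝕜 := ℂ) ((𝒢.toFam a).op x (𝒢.delta x (𝒢.unitPt x)))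
    ((𝒢.toFam b).op x (𝒢.delta x (𝒢.unitPt x)))
  have e : 𝒢.condExp (star a * b) x = inner ℂ ((𝒢.toFam a).op x (𝒢.delta x (𝒢.unitPt x)))
      ((𝒢.toFam b).op x (𝒢.delta x (𝒢.unitPt x))) := by
    change inner ℂ _ ((ContinuousLinearMap.adjoint ((𝒢.toFam a).op x)) ((𝒢.toFam b).op x _)) = _
    rw [ContinuousLinearMap.adjoint_inner_right]
  rw [e]
  refine (congrArg (HasSum · _) (funext fun g => ?_)).mpr h
  rw [𝒢.coef_eq, 𝒢.coef_eq, RCLike.inner_apply, mul_comm]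

theorem condExp_add (a b : 𝒢.ReducedCStar) (x : X) :
    𝒢.condExp (a + b) x = 𝒢.condExp a x + 𝒢.condExp b x := by
  simp only [condExp_eq_coef]
  rfl

theorem condExp_sub (a b : 𝒢.ReducedCStar) (x : X) :
    𝒢.condExp (a - b) x = 𝒢.condExp a x - 𝒢.condExp b x := by
  simp only [condExp_eq_coef]
  rfl

theorem condExp_smul (z : ℂ) (a : 𝒢.ReducedCStar) (x : X) :
    𝒢.condExp (z • a) x = z * 𝒢.condExp a x := by
  simp only [condExp_eq_coef]
  rfl

theorem condExp_sigma (c : 𝒢.RealHom) (t : ℝ) (a : 𝒢.ReducedCStar) (x : X) :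
    𝒢.condExp (sigma c t a) x = 𝒢.condExp a x := by
  rw [condExp_eq_coef, coef_sigma, phase_unit, one_mul, condExp_eq_coef]

theorem hasSum_condExp_star_mul_self (a : 𝒢.ReducedCStar) (x : X) :
    HasSum (fun g : {g : G // 𝒢.s g = x} => ‖𝒢.coef a g‖ ^ 2) (𝒢.condExp (star a * a) x).re := by
  refine (congrArg (HasSum · _) (funext fun g => ?_)).mpr (Complex.hasSum_re (𝒢.hasSum_condExp_star_mul a a x))
  rw [Complex.conj_mul']
  norm_cast

theorem condExp_nonneg {a : 𝒢.ReducedCStar} (ha : 0 ≤ a) (x : X) :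
    0 ≤ (𝒢.condExp a x).re ∧ 𝒢.condExp a x = (𝒢.condExp a x).re := by
  obtain ⟨b, rfl⟩ := CStarAlgebra.nonneg_iff_eq_star_mul_self.1 ha
  refine ⟨(𝒢.hasSum_condExp_star_mul_self b x).nonneg fun _ => by positivity, ?_⟩
  have h := 𝒢.hasSum_condExp_star_mul_self b x
  have h1 := 𝒢.hasSum_condExp_star_mul b b x
  refine h1.unique ?_
  refine (congrArg (HasSum · _) (funext fun g => ?_)).mpr (Complex.hasSum_ofReal.2 h)
  rw [Complex.conj_mul']
  norm_cast

theorem coef_diagElt_mul (p : C_c(X, ℝ)) (a : 𝒢.ReducedCStar) (g : G) :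
    𝒢.coef (𝒢.diagElt p * a) g = p (𝒢.r g) * 𝒢.coef a g := by
  rw [coef, toFam_mul_apply, toFam_diagElt_apply]
  rfl

theorem coef_mul_diagElt (p : C_c(X, ℝ)) (a : 𝒢.ReducedCStar) (g : G) :
    𝒢.coef (a * 𝒢.diagElt p) g = 𝒢.coef a g * p (𝒢.s g) := by
  have h : a * 𝒢.diagElt p = star (𝒢.diagElt p * star a) := by
    rw [star_mul, star_star, star_diagElt]
  rw [h, coef_star, coef_diagElt_mul, coef_star, 𝒢.inv_inv, 𝒢.r_inv, map_mul, Complex.conj_conj,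
    Complex.conj_ofReal, mul_comm]

theorem condExp_diagElt (p : C_c(X, ℝ)) (x : X) : 𝒢.condExp (𝒢.diagElt p) x = p x := by
  rw [diagElt, condExp_ofCc, diag_unit]

theorem condExp_diagElt_mul_mul (p q : C_c(X, ℝ)) (a : 𝒢.ReducedCStar) (x : X) :
    𝒢.condExp (𝒢.diagElt p * a * 𝒢.diagElt q) x = p x * q x * 𝒢.condExp a x := by
  rw [condExp_eq_coef, coef_mul_diagElt, coef_diagElt_mul, condExp_eq_coef, 𝒢.r_unit, 𝒢.s_unit]
  ring

end Coef

/-! ### Norm estimates and approximate units -/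

section Schur

variable {G X : Type*} [TopologicalSpace G] [TopologicalSpace X] [T2Space G] [LocallyCompactSpace G]
  (𝒢 : EtaleGroupoid G X)

/-- On functions whose support is contained in that of `f`, the reduced norm is dominated by the
supremum norm. -/
theorem exists_norm_ofCc_le (f : C_c(G, ℂ)) : ∃ C : ℝ, 0 ≤ C ∧ ∀ (h : C_c(G, ℂ)) (M : ℝ), 0 ≤ M →
    (∀ g, f g = 0 → h g = 0) → (∀ g, ‖h g‖ ≤ M) → ‖𝒢.ofCc h‖ ≤ C * M := by
  obtain ⟨N, hN⟩ := 𝒢.exists_row_bound f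
  obtain ⟨N', hN'⟩ := 𝒢.exists_col_bound f
  -- The Schur test constant: in each fibre the matrix `h(g k⁻¹)` has at most `N` nonzero entries in
  -- a row and at most `N'` in a column, each bounded by `M`.
  refine ⟨√(N * N'), Real.sqrt_nonneg _, fun h M hM0 hfh hM => ?_⟩
  have hCM : 0 ≤ √(N * N') * M := by positivity
  refine 𝒢.norm_le_of_forall_op hCM fun x => ContinuousLinearMap.opNorm_le_bound _ hCM fun ψ => ?_
  refine lp.norm_le_of_forall_sum_le (by simp) (by positivity) fun S => ?_
  classical
  have h2 : ∀ a : ℝ, a ^ (2 : ENNReal).toReal = a ^ 2 := fun a => by simp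
  simp only [h2, mul_pow]
  rw [Real.sq_sqrt (by positivity)]
  set F : {g : G // 𝒢.s g = x} → Finset {g : G // 𝒢.s g = x} :=
    fun g => (𝒢.finite_row f x g).toFinset with hF
  have hsum : ∀ g, 𝒢.regFun h x ψ g = ∑ k ∈ F g, h (𝒢.mul g (𝒢.inv k)) * ψ k := by
    intro g
    rw [𝒢.regFun_eq]
    refine tsum_eq_sum fun k hk => ?_
    simp only [hF, Set.Finite.mem_toFinset, Set.mem_ofPred_eq, not_not] at hk
    rw [hfh _ hk, zero_mul]
  have hrow : ∀ g, ‖𝒢.regFun h x ψ g‖ ^ 2 ≤ N * M ^ 2 * ∑ k ∈ F g, ‖ψ k‖ ^ 2 := by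
    intro g
    rw [hsum]
    calc ‖∑ k ∈ F g, h (𝒢.mul g (𝒢.inv k)) * ψ k‖ ^ 2
        ≤ (∑ k ∈ F g, M * ‖ψ k‖) ^ 2 := by
          gcongr
          refine (norm_sum_le _ _).trans (Finset.sum_le_sum fun k _ => ?_)
          rw [norm_mul]
          gcongr
          exact hM _
      _ ≤ (F g).card * ∑ k ∈ F g, (M * ‖ψ k‖) ^ 2 := sq_sum_le_card_mul_sum_sq
      _ ≤ N * ∑ k ∈ F g, (M * ‖ψ k‖) ^ 2 := by
          gcongr
          exact hN x g
      _ = N * M ^ 2 * ∑ k ∈ F g, ‖ψ k‖ ^ 2 := by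
          simp only [mul_pow, ← Finset.mul_sum]
          ring
  calc ∑ g ∈ S, ‖𝒢.regFun h x ψ g‖ ^ 2
      ≤ ∑ g ∈ S, N * M ^ 2 * ∑ k ∈ F g, ‖ψ k‖ ^ 2 := Finset.sum_le_sum fun g _ => hrow g
    _ = N * M ^ 2 * ∑ g ∈ S, ∑ k ∈ F g, ‖ψ k‖ ^ 2 := by rw [Finset.mul_sum]
    _ = N * M ^ 2 * ∑ k ∈ S.biUnion F, ∑ g ∈ S with k ∈ F g, ‖ψ k‖ ^ 2 := by
        congr 1
        refine Finset.sum_comm' fun g k => ?_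
        simp only [Finset.mem_filter, Finset.mem_biUnion]
        tauto
    _ ≤ N * M ^ 2 * ∑ k ∈ S.biUnion F, N' * ‖ψ k‖ ^ 2 := by
        gcongr with k hk
        rw [Finset.sum_const, nsmul_eq_mul]
        gcongr
        refine hN' x k _ fun g hg => ?_
        simpa [hF] using (Finset.mem_filter.1 hg).2
    _ = N * N' * M ^ 2 * ∑ k ∈ S.biUnion F, ‖ψ k‖ ^ 2 := by
        rw [← Finset.mul_sum]
        ring
    _ ≤ N * N' * M ^ 2 * ‖ψ‖ ^ 2 := by
        gcongr
        have := lp.sum_rpow_le_norm_rpow (p := 2) (by simp) ψ (S.biUnion F)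
        simpa only [h2] using this

theorem ofCc_add (f₁ f₂ : C_c(G, ℂ)) : 𝒢.ofCc (f₁ + f₂) = 𝒢.ofCc f₁ + 𝒢.ofCc f₂ :=
  𝒢.toFam_injective (𝒢.regFam_add f₁ f₂)

theorem ofCc_smul (z : ℂ) (f : C_c(G, ℂ)) : 𝒢.ofCc (z • f) = z • 𝒢.ofCc f :=
  𝒢.toFam_injective (𝒢.regFam_smul z f)

/-- The canonical map of `C_c(G)` to `C*_r(G)` as a linear map. -/
noncomputable def ofCcLin : C_c(G, ℂ) →ₗ[ℂ] 𝒢.ReducedCStar where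
  toFun := 𝒢.ofCc
  map_add' := 𝒢.ofCc_add
  map_smul' := 𝒢.ofCc_smul

theorem diagElt_mul_ofCc {p : C_c(X, ℝ)} {f h : C_c(G, ℂ)} (e : ∀ g, p (𝒢.r g) * f g = h g) :
    𝒢.diagElt p * 𝒢.ofCc f = 𝒢.ofCc h := by
  rw [diagElt, ← ofCc_conv]
  congr 1
  refine CompactlySupportedContinuousMap.ext fun g => ?_
  rw [← 𝒢.coef_ofCc (𝒢.conv _ _), ofCc_conv, ← diagElt, coef_diagElt_mul, coef_ofCc, e]

theorem ofCc_mul_diagElt {p : C_c(X, ℝ)} {f h : C_c(G, ℂ)} (e : ∀ g, f g * p (𝒢.s g) = h g) :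
    𝒢.ofCc f * 𝒢.diagElt p = 𝒢.ofCc h := by
  rw [diagElt, ← ofCc_conv]
  congr 1
  refine CompactlySupportedContinuousMap.ext fun g => ?_
  rw [← 𝒢.coef_ofCc (𝒢.conv _ _), ofCc_conv, ← diagElt, coef_mul_diagElt, coef_ofCc, e]

/-- Local units for `C_c(G)` in `C_c(X)`. -/
theorem exists_local_unit (f : C_c(G, ℂ)) : ∃ p : C_c(X, ℝ), (∀ x, 0 ≤ p x ∧ p x ≤ 1) ∧
    𝒢.diagElt p * 𝒢.ofCc f = 𝒢.ofCc f ∧ 𝒢.ofCc f * 𝒢.diagElt p = 𝒢.ofCc f := by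
  have := 𝒢.t2Space_units
  have := 𝒢.locallyCompactSpace_units
  have hf : IsCompact (tsupport f) := f.hasCompactSupport
  obtain ⟨p, h1, -, h3⟩ := exists_bump ((hf.image 𝒢.continuous_r).union (hf.image 𝒢.continuous_s))
    isOpen_univ (Set.subset_univ _)
  refine ⟨p, h3, 𝒢.diagElt_mul_ofCc fun g => ?_, 𝒢.ofCc_mul_diagElt fun g => ?_⟩ <;>
    by_cases hg : g ∈ tsupport f
  · rw [h1 _ (Or.inl ⟨g, hg, rfl⟩), Complex.ofReal_one, one_mul]
  · rw [image_eq_zero_of_notMem_tsupport hg, mul_zero]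
  · rw [h1 _ (Or.inr ⟨g, hg, rfl⟩), Complex.ofReal_one, mul_one]
  · rw [image_eq_zero_of_notMem_tsupport hg, zero_mul]

/-- `C_c(X)` contains an approximate unit of `C*_r(G)`. -/
theorem exists_approx_unit (a : 𝒢.ReducedCStar) {ε : ℝ} (hε : 0 < ε) :
    ∃ p : C_c(X, ℝ), (∀ x, 0 ≤ p x ∧ p x ≤ 1) ∧ ‖𝒢.diagElt p * a * 𝒢.diagElt p - a‖ < ε := by
  obtain ⟨_, ⟨f, rfl⟩, hf⟩ := Metric.mem_closure_iff.1 (𝒢.denseRange_ofCc a) (ε / 2) (half_pos hε)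
  obtain ⟨p, h1, h2, h3⟩ := 𝒢.exists_local_unit f
  refine ⟨p, h1, ?_⟩
  have hp : ‖𝒢.diagElt p‖ ≤ 1 := 𝒢.norm_diagElt_le p zero_le_one fun x => by
    rw [abs_of_nonneg (h1 x).1]
    exact (h1 x).2
  -- The local unit fixes `f` on both sides, so only the small element `a - f` is affected by the
  -- compression.
  have e : 𝒢.diagElt p * a * 𝒢.diagElt p - a =
      𝒢.diagElt p * (a - 𝒢.ofCc f) * 𝒢.diagElt p - (a - 𝒢.ofCc f) := by
    rw [mul_sub, sub_mul, h2, h3]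
    abel
  rw [dist_eq_norm] at hf
  rw [e]
  calc _ ≤ ‖𝒢.diagElt p * (a - 𝒢.ofCc f) * 𝒢.diagElt p‖ + ‖a - 𝒢.ofCc f‖ := norm_sub_le _ _
    _ ≤ ‖𝒢.diagElt p‖ * ‖a - 𝒢.ofCc f‖ * ‖𝒢.diagElt p‖ + ‖a - 𝒢.ofCc f‖ := by
        gcongr
        exact (norm_mul_le _ _).trans (by gcongr; exact norm_mul_le _ _)
    _ ≤ 1 * ‖a - 𝒢.ofCc f‖ * 1 + ‖a - 𝒢.ofCc f‖ := by gcongr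
    _ < ε := by linarith

end Schur

/-! ### Time averages and fixed points of the action -/

section Average

/-- A geometric sum: the numerator is at most `2`, and the denominator is `2|sin(x/2)| ≥ 2|x|/π` by
Jordan's inequality, which is where `|x| ≤ π` enters. -/
theorem norm_sum_exp_le {x : ℝ} (hx : x ≠ 0) (hπ : |x| ≤ Real.pi) (N : ℕ) :
    ‖∑ j ∈ Finset.range N, Complex.exp (Complex.I * x) ^ j‖ ≤ Real.pi / |x| := by
  have hpi := Real.pi_pos
  have hx' : 0 < |x| := abs_pos.2 hx
  have hlow : 2 / Real.pi * |x| ≤ ‖Complex.exp (Complex.I * x) - 1‖ := by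
    rw [Complex.norm_exp_I_mul_ofReal_sub_one, norm_mul, Real.norm_eq_abs, Real.norm_eq_abs,
      abs_two, Real.abs_sin_eq_sin_abs_of_abs_le_pi, abs_div, abs_two]
    · have := Real.mul_le_sin (x := |x| / 2) (by positivity) (by linarith)
      calc 2 / Real.pi * |x| = 2 * (2 / Real.pi * (|x| / 2)) := by ring
        _ ≤ _ := by gcongr
    · rw [abs_div, abs_two]
      linarith
  have hpos : 0 < ‖Complex.exp (Complex.I * x) - 1‖ := lt_of_lt_of_le (by positivity) hlow
  rw [geom_sum_eq (by rw [Ne, ← sub_eq_zero]; exact norm_pos_iff.1 hpos), norm_div,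
    div_le_div_iff₀ hpos hx']
  have h2 : ‖Complex.exp (Complex.I * x) ^ N - 1‖ ≤ 2 := by
    refine (norm_sub_le _ _).trans ?_
    rw [norm_pow, mul_comm, Complex.norm_exp_ofReal_mul_I, one_pow, norm_one]
    norm_num
  calc _ ≤ 2 * |x| := by gcongr
    _ = Real.pi * (2 / Real.pi * |x|) := by field_simp
    _ ≤ _ := by gcongr

variable {G X : Type*} [TopologicalSpace G] [TopologicalSpace X] [T2Space G] [LocallyCompactSpace G]
  {𝒢 : EtaleGroupoid G X} (c : 𝒢.RealHom)

/-- Averages of the orbit of `a` under `σ^c` over the points `j / (n + 1)`, `j < (n + 1)²`. -/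
noncomputable def orbitAvg (n : ℕ) (a : 𝒢.ReducedCStar) : 𝒢.ReducedCStar :=
  ((((n + 1 : ℝ) ^ 2)⁻¹ : ℝ) : ℂ) • ∑ j ∈ Finset.range ((n + 1) ^ 2), sigma c (j / (n + 1)) a

/-- The function by which `orbitAvg` multiplies elements of `C_c(G)`. -/
noncomputable def avgMult (n : ℕ) : C(G, ℂ) where
  toFun g := ((((n + 1 : ℝ) ^ 2)⁻¹ : ℝ) : ℂ) *
    ∑ j ∈ Finset.range ((n + 1) ^ 2), phase c (j / (n + 1)) g
  continuous_toFun := by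
    have := c.continuous_toFun
    unfold phase
    fun_prop

omit [T2Space G] [LocallyCompactSpace G] in
theorem avgMult_apply (n : ℕ) (g : G) : avgMult c n g = ((((n + 1 : ℝ) ^ 2)⁻¹ : ℝ) : ℂ) *
    ∑ j ∈ Finset.range ((n + 1) ^ 2), phase c ((j : ℝ) / (n + 1)) g := rfl

theorem orbitAvg_ofCc (n : ℕ) (f : C_c(G, ℂ)) :
    orbitAvg c n (𝒢.ofCc f) = 𝒢.ofCc (avgMult c n • f) := by
  have h : avgMult c n • f = ((((n + 1 : ℝ) ^ 2)⁻¹ : ℝ) : ℂ) •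
      ∑ j ∈ Finset.range ((n + 1) ^ 2), twist c (j / (n + 1)) f := by
    refine CompactlySupportedContinuousMap.ext fun g => ?_
    rw [CompactlySupportedContinuousMap.smul_apply, CompactlySupportedContinuousMap.sum_apply]
    change (_ * _) * f g = _ * ∑ j ∈ _, _ * f g
    rw [_root_.mul_assoc, Finset.sum_mul]
  rw [h, orbitAvg]
  change _ = 𝒢.ofCcLin _
  rw [map_smul, map_sum]
  congr 1
  exact Finset.sum_congr rfl fun j _ => sigma_ofCc c _ f

-- Sampling at spacing `1/(n+1)` turns `c g` into the angle `c g/(n+1)`, at most `1` in absolute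
-- value once `n ≥ |c g|`, so there is no aliasing. Taking `(n+1)²` samples stretches the time
-- window to length about `n+1`, which gives decay as `n` grows.
omit [T2Space G] [LocallyCompactSpace G] in
theorem norm_avgMult_le (n : ℕ) {g : G} (hg : c g ≠ 0) (hn : |c g| ≤ n) :
    ‖avgMult c n g‖ ≤ Real.pi / ((n + 1) * |c g|) := by
  have hn1 : (0 : ℝ) < n + 1 := by positivity
  have e : avgMult c n g = ((((n + 1 : ℝ) ^ 2)⁻¹ : ℝ) : ℂ) * ∑ j ∈ Finset.range ((n + 1) ^ 2),
      Complex.exp (Complex.I * ((c g / (n + 1) : ℝ) : ℂ)) ^ j := by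
    rw [avgMult_apply]
    congr 1
    refine Finset.sum_congr rfl fun j _ => ?_
    rw [phase, ← Complex.exp_nat_mul]
    congr 1
    push_cast
    ring
  have habs : |c g / (n + 1)| = |c g| / (n + 1) := by rw [abs_div, abs_of_pos hn1]
  have h1 := norm_sum_exp_le (x := c g / (n + 1)) (div_ne_zero hg hn1.ne') (by
    rw [habs, div_le_iff₀ hn1]
    nlinarith [Real.pi_gt_three]) ((n + 1) ^ 2)
  rw [e, norm_mul, Complex.norm_real, norm_inv, Real.norm_of_nonneg (by positivity)]
  have hc := abs_pos.2 hg
  calc _ ≤ ((n + 1 : ℝ) ^ 2)⁻¹ * (Real.pi / |c g / (n + 1)|) := by gcongr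
    _ = _ := by rw [habs]; field_simp

theorem orbitAvg_sub (n : ℕ) (a b : 𝒢.ReducedCStar) :
    orbitAvg c n (a - b) = orbitAvg c n a - orbitAvg c n b := by
  simp only [orbitAvg, map_sub, Finset.sum_sub_distrib, smul_sub]

theorem norm_orbitAvg_le (n : ℕ) (a : 𝒢.ReducedCStar) : ‖orbitAvg c n a‖ ≤ ‖a‖ := by
  rw [orbitAvg, norm_smul, Complex.norm_real, Real.norm_of_nonneg (by positivity)]
  calc _ ≤ ((n + 1 : ℝ) ^ 2)⁻¹ * ∑ j ∈ Finset.range ((n + 1) ^ 2), ‖a‖ := by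
        gcongr
        refine (norm_sum_le _ _).trans (Finset.sum_le_sum fun j _ => ?_)
        rw [StarAlgEquiv.norm_map]
    _ = ‖a‖ := by
        rw [Finset.sum_const, Finset.card_range, nsmul_eq_mul]
        push_cast
        field_simp

theorem orbitAvg_eq_self (n : ℕ) {a : 𝒢.ReducedCStar} (h : ∀ t, sigma c t a = a) :
    orbitAvg c n a = a := by
  rw [orbitAvg]
  simp only [h]
  rw [Finset.sum_const, Finset.card_range, ← Nat.cast_smul_eq_nsmul ℂ, smul_smul]
  push_cast
  have : ((n : ℂ) + 1) ≠ 0 := by exact_mod_cast n.succ_ne_zero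
  rw [inv_mul_cancel₀ (pow_ne_zero 2 this), one_smul]

open Filter Topology in
/-- The averages of a function supported away from the kernel of `c` tend to `0`. -/
theorem tendsto_orbitAvg_zero {f : C_c(G, ℂ)} (hf : tsupport f ⊆ {g | c g ≠ 0}) :
    Tendsto (fun n => orbitAvg c n (𝒢.ofCc f)) atTop (𝓝 0) := by
  have hK : IsCompact (tsupport f) := f.hasCompactSupport
  have hcont := c.continuous_toFun
  obtain ⟨C, hC0, hC⟩ := 𝒢.exists_norm_ofCc_le f
  obtain ⟨M, hM⟩ := f.hasCompactSupport.exists_bound_of_continuous f.continuous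
  have hM0 : 0 ≤ max M 0 := le_max_right _ _
  -- Compactness keeps `|c|` between some `δ > 0` and some `R` on the support, which makes the decay
  -- of the multipliers uniform. Multiplication does not enlarge the support, so sup norm decay
  -- implies decay of the reduced norm.
  have hδ : ∃ δ > 0, ∀ g ∈ tsupport f, δ ≤ |c g| := by
    rcases (tsupport f).eq_empty_or_nonempty with h | h
    · exact ⟨1, one_pos, by simp [h]⟩
    · obtain ⟨g₀, hg₀, hmin⟩ := hK.exists_isMinOn h hcont.abs.continuousOn
      exact ⟨|c g₀|, abs_pos.2 (hf hg₀), fun g hg => hmin hg⟩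
  obtain ⟨δ, hδ, hδ'⟩ := hδ
  obtain ⟨R, hR⟩ := hK.exists_bound_of_continuousOn hcont.continuousOn
  have hlim : Tendsto (fun n : ℕ => C * (Real.pi / ((n + 1) * δ) * max M 0)) atTop (𝓝 0) := by
    have h1 : Tendsto (fun n : ℕ => 1 / ((n : ℝ) + 1)) atTop (𝓝 0) :=
      tendsto_one_div_add_atTop_nhds_zero_nat
    have h2 := h1.const_mul (C * (Real.pi / δ * max M 0))
    rw [mul_zero] at h2
    refine h2.congr fun n => ?_
    have : (n : ℝ) + 1 ≠ 0 := by positivity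
    field_simp
  refine squeeze_zero_norm' ?_ hlim
  filter_upwards [eventually_ge_atTop ⌈R⌉₊] with n hn
  rw [orbitAvg_ofCc]
  have hRn : R ≤ n := (Nat.le_ceil R).trans (by exact_mod_cast hn)
  refine hC _ _ (by positivity) (fun g hg => ?_) fun g => ?_
  · change _ * f g = 0
    rw [hg, mul_zero]
  · change ‖_ * f g‖ ≤ _
    rw [norm_mul]
    by_cases hg : g ∈ tsupport f
    · refine mul_le_mul ?_ ((hM g).trans (le_max_left _ _)) (norm_nonneg _) (by positivity)
      refine (norm_avgMult_le c n (hf hg) ((hR g hg).trans hRn)).trans ?_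
      have := hδ' g hg
      gcongr
    · rw [image_eq_zero_of_notMem_tsupport hg, norm_zero, mul_zero]
      positivity

-- Since `ker c` is clopen, its characteristic function `χ` is continuous and `f = χf + (1-χ)f`
-- splits inside `C_c(G)`. The first summand is fixed by the action, and the averages of the second
-- tend to `0`.
open Filter Topology in
theorem exists_tendsto_orbitAvg_ofCc (hopen : IsOpen {g | c g = 0}) (f : C_c(G, ℂ)) :
    ∃ b, Tendsto (fun n => orbitAvg c n (𝒢.ofCc f)) atTop (𝓝 b) ∧ ∀ t, sigma c t b = b := by
  have hclopen : IsClopen {g | c g = 0} :=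
    ⟨isClosed_eq c.continuous_toFun continuous_const, hopen⟩
  set χ : C(G, ℂ) := ⟨LocallyConstant.charFn ℂ hclopen,
    (LocallyConstant.charFn ℂ hclopen).continuous⟩ with hχ
  have hχ1 : ∀ g, c g = 0 → χ g = 1 := fun g hg => by
    change LocallyConstant.charFn ℂ hclopen g = 1
    rw [LocallyConstant.coe_charFn]
    exact Set.indicator_of_mem (show g ∈ {g | c g = 0} from hg) _
  have hχ0 : ∀ g, c g ≠ 0 → χ g = 0 := fun g hg => by
    change LocallyConstant.charFn ℂ hclopen g = 0
    rw [LocallyConstant.coe_charFn]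
    exact Set.indicator_of_notMem (show g ∉ {g | c g = 0} from hg) _
  have hinv : ∀ t, sigma c t (𝒢.ofCc (χ • f)) = 𝒢.ofCc (χ • f) := by
    intro t
    rw [sigma_ofCc]
    congr 1
    refine CompactlySupportedContinuousMap.ext fun g => ?_
    change phase c t g * (χ g * f g) = χ g * f g
    by_cases hg : c g = 0
    · simp [phase, hg]
    · rw [hχ0 g hg, zero_mul, mul_zero]
  refine ⟨𝒢.ofCc (χ • f), ?_, hinv⟩
  have hrest : tsupport (((1 : C(G, ℂ)) - χ) • f : C_c(G, ℂ)) ⊆ {g | c g ≠ 0} := by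
    have hcl : IsClosed {g | c g ≠ 0} := hopen.isClosed_compl
    refine closure_minimal (fun g hg h0 => hg ?_) hcl
    change (1 - χ g) * f g = 0
    rw [hχ1 g h0, sub_self, zero_mul]
  have h1 := tendsto_orbitAvg_zero c hrest
  have e : 𝒢.ofCc (((1 : C(G, ℂ)) - χ) • f) = 𝒢.ofCc f - 𝒢.ofCc (χ • f) := by
    rw [eq_sub_iff_add_eq, ← ofCc_add]
    congr 1
    refine CompactlySupportedContinuousMap.ext fun g => ?_
    change (1 - χ g) * f g + χ g * f g = f g
    ring
  rw [e] at h1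
  have h2 := h1.add_const (𝒢.ofCc (χ • f))
  rw [zero_add] at h2
  refine h2.congr fun n => ?_
  rw [orbitAvg_sub, orbitAvg_eq_self c n hinv, sub_add_cancel]

open Filter Topology in
/-- If the kernel of `c` is open, then the averages of every orbit converge to a fixed point. -/
theorem exists_tendsto_orbitAvg (hopen : IsOpen {g | c g = 0}) (a : 𝒢.ReducedCStar) :
    ∃ b, Tendsto (fun n => orbitAvg c n a) atTop (𝓝 b) ∧ ∀ t, sigma c t b = b := by
  have happ : ∀ ε > 0, ∃ f, ‖a - 𝒢.ofCc f‖ < ε := fun ε hε => by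
    obtain ⟨_, ⟨f, rfl⟩, hf⟩ := Metric.mem_closure_iff.1 (𝒢.denseRange_ofCc a) ε hε
    exact ⟨f, by rwa [dist_eq_norm] at hf⟩
  have hclose : ∀ f n, ‖orbitAvg c n a - orbitAvg c n (𝒢.ofCc f)‖ ≤ ‖a - 𝒢.ofCc f‖ := fun f n => by
    rw [← orbitAvg_sub]
    exact norm_orbitAvg_le c n _
  -- The averaging maps are contractions, so convergence on a dense subset passes to all of the
  -- algebra.
  have hcauchy : CauchySeq fun n => orbitAvg c n a := by
    rw [Metric.cauchySeq_iff']
    intro ε hε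
    obtain ⟨f, hf⟩ := happ (ε / 4) (by positivity)
    obtain ⟨b, hb, -⟩ := exists_tendsto_orbitAvg_ofCc c hopen f
    obtain ⟨N, hN⟩ := Metric.cauchySeq_iff'.1 hb.cauchySeq (ε / 4) (by positivity)
    refine ⟨N, fun n hn => ?_⟩
    have h1 := hN n hn
    have h2 := hclose f n
    have h3 := hclose f N
    rw [← dist_eq_norm] at h2 h3
    rw [dist_comm] at h3
    have h4 := dist_triangle4 (orbitAvg c n a) (orbitAvg c n (𝒢.ofCc f))
      (orbitAvg c N (𝒢.ofCc f)) (orbitAvg c N a)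
    linarith
  obtain ⟨b, hb⟩ := cauchySeq_tendsto_of_complete hcauchy
  refine ⟨b, hb, fun t => ?_⟩
  rw [← sub_eq_zero, ← norm_le_zero_iff]
  refine le_of_forall_pos_lt_add fun ε hε => ?_
  obtain ⟨f, hf⟩ := happ (ε / 2) (by positivity)
  obtain ⟨b', hb', hinv⟩ := exists_tendsto_orbitAvg_ofCc c hopen f
  have hbb : ‖b - b'‖ ≤ ‖a - 𝒢.ofCc f‖ :=
    le_of_tendsto (hb.sub hb').norm (Eventually.of_forall (hclose f))
  have e : sigma c t b - b = sigma c t (b - b') - (b - b') := by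
    rw [map_sub, hinv]
    abel
  rw [e]
  refine (norm_sub_le _ _).trans_lt ?_
  rw [StarAlgEquiv.norm_map]
  linarith

end Average

/-! ### The measure on the groupoid induced by a measure on the units -/

section FibreMeasure

open MeasureTheory

variable {G X : Type*} [TopologicalSpace G] [TopologicalSpace X] [SecondCountableTopology G]
  [MeasurableSpace G] [BorelSpace G] [MeasurableSpace X] [BorelSpace X] (𝒢 : EtaleGroupoid G X)

/-- A countable Borel partition of `G` into sets on which `s` is injective, together with
measurable sections of `s` over their images. -/
theorem exists_sections : ∃ (D : ℕ → Set G) (τ : ℕ → X → G),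
    (∀ n, MeasurableSet (𝒢.s '' D n)) ∧ (∀ n, Measurable (τ n)) ∧
    (∀ n, ∀ g ∈ D n, τ n (𝒢.s g) = g) ∧ ∀ g, ∃! n, g ∈ D n := by
  -- The sections need a default value off their domains, which an empty `G` cannot supply; in that
  -- case `X` is empty too.
  rcases isEmpty_or_nonempty G with hG | ⟨⟨g₀⟩⟩
  · have hX : IsEmpty X := ⟨fun x => hG.false (𝒢.unit x)⟩
    exact ⟨fun _ => ∅, fun _ => isEmptyElim, by simp, fun _ => measurable_of_empty _,
      fun _ g => isEmptyElim g, fun g => isEmptyElim g⟩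
  have : Nonempty G := ⟨g₀⟩
  choose e hge hes using 𝒢.isLocalHomeomorph_s
  obtain ⟨T, hT, hTU⟩ := TopologicalSpace.isOpen_iUnion_countable (fun g => (e g).source)
    fun g => (e g).open_source
  have hTU' : ⋃ g ∈ T, (e g).source = Set.univ := by
    rw [hTU]
    exact Set.eq_univ_of_forall fun g => Set.mem_iUnion.2 ⟨g, hge g⟩
  have hTne : T.Nonempty := by
    by_contra h
    rw [Set.not_nonempty_iff_eq_empty] at h
    simp only [h, Set.mem_empty_iff_false, Set.iUnion_of_empty, Set.iUnion_empty] at hTU'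
    exact Set.empty_ne_univ hTU'
  obtain ⟨f, rfl⟩ := hT.exists_eq_range hTne
  classical
  set U : ℕ → Set G := fun n => (e (f n)).source with hU
  have hUm : ∀ n, MeasurableSet (disjointed U n) := fun n =>
    MeasurableSet.disjointed (fun n => (e (f n)).open_source.measurableSet) n
  have hτ : ∀ n, Measurable ((e (f n)).target.piecewise (e (f n)).symm fun _ => g₀) := fun n =>
    ContinuousOn.measurable_piecewise (e (f n)).continuousOn_symm continuousOn_const
      (e (f n)).open_target.measurableSet
  have hsec : ∀ n, ∀ g ∈ U n,
      (e (f n)).target.piecewise (e (f n)).symm (fun _ => g₀) (𝒢.s g) = g := by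
    intro n g hg
    have h1 : 𝒢.s g ∈ (e (f n)).target := by
      rw [hes (f n)]
      exact (e (f n)).map_source hg
    rw [Set.piecewise_eq_of_mem _ _ _ h1]
    conv_lhs => rw [hes (f n)]
    exact (e (f n)).left_inv hg
  refine ⟨disjointed U, _, fun n => ?_, hτ, fun n g hg => hsec n g (disjointed_subset U n hg),
    fun g => ?_⟩
  -- The disjointified pieces are Borel but need not be open. Their images are Borel because they
  -- are preimages of the pieces under the measurable sections.
  · have : 𝒢.s '' disjointed U n = (e (f n)).target ∩
        ((e (f n)).target.piecewise (e (f n)).symm fun _ => g₀) ⁻¹' disjointed U n := by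
      ext x
      constructor
      · rintro ⟨g, hg, rfl⟩
        refine ⟨?_, ?_⟩
        · rw [hes (f n)]
          exact (e (f n)).map_source (disjointed_subset U n hg)
        · rwa [Set.mem_preimage, hsec n g (disjointed_subset U n hg)]
      · rintro ⟨hx, hx'⟩
        rw [Set.mem_preimage, Set.piecewise_eq_of_mem _ _ _ hx] at hx'
        refine ⟨_, hx', ?_⟩
        rw [hes (f n)]
        exact (e (f n)).right_inv hx
    rw [this]
    exact (e (f n)).open_target.measurableSet.inter (hτ n (hUm n))
  · have h1 : g ∈ ⋃ n, disjointed U n := by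
      rw [iUnion_disjointed]
      have : g ∈ ⋃ g ∈ Set.range f, (e g).source := by rw [hTU']; trivial
      simpa [hU] using this
    obtain ⟨n, hn⟩ := Set.mem_iUnion.1 h1
    refine ⟨n, hn, fun k hk => ?_⟩
    by_contra hne
    exact Set.disjoint_left.1 (disjoint_disjointed U hne) hk hn

/-- The measure `∫ ∑_{g ∈ G_x} δ_g dm(x)` on `G` obtained by integrating the counting measures on
the fibres of the source map. -/
noncomputable def fibreMeasure (m : Measure X) : Measure G :=
  Measure.sum fun n => (m.restrict (𝒢.s '' 𝒢.exists_sections.choose n)).map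
    (𝒢.exists_sections.choose_spec.choose n)

/-- The points of the fibre over `x` correspond bijectively to the indices `n` for which `x` lies in
the image of the `n`-th piece. This converts sums whose index type varies with `x` into one
countable sum of measurable functions. -/
theorem tsum_fibre_eq {α : Type*} [AddCommMonoid α] [TopologicalSpace α]
    (F : G → α) (x : X) : ∑' g : {g : G // 𝒢.s g = x}, F g =
      ∑' n, (𝒢.s '' 𝒢.exists_sections.choose n).indicator
        (fun x => F (𝒢.exists_sections.choose_spec.choose n x)) x := by
  obtain ⟨-, -, h3, h4⟩ := 𝒢.exists_sections.choose_spec.choose_spec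
  set D := 𝒢.exists_sections.choose
  set τ := 𝒢.exists_sections.choose_spec.choose
  have hmem : ∀ n, x ∈ 𝒢.s '' D n → τ n x ∈ D n ∧ 𝒢.s (τ n x) = x := by
    rintro n ⟨g, hg, rfl⟩
    rw [h3 n g hg]
    exact ⟨hg, rfl⟩
  let φ : {n | x ∈ 𝒢.s '' D n} → {g : G // 𝒢.s g = x} := fun n => ⟨τ n x, (hmem n n.2).2⟩
  have hφ : Function.Bijective φ := by
    constructor
    · rintro ⟨n, hn⟩ ⟨k, hk⟩ h
      have h' : τ n x = τ k x := congrArg Subtype.val h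
      refine Subtype.ext ((h4 (τ n x)).unique (hmem n hn).1 ?_)
      rw [h']
      exact (hmem k hk).1
    · rintro ⟨g, rfl⟩
      obtain ⟨n, hn, -⟩ := h4 g
      exact ⟨⟨n, g, hn, rfl⟩, Subtype.ext (h3 n g hn)⟩
  rw [← (Equiv.ofBijective φ hφ).tsum_eq]
  refine (tsum_subtype {n | x ∈ 𝒢.s '' D n} fun n => F (τ n x)).trans ?_
  exact tsum_congr fun n => by
    classical
    simp only [Set.indicator_apply]
    rfl

theorem lintegral_fibreMeasure (m : Measure X) {f : G → ℝ≥0∞} (hf : Measurable f) :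
    ∫⁻ g, f g ∂(𝒢.fibreMeasure m) = ∫⁻ x, ∑' g : {g : G // 𝒢.s g = x}, f g ∂m := by
  obtain ⟨h1, h2, -, -⟩ := 𝒢.exists_sections.choose_spec.choose_spec
  have hcomp : ∀ n, Measurable ((𝒢.s '' 𝒢.exists_sections.choose n).indicator
      fun x => f (𝒢.exists_sections.choose_spec.choose n x)) := fun n =>
    (hf.comp (h2 n)).indicator (h1 n)
  simp only [tsum_fibre_eq]
  rw [lintegral_tsum fun n => (hcomp n).aemeasurable, fibreMeasure,
    lintegral_sum_measure]
  refine tsum_congr fun n => ?_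
  rw [lintegral_map hf (h2 n), ← lintegral_indicator (h1 n)]

theorem integral_fibreMeasure (m : Measure X) {f : G → ℂ} (hf : Measurable f)
    (hi : Integrable f (𝒢.fibreMeasure m)) :
    ∫ g, f g ∂(𝒢.fibreMeasure m) = ∫ x, ∑' g : {g : G // 𝒢.s g = x}, f g ∂m := by
  obtain ⟨h1, h2, -, -⟩ := 𝒢.exists_sections.choose_spec.choose_spec
  have hfin : ∫⁻ g, ‖f g‖ₑ ∂(𝒢.fibreMeasure m) ≠ ∞ := hi.2.ne
  have hcomp : ∀ n, Measurable ((𝒢.s '' 𝒢.exists_sections.choose n).indicator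
      fun x => f (𝒢.exists_sections.choose_spec.choose n x)) := fun n =>
    (hf.comp (h2 n)).indicator (h1 n)
  simp only [tsum_fibre_eq]
  rw [integral_tsum fun n => (hcomp n).aestronglyMeasurable]
  · rw [fibreMeasure, integral_sum_measure hi]
    refine tsum_congr fun n => ?_
    rw [integral_map (h2 n).aemeasurable hf.aestronglyMeasurable, ← integral_indicator (h1 n)]
  · rw [fibreMeasure, lintegral_sum_measure] at hfin
    convert hfin using 3 with n
    rw [lintegral_map hf.enorm (h2 n), ← lintegral_indicator (h1 n)]
    refine lintegral_congr fun x => ?_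
    rw [enorm_indicator_eq_indicator_enorm]

theorem fibreMeasure_apply {W : Set G} (m : Measure X) (hW : IsOpen W) (hs : Set.InjOn 𝒢.s W) :
    𝒢.fibreMeasure m W = m (𝒢.s '' W) := by
  rw [← lintegral_indicator_one hW.measurableSet, 𝒢.lintegral_fibreMeasure m
    (measurable_one.indicator hW.measurableSet), ← lintegral_indicator_one
    (𝒢.isLocalHomeomorph_s.isOpenMap W hW).measurableSet]
  refine lintegral_congr fun x => ?_
  by_cases hx : x ∈ 𝒢.s '' W
  · obtain ⟨w, hw, rfl⟩ := hx
    rw [tsum_eq_single ⟨w, rfl⟩, Set.indicator_of_mem hw,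
      Set.indicator_of_mem (Set.mem_image_of_mem _ hw)]
    · rfl
    · rintro ⟨g, hg⟩ hne
      exact Set.indicator_of_notMem (fun hgW => hne (Subtype.ext (hs hgW hw hg))) _
  · rw [Set.indicator_of_notMem hx, ENNReal.tsum_eq_zero]
    rintro ⟨g, rfl⟩
    exact Set.indicator_of_notMem (fun hgW => hx ⟨g, hgW, rfl⟩) _

variable {𝒢} (c : 𝒢.RealHom) (β : ℝ)

omit [SecondCountableTopology G] [MeasurableSpace X] [BorelSpace X] in
theorem measurable_exp_cocycle : Measurable fun g => ENNReal.ofReal (Real.exp (-β * c g)) := by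
  have := c.continuous_toFun.measurable
  fun_prop

/-- The source fibre over `x` meets `W⁻¹` exactly when `x ∈ r(W)`, then only in the inverse of
`r_W⁻¹(x)`, where `-βc` takes the value `βc(r_W⁻¹(x))`. So the right side of the conformality
equation is the mass of a set in `G`. -/
theorem withDensity_fibreMeasure_apply {W : Set G} (m : Measure X) (hW : IsOpen W)
    (hr : Set.InjOn 𝒢.r W) :
    (𝒢.fibreMeasure m).withDensity (fun g => ENNReal.ofReal (Real.exp (-β * c g))) (𝒢.inv ⁻¹' W) =
      ∫⁻ x in 𝒢.r '' W, ENNReal.ofReal (Real.exp (β * c (𝒢.rInv W x))) ∂m := by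
  have hW' : MeasurableSet (𝒢.inv ⁻¹' W) := (hW.preimage 𝒢.continuous_inv).measurableSet
  rw [withDensity_apply _ hW', ← lintegral_indicator hW', 𝒢.lintegral_fibreMeasure m
    ((measurable_exp_cocycle c β).indicator hW'),
    ← lintegral_indicator (𝒢.isLocalHomeomorph_r.isOpenMap W hW).measurableSet]
  refine lintegral_congr fun x => ?_
  by_cases hx : x ∈ 𝒢.r '' W
  · obtain ⟨w, hw, rfl⟩ := hx
    have hmem : 𝒢.inv w ∈ 𝒢.inv ⁻¹' W := by
      rw [Set.mem_preimage, 𝒢.inv_inv]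
      exact hw
    rw [tsum_eq_single ⟨𝒢.inv w, 𝒢.s_inv w⟩, Set.indicator_of_mem hmem,
      Set.indicator_of_mem (Set.mem_image_of_mem _ hw), 𝒢.rInv_apply hr hw, c.map_inv,
      neg_mul_neg]
    rintro ⟨g, hg⟩ hne
    refine Set.indicator_of_notMem (fun hgW => hne (Subtype.ext ?_)) _
    exact (𝒢.inv_inv g).symm.trans (congrArg 𝒢.inv (hr hgW hw (by rw [𝒢.r_inv, hg])))
  · rw [Set.indicator_of_notMem hx, ENNReal.tsum_eq_zero]
    rintro ⟨g, rfl⟩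
    exact Set.indicator_of_notMem (s := 𝒢.inv ⁻¹' W) (fun hgW => hx ⟨𝒢.inv g, hgW, 𝒢.r_inv g⟩) _

variable (𝒢) in
omit [SecondCountableTopology G] [MeasurableSpace G] [BorelSpace G] [BorelSpace X] in
/-- Every point has small open bisection neighbourhoods whose images have finite measure. -/
theorem exists_bisection_nhds (m : Measure X) [IsLocallyFiniteMeasure m] {g : G} {U : Set G}
    (hU : IsOpen U) (hg : g ∈ U) : ∃ W, IsOpen W ∧ Set.InjOn 𝒢.r W ∧ Set.InjOn 𝒢.s W ∧
      m (𝒢.r '' W) < ∞ ∧ m (𝒢.s '' W) < ∞ ∧ g ∈ W ∧ W ⊆ U := by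
  obtain ⟨e, he, her⟩ := 𝒢.isLocalHomeomorph_r g
  obtain ⟨e', he', hes⟩ := 𝒢.isLocalHomeomorph_s g
  obtain ⟨V, hgV, hV, hVm⟩ := m.exists_isOpen_measure_lt_top (𝒢.r g)
  obtain ⟨V', hgV', hV', hVm'⟩ := m.exists_isOpen_measure_lt_top (𝒢.s g)
  refine ⟨(U ∩ (e.source ∩ e'.source)) ∩ (𝒢.r ⁻¹' V ∩ 𝒢.s ⁻¹' V'),
    (hU.inter (e.open_source.inter e'.open_source)).inter
      ((hV.preimage 𝒢.continuous_r).inter (hV'.preimage 𝒢.continuous_s)), ?_, ?_, ?_, ?_,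
    ⟨⟨hg, he, he'⟩, hgV, hgV'⟩, fun w hw => hw.1.1⟩
  · rw [her]
    exact e.injOn.mono fun w hw => hw.1.2.1
  · rw [hes]
    exact e'.injOn.mono fun w hw => hw.1.2.2
  · refine (measure_mono ?_).trans_lt hVm
    rintro _ ⟨w, hw, rfl⟩
    exact hw.2.1
  · refine (measure_mono ?_).trans_lt hVm'
    rintro _ ⟨w, hw, rfl⟩
    exact hw.2.2

instance isLocallyFiniteMeasure_fibreMeasure (m : Measure X) [IsLocallyFiniteMeasure m] :
    IsLocallyFiniteMeasure (𝒢.fibreMeasure m) := by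
  refine ⟨fun g => ?_⟩
  obtain ⟨W, hW, -, hs, -, hfin, hg, -⟩ := 𝒢.exists_bisection_nhds m isOpen_univ (Set.mem_univ g)
  exact ⟨W, hW.mem_nhds hg, by rwa [𝒢.fibreMeasure_apply m hW hs]⟩

/-- A locally finite measure `m` is conformal if and only if the inversion of `G` transforms the
measure `∫ ∑_{g ∈ G_x} δ_g dm(x)` by the density `e^{-βc}`. -/
theorem isConformal_iff (m : Measure X) [IsLocallyFiniteMeasure m] : IsConformal c β m ↔
    (𝒢.fibreMeasure m).map 𝒢.inv =
      (𝒢.fibreMeasure m).withDensity (fun g => ENNReal.ofReal (Real.exp (-β * c g))) := by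
  have hinvm : Measurable 𝒢.inv := 𝒢.continuous_inv.measurable
  have himg : ∀ W, 𝒢.inv ⁻¹' (𝒢.inv ⁻¹' W) = W := fun W => by
    ext g
    simp only [Set.mem_preimage, 𝒢.inv_inv]
  constructor
  · intro hm
    -- These bisections form a basis closed under intersections, so they suffice to compare the two
    -- measures. The finiteness condition makes them of finite mass, since the transported measure
    -- of `V` is `m(s(V⁻¹)) = m(r(V))`.
    set S : Set (Set G) := {W | IsOpen W ∧ Set.InjOn 𝒢.r W ∧ Set.InjOn 𝒢.s W ∧ m (𝒢.r '' W) < ∞}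
      with hS
    have hbasis : TopologicalSpace.IsTopologicalBasis S := by
      refine TopologicalSpace.isTopologicalBasis_of_isOpen_of_nhds (fun W hW => hW.1) ?_
      intro g U hg hU
      obtain ⟨W, h1, h2, h3, h4, -, h5, h6⟩ := 𝒢.exists_bisection_nhds m hU hg
      exact ⟨W, ⟨h1, h2, h3, h4⟩, h5, h6⟩
    obtain ⟨T, hTc, hTS, hTU⟩ := TopologicalSpace.isOpen_sUnion_countable S fun W hW => hW.1
    have hval : ∀ V ∈ S, (𝒢.fibreMeasure m).map 𝒢.inv V = m (𝒢.s '' (𝒢.inv ⁻¹' V)) := by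
      rintro V ⟨h1, h2, h3, -⟩
      rw [Measure.map_apply hinvm h1.measurableSet, 𝒢.fibreMeasure_apply m
        (h1.preimage 𝒢.continuous_inv)]
      intro g hg g' hg' e
      refine 𝒢.inv_bijective.1 (h2 hg hg' ?_)
      rw [𝒢.r_inv, 𝒢.r_inv, e]
    refine Measure.ext_of_generateFrom_of_cover_subset (S := S) (T := T) ?_ ?_ hTS hTc ?_ ?_ ?_
    · rw [BorelSpace.measurable_eq (α := G), hbasis.borel_eq_generateFrom]
    · rintro V ⟨h1, h2, h3, h4⟩ V' ⟨h1', -, -, -⟩ -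
      exact ⟨h1.inter h1', h2.mono Set.inter_subset_left, h3.mono Set.inter_subset_left,
        (measure_mono (Set.image_mono Set.inter_subset_left)).trans_lt h4⟩
    · rw [hTU, hbasis.sUnion_eq]
    · intro V hV
      rw [hval V (hTS hV)]
      refine ((measure_mono ?_).trans_lt (hTS hV).2.2.2).ne
      rintro _ ⟨g, hg, rfl⟩
      exact ⟨𝒢.inv g, hg, 𝒢.r_inv g⟩
    · intro V hV
      rw [hval V hV]
      obtain ⟨h1, h2, h3, -⟩ := hV
      have hr : Set.InjOn 𝒢.r (𝒢.inv ⁻¹' V) := by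
        intro g hg g' hg' e
        refine 𝒢.inv_bijective.1 (h3 hg hg' ?_)
        rw [𝒢.s_inv, 𝒢.s_inv, e]
      -- Conformality is applied to the bisection `V⁻¹` rather than `V`, which puts `V` itself on
      -- the density side.
      rw [hm _ (h1.preimage 𝒢.continuous_inv) hr, ← withDensity_fibreMeasure_apply c β m
        (h1.preimage 𝒢.continuous_inv) hr, himg]
      intro g hg g' hg' e
      refine 𝒢.inv_bijective.1 (h2 hg hg' ?_)
      rw [𝒢.r_inv, 𝒢.r_inv, e]
  · intro hm W hW hr hs
    rw [← withDensity_fibreMeasure_apply c β m hW hr, ← hm, Measure.map_apply hinvm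
      (hW.preimage 𝒢.continuous_inv).measurableSet, himg, 𝒢.fibreMeasure_apply m hW hs]

end FibreMeasure

/-! ### From conformal measures to KMS weights -/

section MeasureWeight

open MeasureTheory

variable {G X : Type*} [TopologicalSpace G] [TopologicalSpace X] [T2Space G] [LocallyCompactSpace G]
  [MeasurableSpace X] [BorelSpace X] (𝒢 : EtaleGroupoid G X) (m : Measure X)

omit [BorelSpace X] in
theorem posExt_weightOf {a : 𝒢.ReducedCStar} (ha : 0 ≤ a) :
    posExt (𝒢.weightOf m) a = ∫⁻ x, ENNReal.ofReal (𝒢.condExp a x).re ∂m :=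
  posExt_of_nonneg ha

omit [MeasurableSpace X] [BorelSpace X] in
theorem continuous_condExp (a : 𝒢.ReducedCStar) : Continuous fun x => 𝒢.condExp a x :=
  (𝒢.condExp a).continuous

theorem measurable_condExp (a : 𝒢.ReducedCStar) :
    Measurable fun x => ENNReal.ofReal (𝒢.condExp a x).re := by
  have := (𝒢.continuous_condExp a).measurable
  fun_prop

omit [MeasurableSpace X] [BorelSpace X] in
theorem diagElt_conj_nonneg (p : C_c(X, ℝ)) {a : 𝒢.ReducedCStar} (ha : 0 ≤ a) :
    0 ≤ 𝒢.diagElt p * a * 𝒢.diagElt p := by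
  have := star_left_conjugate_nonneg ha (𝒢.diagElt p)
  rwa [star_diagElt] at this

omit [MeasurableSpace X] [BorelSpace X] in
theorem condExp_diagElt_conj_re (p : C_c(X, ℝ)) (a : 𝒢.ReducedCStar) (x : X) :
    (𝒢.condExp (𝒢.diagElt p * a * 𝒢.diagElt p) x).re = p x ^ 2 * (𝒢.condExp a x).re := by
  rw [condExp_diagElt_mul_mul, ← Complex.ofReal_mul, Complex.re_ofReal_mul]
  ring

theorem weightOf_nonzero [SecondCountableTopology G] (hm : m ≠ 0) : ∃ a, 𝒢.weightOf m a ≠ 0 := by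
  have := 𝒢.t2Space_units
  have := 𝒢.locallyCompactSpace_units
  have : SecondCountableTopology X :=
    𝒢.isClosedEmbedding_unit.isEmbedding.secondCountableTopology
  have hK : ∃ n, m (compactCovering X n) ≠ 0 := by
    by_contra! h
    refine hm (Measure.measure_univ_eq_zero.1 ?_)
    rw [← iUnion_compactCovering]
    exact measure_iUnion_null h
  obtain ⟨n, hn⟩ := hK
  obtain ⟨p, h1, -, -⟩ := exists_bump (isCompact_compactCovering X n) isOpen_univ
    (Set.subset_univ _)
  have h0 : 0 ≤ 𝒢.diagElt p * 𝒢.diagElt p := by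
    have := star_mul_self_nonneg (𝒢.diagElt p)
    rwa [star_diagElt] at this
  refine ⟨⟨_, h0⟩, ?_⟩
  change ∫⁻ x, ENNReal.ofReal (𝒢.condExp (𝒢.diagElt p * 𝒢.diagElt p) x).re ∂m ≠ 0
  have hle : m (compactCovering X n) ≤
      ∫⁻ x, ENNReal.ofReal (𝒢.condExp (𝒢.diagElt p * 𝒢.diagElt p) x).re ∂m := by
    rw [← lintegral_indicator_one (isCompact_compactCovering X n).measurableSet]
    refine lintegral_mono fun x => ?_
    by_cases hx : x ∈ compactCovering X n
    · rw [Set.indicator_of_mem hx, ← diagElt_mul, condExp_diagElt,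
        CompactlySupportedContinuousMap.mul_apply, h1 x hx]
      simp
    · rw [Set.indicator_of_notMem hx]
      exact zero_le
  exact fun h => hn (le_antisymm (h ▸ hle) zero_le)

theorem lintegral_conj_lt_top [IsFiniteMeasureOnCompacts m] (p : C_c(X, ℝ)) (a : 𝒢.ReducedCStar) :
    ∫⁻ x, ENNReal.ofReal (p x ^ 2 * (𝒢.condExp a x).re) ∂m < ∞ := by
  have := 𝒢.t2Space_units
  have h1 : Continuous fun x => p x ^ 2 * (𝒢.condExp a x).re := by
    have := 𝒢.continuous_condExp a
    fun_prop
  have h2 : HasCompactSupport fun x => p x ^ 2 * (𝒢.condExp a x).re :=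
    HasCompactSupport.intro p.hasCompactSupport fun x hx => by
      rw [image_eq_zero_of_notMem_tsupport hx]
      simp
  exact (h1.integrable_of_hasCompactSupport h2).lintegral_lt_top

theorem isProperWeight_weightOf [SecondCountableTopology G] [IsFiniteMeasureOnCompacts m]
    (hm : m ≠ 0) : IsProperWeight (𝒢.weightOf m) where
  map_add a b := by
    change ∫⁻ x, ENNReal.ofReal (𝒢.condExp (a + b : 𝒢.ReducedCStar) x).re ∂m = _
    rw [weightOf, weightOf, ← lintegral_add_left (𝒢.measurable_condExp a)]
    refine lintegral_congr fun x => ?_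
    rw [condExp_add, Complex.add_re, ENNReal.ofReal_add (𝒢.condExp_nonneg a.2 x).1
      (𝒢.condExp_nonneg b.2 x).1]
  map_smul r hr a := by
    change ∫⁻ x, ENNReal.ofReal (𝒢.condExp (r • (a : 𝒢.ReducedCStar)) x).re ∂m = _
    rw [weightOf, ← lintegral_const_mul _ (𝒢.measurable_condExp a)]
    refine lintegral_congr fun x => ?_
    rw [← Complex.coe_smul, condExp_smul, Complex.re_ofReal_mul, ENNReal.ofReal_mul hr.le]
  nonzero := 𝒢.weightOf_nonzero m hm
  denselyDefined := by
    rintro ⟨a, ha⟩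
    rw [Metric.mem_closure_iff]
    intro ε hε
    obtain ⟨p, -, hp⟩ := 𝒢.exists_approx_unit a hε
    -- The compressions `p a p` approximate `a`, and they have finite weight because `P(p a p) = p²
    -- P(a)` is compactly supported.
    refine ⟨⟨_, 𝒢.diagElt_conj_nonneg p ha⟩, ?_, ?_⟩
    · change ∫⁻ x, ENNReal.ofReal (𝒢.condExp _ x).re ∂m < ∞
      simp only [condExp_diagElt_conj_re]
      exact 𝒢.lintegral_conj_lt_top m p a
    · rw [dist_comm, Subtype.dist_eq, dist_eq_norm]
      exact hp
  lowerSemicontinuous r hr := by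
    -- Sequences suffice in a metric space; then `P(u n)` converges pointwise and Fatou's lemma
    -- applies.
    refine IsSeqClosed.isClosed fun u a hu hua => ?_
    have hlim : ∀ x, Filter.Tendsto (fun n => ENNReal.ofReal (𝒢.condExp (u n) x).re) Filter.atTop
        (nhds (ENNReal.ofReal (𝒢.condExp a x).re)) := by
      intro x
      simp only [condExp_eq_coef]
      have h1 : Continuous fun b : 𝒢.ReducedCStar =>
          ENNReal.ofReal (𝒢.coef b (𝒢.unit x)).re := by
        exact ENNReal.continuous_ofReal.comp
          (Complex.continuous_re.comp (𝒢.continuous_coef_left (𝒢.unit x)))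
      exact (h1.comp continuous_subtype_val).continuousAt.tendsto.comp hua
    change ∫⁻ x, ENNReal.ofReal (𝒢.condExp a x).re ∂m ≤ _
    calc ∫⁻ x, ENNReal.ofReal (𝒢.condExp a x).re ∂m
        = ∫⁻ x, Filter.liminf (fun n => ENNReal.ofReal (𝒢.condExp (u n) x).re) Filter.atTop ∂m :=
          lintegral_congr fun x => (hlim x).liminf_eq.symm
      _ ≤ Filter.liminf (fun n => ∫⁻ x, ENNReal.ofReal (𝒢.condExp (u n) x).re ∂m) Filter.atTop :=
          lintegral_liminf_le fun n => 𝒢.measurable_condExp _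
      _ ≤ ENNReal.ofReal r :=
          Filter.liminf_le_of_frequently_le' (Filter.Frequently.of_forall fun n => hu n)

omit [BorelSpace X] in
theorem isInvariantWeight_weightOf (c : 𝒢.RealHom) :
    IsInvariantWeight (𝒢.weightOf m) (sigma c) := fun t a => by
  refine lintegral_congr fun x => ?_
  rw [condExp_sigma]

omit [MeasurableSpace X] [BorelSpace X] in
theorem norm_condExp_star_mul_le (a b : 𝒢.ReducedCStar) (x : X) :
    ‖𝒢.condExp (star a * b) x‖ ≤
      (𝒢.condExp (star a * a) x).re + (𝒢.condExp (star b * b) x).re := by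
  refine (𝒢.hasSum_condExp_star_mul a b x).norm_le_of_bounded
    ((𝒢.hasSum_condExp_star_mul_self a x).add (𝒢.hasSum_condExp_star_mul_self b x)) fun g => ?_
  rw [norm_mul, RCLike.norm_conj]
  nlinarith [sq_nonneg (‖𝒢.coef a g‖ - ‖𝒢.coef b g‖), sq_nonneg (‖𝒢.coef a g‖),
    sq_nonneg (‖𝒢.coef b g‖)]

variable {m} {𝒢}

theorem integrable_condExp_re {a : 𝒢.ReducedCStar} (ha : a ∈ weightN (𝒢.weightOf m)) :
    Integrable (fun x => (𝒢.condExp (star a * a) x).re) m := by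
  refine ⟨(Complex.continuous_re.comp (𝒢.continuous_condExp _)).measurable.aestronglyMeasurable, ?_⟩
  rw [hasFiniteIntegral_iff_ofReal (Filter.Eventually.of_forall fun x =>
    (𝒢.condExp_nonneg (star_mul_self_nonneg a) x).1)]
  exact ha

theorem integrable_condExp {a : 𝒢.ReducedCStar} (ha : a ∈ weightDomain (𝒢.weightOf m)) :
    Integrable (fun x => 𝒢.condExp a x) m := by
  induction ha using Submodule.span_induction with
  | mem x hx =>
    obtain ⟨a, ha, b, hb, rfl⟩ := hx
    exact ((integrable_condExp_re ha).add (integrable_condExp_re hb)).mono'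
      (𝒢.continuous_condExp _).measurable.aestronglyMeasurable
      (Filter.Eventually.of_forall fun x => 𝒢.norm_condExp_star_mul_le a b x)
  | zero =>
    have : (fun x => 𝒢.condExp 0 x) = fun _ => 0 := by
      funext x
      rw [condExp_eq_coef]
      rfl
    rw [this]
    exact integrable_zero _ _ _
  | add a b _ _ ha hb =>
    simp only [condExp_add]
    exact ha.add hb
  | smul z a _ ha =>
    simp only [condExp_smul]
    exact ha.const_mul z

variable (m 𝒢) in
/-- The linear extension `a ↦ ∫ P(a) dm` of the weight `φ_m`. -/
noncomputable def weightFunctional : weightDomain (𝒢.weightOf m) →ₗ[ℂ] ℂ where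
  toFun a := ∫ x, 𝒢.condExp a x ∂m
  map_add' a b := by
    rw [← integral_add (integrable_condExp a.2) (integrable_condExp b.2)]
    exact integral_congr_ae (Filter.Eventually.of_forall fun x => 𝒢.condExp_add a b x)
  map_smul' z a := by
    rw [RingHom.id_apply, smul_eq_mul, ← integral_const_mul]
    exact integral_congr_ae (Filter.Eventually.of_forall fun x => 𝒢.condExp_smul z a x)

theorem isWeightExtension_weightFunctional :
    IsWeightExtension (𝒢.weightOf m) (𝒢.weightFunctional m) := by
  rintro ⟨a, ha⟩ ha0
  have hi := integrable_condExp ha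
  refine ⟨hi.re.lintegral_lt_top, ?_⟩
  change ∫ x, 𝒢.condExp a x ∂m = ((∫⁻ x, ENNReal.ofReal (𝒢.condExp a x).re ∂m).toReal : ℂ)
  rw [← integral_eq_lintegral_of_nonneg_ae (Filter.Eventually.of_forall fun x =>
    (𝒢.condExp_nonneg ha0 x).1) hi.re.1]
  exact (integral_congr_ae (Filter.Eventually.of_forall fun x =>
    (𝒢.condExp_nonneg ha0 x).2)).trans integral_ofReal

section

variable [SecondCountableTopology G] [MeasurableSpace G] [BorelSpace G]

/-- Identifies membership in `𝒩` for `φ_m` with square integrability of the coefficient function on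
`G`. -/
theorem lintegral_norm_coef_sq (a : 𝒢.ReducedCStar) :
    ∫⁻ g, ENNReal.ofReal (‖𝒢.coef a g‖ ^ 2) ∂(𝒢.fibreMeasure m) =
      ∫⁻ x, ENNReal.ofReal (𝒢.condExp (star a * a) x).re ∂m := by
  have hm := (𝒢.continuous_coef a).measurable
  rw [𝒢.lintegral_fibreMeasure m (by fun_prop)]
  refine lintegral_congr fun x => ?_
  have h := 𝒢.hasSum_condExp_star_mul_self a x
  rw [← h.tsum_eq, ENNReal.ofReal_tsum_of_nonneg (fun _ => by positivity) h.summable]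

theorem integrable_conj_coef_mul_coef {a b : 𝒢.ReducedCStar} (ha : a ∈ weightN (𝒢.weightOf m))
    (hb : b ∈ weightN (𝒢.weightOf m)) :
    Integrable (fun g => starRingEnd ℂ (𝒢.coef a g) * 𝒢.coef b g) (𝒢.fibreMeasure m) := by
  have hsq : ∀ {a : 𝒢.ReducedCStar}, a ∈ weightN (𝒢.weightOf m) →
      Integrable (fun g => ‖𝒢.coef a g‖ ^ 2) (𝒢.fibreMeasure m) := by
    intro a ha
    refine ⟨((𝒢.continuous_coef a).norm.pow 2).measurable.aestronglyMeasurable, ?_⟩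
    rw [hasFiniteIntegral_iff_ofReal (Filter.Eventually.of_forall fun g => by positivity),
      lintegral_norm_coef_sq]
    exact ha
  refine ((hsq ha).add (hsq hb)).mono' ((Complex.continuous_conj.comp
    (𝒢.continuous_coef a)).mul (𝒢.continuous_coef b)).measurable.aestronglyMeasurable
    (Filter.Eventually.of_forall fun g => ?_)
  rw [norm_mul, RCLike.norm_conj, Pi.add_apply]
  nlinarith [sq_nonneg (‖𝒢.coef a g‖ - ‖𝒢.coef b g‖), sq_nonneg (‖𝒢.coef a g‖),
    sq_nonneg (‖𝒢.coef b g‖)]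

omit [T2Space G] [LocallyCompactSpace G] in
/-- Change of variables for the inversion of `G`. -/
theorem integral_exp_cocycle_smul (c : 𝒢.RealHom) {β : ℝ} (hm : (𝒢.fibreMeasure m).map 𝒢.inv =
      (𝒢.fibreMeasure m).withDensity (fun g => ENNReal.ofReal (Real.exp (-β * c g))))
    (f : G → ℂ) : ∫ g, Real.exp (-β * c g) • f g ∂(𝒢.fibreMeasure m) =
      ∫ g, f (𝒢.inv g) ∂(𝒢.fibreMeasure m) := by
  have h1 := integral_withDensity_eq_integral_toReal_smul (μ := 𝒢.fibreMeasure m)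
    (measurable_exp_cocycle c β) (Filter.Eventually.of_forall fun g => ENNReal.ofReal_lt_top) f
  rw [← hm, 𝒢.invHomeo.measurableEmbedding.integral_map (f := 𝒢.inv)] at h1
  rw [h1]
  refine integral_congr_ae (Filter.Eventually.of_forall fun g => ?_)
  simp only [ENNReal.toReal_ofReal (Real.exp_pos _).le]

omit [T2Space G] [LocallyCompactSpace G] in
theorem integrable_exp_cocycle_smul (c : 𝒢.RealHom) {β : ℝ}
    (hm : (𝒢.fibreMeasure m).map 𝒢.inv =
      (𝒢.fibreMeasure m).withDensity (fun g => ENNReal.ofReal (Real.exp (-β * c g))))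
    {f : G → ℂ} (hf : Integrable (fun g => f (𝒢.inv g)) (𝒢.fibreMeasure m)) :
    Integrable (fun g => Real.exp (-β * c g) • f g) (𝒢.fibreMeasure m) := by
  have h1 := integrable_withDensity_iff_integrable_smul' (μ := 𝒢.fibreMeasure m)
    (measurable_exp_cocycle c β) (Filter.Eventually.of_forall fun g => ENNReal.ofReal_lt_top)
    (g := f)
  rw [← hm, 𝒢.invHomeo.measurableEmbedding.integrable_map_iff (f := 𝒢.inv)] at h1
  refine (h1.1 hf).congr (Filter.Eventually.of_forall fun g => ?_)
  simp only [ENNReal.toReal_ofReal (Real.exp_pos _).le]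

theorem integral_phase_mul (c : 𝒢.RealHom) (t : ℝ) {a b : 𝒢.ReducedCStar}
    (ha : star a ∈ weightN (𝒢.weightOf m)) (hb : b ∈ weightN (𝒢.weightOf m)) :
    ∫ g, phase c t g * (starRingEnd ℂ (𝒢.coef (star a) g) * 𝒢.coef b g) ∂(𝒢.fibreMeasure m) =
      ∫ x, 𝒢.condExp (a * sigma c t b) x ∂m := by
  have hb' := (𝒢.isInvariantWeight_weightOf m c).apply_mem t hb
  have e : ∀ g, phase c t g * (starRingEnd ℂ (𝒢.coef (star a) g) * 𝒢.coef b g) =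
      starRingEnd ℂ (𝒢.coef (star a) g) * 𝒢.coef (sigma c t b) g := fun g => by
    rw [coef_sigma]
    ring
  simp only [e]
  refine (𝒢.integral_fibreMeasure m ((Complex.continuous_conj.comp
    (𝒢.continuous_coef _)).mul (𝒢.continuous_coef _)).measurable
    (integrable_conj_coef_mul_coef ha hb')).trans ?_
  refine integral_congr_ae (Filter.Eventually.of_forall fun x => ?_)
  have h := (𝒢.hasSum_condExp_star_mul (star a) (sigma c t b) x).tsum_eq
  rw [star_star] at h
  exact h

omit [MeasurableSpace X] [BorelSpace X] [SecondCountableTopology G] [MeasurableSpace G] [BorelSpace G] in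
theorem phase_mul_inv_eq (c : 𝒢.RealHom) (t : ℝ) (a b : 𝒢.ReducedCStar) (g : G) :
    phase c t (𝒢.inv g) * (starRingEnd ℂ (𝒢.coef (star a) (𝒢.inv g)) * 𝒢.coef b (𝒢.inv g)) =
      starRingEnd ℂ (𝒢.coef (star (sigma c t b)) g) * 𝒢.coef a g := by
  rw [coef_star, coef_star, Complex.conj_conj, Complex.conj_conj, 𝒢.inv_inv, coef_sigma]
  ring

/-- The coefficients of an adjoint are conjugates at the inverse arrow, so substituting `g⁻¹`
reverses the product and turns the integrand for `a σ_t(b)` into that for `σ_t(b) a`. -/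
theorem integral_phase_mul_inv (c : 𝒢.RealHom) (t : ℝ) {a b : 𝒢.ReducedCStar}
    (ha : a ∈ weightN (𝒢.weightOf m)) (hb : star b ∈ weightN (𝒢.weightOf m)) :
    ∫ g, phase c t (𝒢.inv g) * (starRingEnd ℂ (𝒢.coef (star a) (𝒢.inv g)) * 𝒢.coef b (𝒢.inv g))
        ∂(𝒢.fibreMeasure m) = ∫ x, 𝒢.condExp (sigma c t b * a) x ∂m := by
  have hb' := (𝒢.isInvariantWeight_weightOf m c).star_apply_mem t hb
  simp only [phase_mul_inv_eq]
  refine (𝒢.integral_fibreMeasure m ((Complex.continuous_conj.comp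
    (𝒢.continuous_coef _)).mul (𝒢.continuous_coef _)).measurable
    (integrable_conj_coef_mul_coef hb' ha)).trans ?_
  refine integral_congr_ae (Filter.Eventually.of_forall fun x => ?_)
  have h := (𝒢.hasSum_condExp_star_mul (star (sigma c t b)) a x).tsum_eq
  rw [star_star] at h
  exact h

theorem integrable_coef_inv {a b : 𝒢.ReducedCStar} (ha : a ∈ weightN (𝒢.weightOf m))
    (hb : star b ∈ weightN (𝒢.weightOf m)) :
    Integrable (fun g => starRingEnd ℂ (𝒢.coef (star a) (𝒢.inv g)) * 𝒢.coef b (𝒢.inv g))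
      (𝒢.fibreMeasure m) := by
  refine (integrable_conj_coef_mul_coef hb ha).congr (Filter.Eventually.of_forall fun g => ?_)
  simp only [coef_star, Complex.conj_conj, 𝒢.inv_inv]
  ring

end

omit [T2Space G] [LocallyCompactSpace G] [MeasurableSpace X] [BorelSpace X] in
theorem cexp_add_I_mul (c : 𝒢.RealHom) (t β : ℝ) (g : G) :
    Complex.exp (Complex.I * (t + Complex.I * β) * c g) =
      (Real.exp (-β * c g) : ℂ) * phase c t g := by
  rw [phase, Complex.ofReal_exp, ← Complex.exp_add]
  congr 1
  push_cast
  linear_combination (β : ℂ) * c g * Complex.I_mul_I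

/-- The weight of a conformal measure is a KMS weight. -/
theorem isKMSWeight_weightOf [SecondCountableTopology G] [IsLocallyFiniteMeasure m]
    {c : 𝒢.RealHom} {β : ℝ} (hm : m ≠ 0) (hconf : IsConformal c β m) :
    IsKMSWeight (𝒢.weightOf m) (sigma c) β := by
  borelize G
  have hinv := (isConformal_iff c β m).1 hconf
  refine ⟨𝒢.isProperWeight_weightOf m hm, 𝒢.isInvariantWeight_weightOf m c,
    𝒢.weightFunctional m, isWeightExtension_weightFunctional, fun a b ha ha' hb hb' => ?_⟩
  -- Integrability on the two edges uses the two halves of the hypothesis: `a*, b ∈ 𝒩` on the real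
  -- line, and `a, b* ∈ 𝒩` after inversion on the line through `iβ`.
  have h1 := integrable_conj_coef_mul_coef ha' hb
  have h2 := integrable_exp_cocycle_smul c hinv (f := fun g =>
    starRingEnd ℂ (𝒢.coef (star a) g) * 𝒢.coef b g) (integrable_coef_inv ha hb')
  have hc := c.continuous_toFun.measurable
  refine ⟨_, continuousOn_stripTransform hc h1 h2, ⟨_, fun z hz => norm_stripTransform_le h1 h2 hz⟩,
    differentiableOn_stripTransform hc h1 h2, fun t => ⟨integral_phase_mul c t ha' hb, ?_⟩⟩
  refine Eq.trans ?_ (integral_phase_mul_inv c t ha hb')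
  rw [← integral_exp_cocycle_smul c hinv (fun g => phase c t g *
    (starRingEnd ℂ (𝒢.coef (star a) g) * 𝒢.coef b g))]
  refine integral_congr_ae (Filter.Eventually.of_forall fun g => ?_)
  simp only [cexp_add_I_mul]
  rw [Complex.real_smul, _root_.mul_assoc]

end MeasureWeight

end EtaleGroupoid

/-! ### KMS weights are finite on compactly supported functions -/

section WeightSums

variable {A : Type*} [NonUnitalCStarAlgebra A] [PartialOrder A] [StarOrderedRing A]
  {ψ : {a : A // 0 ≤ a} → ℝ≥0∞}

theorem IsProperWeight.posExt_sum (hψ : IsProperWeight ψ) {ι : Type*} (s : Finset ι) (a : ι → A)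
    (ha : ∀ i, 0 ≤ a i) : posExt ψ (∑ i ∈ s, a i) = ∑ i ∈ s, posExt ψ (a i) := by
  classical
  induction s using Finset.induction_on with
  | empty => simpa using hψ.posExt_zero
  | insert i s hi ih =>
    rw [Finset.sum_insert hi, Finset.sum_insert hi,
      hψ.posExt_add (ha i) (Finset.sum_nonneg fun j _ => ha j), ih]

end WeightSums

namespace EtaleGroupoid

section KMSWeight

open Filter Topology

variable {G X : Type*} [TopologicalSpace G] [TopologicalSpace X] [T2Space G] [LocallyCompactSpace G]
  {𝒢 : EtaleGroupoid G X} {c : 𝒢.RealHom} {β : ℝ} {ψ : {a : 𝒢.ReducedCStar // 0 ≤ a} → ℝ≥0∞}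

theorem posExt_orbitAvg (hψ : IsProperWeight ψ) (hinv : IsInvariantWeight ψ (sigma c)) (n : ℕ)
    {a : 𝒢.ReducedCStar} (ha : 0 ≤ a) : posExt ψ (orbitAvg c n a) = posExt ψ a := by
  have h0 : ∀ j : ℕ, 0 ≤ sigma c (j / (n + 1)) a := fun j => map_nonneg (sigma c _) ha
  rw [orbitAvg, Complex.coe_smul, hψ.posExt_smul (by positivity) (Finset.sum_nonneg fun j _ => h0 j),
    hψ.posExt_sum _ _ h0]
  simp only [hinv.posExt_apply _ ha, Finset.sum_const, Finset.card_range, nsmul_eq_mul]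
  rw [← _root_.mul_assoc]
  have : ENNReal.ofReal ((n + 1 : ℝ) ^ 2)⁻¹ * (((n + 1) ^ 2 : ℕ) : ℝ≥0∞) = 1 := by
    rw [← ENNReal.ofReal_natCast, ← ENNReal.ofReal_mul (by positivity), ← ENNReal.ofReal_one]
    congr 1
    push_cast
    field_simp
  rw [this, one_mul]

/-- Positive elements fixed by the action can be approximated by fixed elements of finite weight. -/
theorem exists_invariant_posExt_lt (hopen : IsOpen {g | c g = 0}) (hψ : IsProperWeight ψ)
    (hinv : IsInvariantWeight ψ (sigma c)) {e : 𝒢.ReducedCStar} (he : 0 ≤ e)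
    (hfix : ∀ t, sigma c t e = e) {ε : ℝ} (hε : 0 < ε) :
    ∃ u, (∀ t, sigma c t u = u) ∧ posExt ψ u < ∞ ∧ ‖u - e‖ < ε := by
  obtain ⟨⟨a, ha⟩, hafin, hae⟩ := Metric.mem_closure_iff.1 (hψ.denselyDefined ⟨e, he⟩) ε hε
  have hafin' : posExt ψ a < ∞ := by
    rw [posExt_of_nonneg ha]
    exact hafin
  rw [Subtype.dist_eq, dist_comm, dist_eq_norm] at hae
  obtain ⟨u, hu, hufix⟩ := exists_tendsto_orbitAvg c hopen a
  -- Every average of `a` has the weight of `a`, so by lower semicontinuity the limit `u` has no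
  -- larger weight. As `e` is fixed and averaging is contractive, `u` is as close to `e` as `a` is.
  refine ⟨u, hufix, (hψ.posExt_le_of_tendsto hu fun n =>
    (posExt_orbitAvg hψ hinv n ha).le).trans_lt hafin', lt_of_le_of_lt ?_ hae⟩
  refine le_of_tendsto (hu.sub_const e).norm (Eventually.of_forall fun n => ?_)
  have h := norm_orbitAvg_le c n (a - e)
  rwa [orbitAvg_sub, orbitAvg_eq_self c n hfix] at h

/-- The centralizer property applied to `y*` and the fixed element `y`; both weights are finite, so
equality of the complex values suffices. -/
theorem apply_mul_comm_of_fixed {Λ : 𝒢.ReducedCStar →ₗ[ℂ] ℂ} (hΛ : IsWeightFunctional ψ Λ)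
    (hkms : IsKMSFunctional ψ (sigma c) β Λ) {y : 𝒢.ReducedCStar} (hy : y ∈ weightN ψ)
    (hy' : star y ∈ weightN ψ) (hfix : ∀ t, sigma c t y = y) :
    posExt ψ (y * star y) = posExt ψ (star y * y) := by
  have h1 := mem_weightN.1 hy
  have h2 := mem_weightN.1 hy'
  have h := hkms.apply_mul_comm hy' (by rwa [star_star]) hy hy' hfix
  rw [star_star] at h2
  rw [hΛ _ h1, hΛ _ h2] at h
  exact ((ENNReal.toReal_eq_toReal_iff' h1.ne h2.ne).1 (by exact_mod_cast h)).symm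

/-- `C_c(X)` is contained in `𝒩_ψ` for every KMS weight `ψ`. -/
theorem diagElt_mem_weightN (hopen : IsOpen {g | c g = 0}) (hψ : IsKMSWeight ψ (sigma c) β)
    (d : C_c(X, ℝ)) : 𝒢.diagElt d ∈ weightN ψ := by
  have := 𝒢.t2Space_units
  have := 𝒢.locallyCompactSpace_units
  obtain ⟨Λ, hΛ, hkms⟩ := hψ.exists_functional
  have hp := hψ.proper
  -- With `q = 1` on the support of `d`, the element `E = q²` is positive, fixed by the action and a
  -- two-sided unit for `D`. It will be approximated by fixed elements `u n` of finite weight.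
  obtain ⟨q, hq1, -, -⟩ := exists_bump d.hasCompactSupport.isCompact isOpen_univ (Set.subset_univ _)
  set D := 𝒢.diagElt d with hD
  set E := 𝒢.diagElt q * 𝒢.diagElt q with hE
  have hDs : star D = D := 𝒢.star_diagElt d
  have hEs : star E = E := by rw [hE, star_mul, star_diagElt]
  have hDfix : ∀ t, sigma c t D = D := fun t => 𝒢.sigma_diagElt c t d
  have hEfix : ∀ t, sigma c t E = E := fun t => by rw [hE, map_mul, sigma_diagElt]
  have hqd : q * d = d := by
    refine CompactlySupportedContinuousMap.ext fun x => ?_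
    rw [CompactlySupportedContinuousMap.mul_apply]
    by_cases hx : x ∈ tsupport d
    · rw [hq1 x hx, one_mul]
    · rw [image_eq_zero_of_notMem_tsupport hx, mul_zero]
  have hqD : 𝒢.diagElt q * D = D := by rw [hD, ← diagElt_mul, hqd]
  have hED : E * D = D := by rw [hE, _root_.mul_assoc, hqD, hqD]
  have hDE : D * E = D := by
    have := congrArg star hED
    rwa [star_mul, hEs, hDs] at this
  have hE0 : 0 ≤ E := by
    have := star_mul_self_nonneg (𝒢.diagElt q)
    rwa [star_diagElt] at this
  have happ : ∀ n : ℕ, ∃ u, (∀ t, sigma c t u = u) ∧ posExt ψ u < ∞ ∧ ‖u - E‖ < 1 / ((n : ℝ) + 1) :=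
    fun n => exists_invariant_posExt_lt hopen hp hψ.invariant hE0 hEfix (by positivity)
  choose u hufix hufin hun using happ
  have hulim : Tendsto u atTop (𝓝 E) := by
    rw [tendsto_iff_norm_sub_tendsto_zero]
    exact squeeze_zero (fun _ => norm_nonneg _) (fun n => (hun n).le)
      tendsto_one_div_add_atTop_nhds_zero_nat
  have hus : ∀ n, star (u n) = u n := fun n =>
    (IsSelfAdjoint.of_nonneg (nonneg_of_posExt_lt (hufin n))).star_eq
  have huN : ∀ n, u n ∈ weightN ψ := fun n => hp.mem_weightN_of_posExt_lt (hufin n)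
  obtain ⟨k, hk⟩ : ∃ k, ‖u k * u k - E * E‖ ≤ 1 / 2 := by
    have h1 := tendsto_iff_norm_sub_tendsto_zero.1 (hulim.mul hulim)
    exact (h1.eventually (ge_mem_nhds (by norm_num : (0 : ℝ) < 1 / 2))).exists
  -- The left ideal property gives `x ∈ 𝒩_ψ`, that is, finiteness of `ψ(x*x)`. What is needed is
  -- finiteness of `ψ(xx*)`, because `xx* = D u_k² D` is close to `D²`.
  set x := D * u k with hx
  have hxN : x ∈ weightN ψ := hp.mul_mem_weightN _ (huN k)
  have hxs : star x = u k * D := by rw [hx, star_mul, hus, hDs]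
  have hEx : E * x = x := by rw [hx, ← _root_.mul_assoc, hED]
  have hxE : star x * E = star x := by rw [hxs, _root_.mul_assoc, hDE]
  -- The element `y = u_n x` is fixed, and both `y` and `y* = x* u_n` lie in `𝒩_ψ`, so `ψ(yy*) =
  -- ψ(y*y) ≤ ‖u_n‖² ψ(x*x)`. This bound is uniform in `n`, while `yy*` tends to `E x x* E = x x*`;
  -- lower semicontinuity then bounds `ψ(xx*)`.
  have hbound : ∀ n, posExt ψ (u n * x * (star x * u n)) ≤
      ENNReal.ofReal ((‖E‖ + 1) ^ 2) * posExt ψ (star x * x) := by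
    intro n
    have hys : star (u n * x) = star x * u n := by rw [star_mul, hus]
    have hyN : u n * x ∈ weightN ψ := hp.mul_mem_weightN _ hxN
    have hyN' : star (u n * x) ∈ weightN ψ := by
      rw [hys]
      exact hp.mul_mem_weightN _ (huN n)
    have h1 := apply_mul_comm_of_fixed hΛ hkms hyN hyN' fun t => by
      rw [hx, map_mul, map_mul, hufix, hufix, hDfix]
    rw [← hys, h1]
    have h2 : star (u n * x) * (u n * x) ≤ (‖E‖ + 1) ^ 2 • (star x * x) := by
      refine (IsProperWeight.star_mul_self_mul_le _ _).trans ?_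
      refine smul_le_smul_of_nonneg_right ?_ (star_mul_self_nonneg x)
      rw [CStarRing.norm_star_mul_self, ← sq]
      have h3 : ‖u n‖ ≤ ‖E‖ + 1 := by
        have h4 : ‖u n‖ ≤ ‖E‖ + ‖u n - E‖ := by
          have := norm_add_le E (u n - E)
          rwa [add_sub_cancel] at this
        have h5 : 1 / ((n : ℝ) + 1) ≤ 1 := by
          rw [div_le_one (by positivity)]
          linarith [n.cast_nonneg (α := ℝ)]
        linarith [hun n]
      gcongr
    exact (hp.posExt_mono (star_mul_self_nonneg _) h2).trans
      (hp.posExt_smul_le (by positivity) (star_mul_self_nonneg x))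
  have hlim : Tendsto (fun n => u n * x * (star x * u n)) atTop (𝓝 (x * star x)) := by
    have h1 := (hulim.mul_const x).mul (hulim.const_mul (star x))
    rwa [hEx, hxE] at h1
  have hfin : posExt ψ (x * star x) < ∞ :=
    (hp.posExt_le_of_tendsto hlim hbound).trans_lt
      (ENNReal.mul_lt_top ENNReal.ofReal_lt_top (mem_weightN.1 hxN))
  have hxx : x * star x = D * (u k * u k) * D := by rw [hxs, hx]; simp only [_root_.mul_assoc]
  -- Compressing `E² - u_k² ≤ 1/2` by `D` gives `D² - xx* ≤ D²/2`.
  have hle : D * D ≤ (2 : ℝ) • (x * star x) := by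
    have hsa : IsSelfAdjoint (E * E - u k * u k) := by
      rw [IsSelfAdjoint, star_sub, star_mul E E, star_mul (u k) (u k), hEs, hus]
    have h1 := CStarAlgebra.star_left_conjugate_le_norm_smul (a := D) hsa
    rw [norm_sub_rev, hDs, mul_sub, sub_mul, ← _root_.mul_assoc D E E, hDE, _root_.mul_assoc D E, hED,
      ← hxx] at h1
    have hDD : 0 ≤ D * D := by
      have := star_mul_self_nonneg D
      rwa [hDs] at this
    have h2 := h1.trans (smul_le_smul_of_nonneg_right hk hDD)
    rw [sub_le_iff_le_add] at h2
    have h3 : (1 / 2 : ℝ) • (D * D) ≤ x * star x := by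
      have h4 : D * D = (1 / 2 : ℝ) • (D * D) + (1 / 2 : ℝ) • (D * D) := by
        rw [← add_smul]
        norm_num
      rw [h4] at h2
      have := le_of_add_le_add_left (a := (1 / 2 : ℝ) • (D * D)) (b := (1 / 2 : ℝ) • (D * D))
        (c := x * star x) (by rwa [← h4] at h2 ⊢)
      exact this
    have h5 := smul_le_smul_of_nonneg_left h3 (zero_le_two (α := ℝ))
    rwa [smul_smul, show (2 : ℝ) * (1 / 2) = 1 by norm_num, one_smul] at h5
  rw [mem_weightN, hDs]
  refine (hp.posExt_mono ?_ hle).trans_lt (hp.posExt_smul_lt zero_le_two hfin)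
  have := star_mul_self_nonneg D
  rwa [hDs] at this

/-- Compactly supported functions belong to `𝒩_ψ`. -/
theorem ofCc_mem_weightN (hopen : IsOpen {g | c g = 0}) (hψ : IsKMSWeight ψ (sigma c) β)
    (f : C_c(G, ℂ)) : 𝒢.ofCc f ∈ weightN ψ := by
  obtain ⟨p, -, -, hp⟩ := 𝒢.exists_local_unit f
  rw [← hp]
  exact hψ.proper.mul_mem_weightN _ (diagElt_mem_weightN hopen hψ p)

theorem star_ofCc_mem_weightN (hopen : IsOpen {g | c g = 0}) (hψ : IsKMSWeight ψ (sigma c) β)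
    (f : C_c(G, ℂ)) : star (𝒢.ofCc f) ∈ weightN ψ := by
  rw [← ofCc_invol]
  exact ofCc_mem_weightN hopen hψ _

end KMSWeight

/-! ### Localisation by partitions of unity -/

section Induction

variable {G : Type*} [TopologicalSpace G] [T2Space G] [LocallyCompactSpace G]

/-- An additive property of compactly supported functions can be checked on functions with small
support. -/
theorem compactlySupported_induction (P : C_c(G, ℂ) → Prop) (h0 : P 0)
    (hadd : ∀ f h, P f → P h → P (f + h))
    (hloc : ∀ g, ∃ U, IsOpen U ∧ g ∈ U ∧ ∀ f : C_c(G, ℂ), tsupport f ⊆ U → P f)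
    (f : C_c(G, ℂ)) : P f := by
  choose U hU hgU hP using hloc
  have hK : IsCompact (tsupport f) := f.hasCompactSupport
  obtain ⟨t, ht⟩ := hK.elim_finite_subcover U hU fun g _ => Set.mem_iUnion.2 ⟨g, hgU g⟩
  have ht' : tsupport f ⊆ ⋃ i : Fin t.card, U (t.equivFin.symm i) := by
    intro h hh
    obtain ⟨g, hg, hgh⟩ := Set.mem_iUnion₂.1 (ht hh)
    refine Set.mem_iUnion.2 ⟨t.equivFin ⟨g, hg⟩, ?_⟩
    simpa using hgh
  obtain ⟨ρ, hρs, hρ1, -, -⟩ := exists_continuous_sum_one_of_isOpen_isCompact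
    (fun i : Fin t.card => hU (t.equivFin.symm i)) hK ht'
  set F : Fin t.card → C_c(G, ℂ) := fun i =>
    (⟨fun g => (ρ i g : ℂ), by fun_prop⟩ : C(G, ℂ)) • f with hF
  have hsum : f = ∑ i, F i := by
    refine CompactlySupportedContinuousMap.ext fun g => ?_
    rw [CompactlySupportedContinuousMap.sum_apply]
    change f g = ∑ i, (ρ i g : ℂ) * f g
    rw [← Finset.sum_mul]
    by_cases hh : f g = 0
    · simp [hh]
    · have h1 := hρ1 (subset_tsupport f hh)
      simp only [Finset.sum_apply, Pi.one_apply] at h1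
      rw [← Complex.ofReal_sum, h1]
      simp
  rw [hsum]
  refine Finset.sum_induction _ P hadd h0 fun i _ => hP (t.equivFin.symm i) _ ?_
  refine subset_trans (closure_mono fun g hg => ?_) (hρs i)
  intro h
  refine hg ?_
  change (ρ i g : ℂ) * f g = 0
  rw [h, Complex.ofReal_zero, zero_mul]

end Induction

open Filter Topology MeasureTheory

/-! ### The measure of a KMS weight -/

section RieszMeasure

variable {G X : Type*} [TopologicalSpace G] [TopologicalSpace X] [T2Space G] [LocallyCompactSpace G]
  {𝒢 : EtaleGroupoid G X} {c : 𝒢.RealHom} {β : ℝ} {ψ : {a : 𝒢.ReducedCStar // 0 ≤ a} → ℝ≥0∞}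
  {Λ : 𝒢.ReducedCStar →ₗ[ℂ] ℂ}

theorem exists_mul_self_eq {p : C_c(X, ℝ)} (hp : ∀ x, 0 ≤ p x) : ∃ q : C_c(X, ℝ), p = q * q := by
  refine ⟨p.compLeft ⟨Real.sqrt, Real.continuous_sqrt⟩,
    CompactlySupportedContinuousMap.ext fun x => ?_⟩
  rw [CompactlySupportedContinuousMap.mul_apply,
    CompactlySupportedContinuousMap.compLeft_apply (by simp)]
  exact (Real.mul_self_sqrt (hp x)).symm

theorem posExt_diagElt_lt (hopen : IsOpen {g | c g = 0}) (hψ : IsKMSWeight ψ (sigma c) β)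
    {p : C_c(X, ℝ)} (hp : ∀ x, 0 ≤ p x) : posExt ψ (𝒢.diagElt p) < ∞ := by
  obtain ⟨q, rfl⟩ := exists_mul_self_eq hp
  have h := mem_weightN.1 (diagElt_mem_weightN hopen hψ q)
  rwa [star_diagElt, ← diagElt_mul] at h

/-- The restriction of a KMS weight to `C_c(X)` is given by a regular measure. -/
theorem exists_measure [MeasurableSpace X] [BorelSpace X] (hopen : IsOpen {g | c g = 0})
    (hψ : IsKMSWeight ψ (sigma c) β) (hΛ : IsWeightFunctional ψ Λ) :
    ∃ m : Measure X, m.Regular ∧ ∀ p : C_c(X, ℝ), Λ (𝒢.diagElt p) = ((∫ x, p x ∂m : ℝ) : ℂ) := by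
  have := 𝒢.t2Space_units
  have := 𝒢.locallyCompactSpace_units
  let Φ : C_c(X, ℝ) →ₗ[ℝ] ℝ :=
    { toFun := fun p => (Λ (𝒢.diagElt p)).re
      map_add' := fun p q => by rw [diagElt_add, map_add, Complex.add_re]
      map_smul' := fun r p => by
        rw [diagElt_smul, map_smul, smul_eq_mul, Complex.re_ofReal_mul, RingHom.id_apply,
          smul_eq_mul] }
  have hpos : ∀ p : C_c(X, ℝ), 0 ≤ p →
      Λ (𝒢.diagElt p) = ((posExt ψ (𝒢.diagElt p)).toReal : ℂ) := fun p hp =>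
    hΛ _ (posExt_diagElt_lt hopen hψ fun x => hp x)
  -- The weight determines `Λ` only on functions of finite weight such as nonnegative ones, so real
  -- values follow from the splitting into positive and negative parts.
  have him : ∀ p : C_c(X, ℝ), (Λ (𝒢.diagElt p)).im = 0 := fun p => by
    have h1 : p + p⁻ = p⁺ := (sub_eq_iff_eq_add.1 (posPart_sub_negPart p)).symm
    have h2 := congrArg (fun q => (Λ (𝒢.diagElt q)).im) h1
    simp only [diagElt_add, map_add, Complex.add_im] at h2
    rwa [hpos _ (negPart_nonneg p), hpos _ (posPart_nonneg p), Complex.ofReal_im,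
      Complex.ofReal_im, add_zero] at h2
  let Φ' : C_c(X, ℝ) →ₚ[ℝ] ℝ := PositiveLinearMap.mk₀ Φ fun p hp => by
    change 0 ≤ (Λ (𝒢.diagElt p)).re
    rw [hpos p hp, Complex.ofReal_re]
    exact ENNReal.toReal_nonneg
  refine ⟨RealRMK.rieszMeasure Φ', inferInstance, fun p => ?_⟩
  rw [RealRMK.integral_rieszMeasure]
  exact Complex.ext rfl ((him p).trans (Complex.ofReal_im _).symm)

end RieszMeasure

/-! ### KMS weights factor through the conditional expectation -/

section Disintegration

variable {G X : Type*} [TopologicalSpace G] [TopologicalSpace X] [T2Space G] [LocallyCompactSpace G]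
  {𝒢 : EtaleGroupoid G X} {c : 𝒢.RealHom} {β : ℝ} {ψ : {a : 𝒢.ReducedCStar // 0 ≤ a} → ℝ≥0∞}
  {Λ : 𝒢.ReducedCStar →ₗ[ℂ] ℂ}

/-- Take a bump function `p` that is `1` on the ranges and `0` on the sources of the support of `f`.
Then `pf = f` and `fp = 0`, while `p` lies in the centralizer, so `Λ(f) = Λ(pf) = Λ(fp) = 0`. -/
theorem apply_ofCc_eq_zero_of_disjoint (hopen : IsOpen {g | c g = 0})
    (hψ : IsKMSWeight ψ (sigma c) β) (hkms : IsKMSFunctional ψ (sigma c) β Λ) {V V' : Set X}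
    (hV : IsOpen V) (hd : Disjoint V V') {f : C_c(G, ℂ)}
    (hf : tsupport f ⊆ 𝒢.r ⁻¹' V ∩ 𝒢.s ⁻¹' V') : Λ (𝒢.ofCc f) = 0 := by
  have := 𝒢.t2Space_units
  have := 𝒢.locallyCompactSpace_units
  obtain ⟨p, hp1, hpV, -⟩ := exists_bump (f.hasCompactSupport.isCompact.image 𝒢.continuous_r) hV
    (Set.image_subset_iff.2 fun g hg => (hf hg).1)
  have h1 : 𝒢.diagElt p * 𝒢.ofCc f = 𝒢.ofCc f := 𝒢.diagElt_mul_ofCc fun g => by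
    by_cases hg : f g = 0
    · rw [hg, mul_zero]
    · rw [hp1 _ ⟨g, subset_tsupport f hg, rfl⟩, Complex.ofReal_one, one_mul]
  have h2 : 𝒢.ofCc f * 𝒢.diagElt p = 𝒢.ofCc 0 := 𝒢.ofCc_mul_diagElt fun g => by
    by_cases hg : f g = 0
    · rw [hg, zero_mul]
      rfl
    · have : p (𝒢.s g) = 0 := image_eq_zero_of_notMem_tsupport fun h =>
        hd.le_bot ⟨hpV h, (hf (subset_tsupport f hg)).2⟩
      rw [this, Complex.ofReal_zero, mul_zero]
      rfl
  have h3 := hkms.apply_mul_comm (ofCc_mem_weightN hopen hψ f) (star_ofCc_mem_weightN hopen hψ f)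
    (diagElt_mem_weightN hopen hψ p) (by rw [star_diagElt]; exact diagElt_mem_weightN hopen hψ p)
    fun t => 𝒢.sigma_diagElt c t p
  rw [h1, h2] at h3
  rw [← h3]
  exact (congrArg Λ (map_zero 𝒢.ofCcLin)).trans (map_zero Λ)

theorem orbitAvg_diagElt_mul (n : ℕ) (p : C_c(X, ℝ)) (a : 𝒢.ReducedCStar) :
    orbitAvg c n (𝒢.diagElt p * a * 𝒢.diagElt p) =
      𝒢.diagElt p * orbitAvg c n a * 𝒢.diagElt p := by
  simp only [orbitAvg, map_mul, sigma_diagElt, mul_smul_comm, smul_mul_assoc, Finset.mul_sum,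
    Finset.sum_mul]

theorem apply_orbitAvg (hp : IsProperWeight ψ) (hinv : IsInvariantWeight ψ (sigma c))
    (hΛ : IsWeightFunctional ψ Λ) (n : ℕ) {a b : 𝒢.ReducedCStar} (ha : a ∈ weightN ψ)
    (hb : b ∈ weightN ψ) : Λ (orbitAvg c n (star a * b)) = Λ (star a * b) := by
  rw [orbitAvg, map_smul, map_sum]
  simp only [hΛ.apply_star_mul_invariant hp hinv _ ha hb, Finset.sum_const, Finset.card_range,
    nsmul_eq_mul, smul_eq_mul]
  rw [← _root_.mul_assoc]
  have : ((((n + 1 : ℝ) ^ 2)⁻¹ : ℝ) : ℂ) * (((n + 1) ^ 2 : ℕ) : ℂ) = 1 := by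
    push_cast
    have : ((n : ℂ) + 1) ≠ 0 := by exact_mod_cast n.succ_ne_zero
    field_simp
  rw [this, one_mul]

/-- By invariance `Λ` takes the same value on `f` and on its averages, which tend to `0`. As `Λ`
need not be continuous, a local unit `p` is used: all the averages lie in `p A p`, where
`exists_norm_apply_le` provides a norm bound. -/
theorem apply_ofCc_eq_zero_of_ne (hopen : IsOpen {g | c g = 0})
    (hψ : IsKMSWeight ψ (sigma c) β) (hΛ : IsWeightFunctional ψ Λ) {f : C_c(G, ℂ)}
    (hf : tsupport f ⊆ {g | c g ≠ 0}) : Λ (𝒢.ofCc f) = 0 := by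
  obtain ⟨p, -, h1, h2⟩ := 𝒢.exists_local_unit f
  have hpN := diagElt_mem_weightN hopen hψ p
  have hpN' : star (𝒢.diagElt p) ∈ weightN ψ := by rwa [star_diagElt]
  obtain ⟨C, hC⟩ := hΛ.exists_norm_apply_le hψ.proper hpN' hpN
  have h3 : ∀ n, ‖Λ (𝒢.ofCc f)‖ ≤ C * ‖orbitAvg c n (𝒢.ofCc f)‖ := fun n => by
    have h4 := apply_orbitAvg hψ.proper hψ.invariant hΛ n hpN (ofCc_mem_weightN hopen hψ f)
    rw [star_diagElt, h1] at h4
    have h5 := hC (orbitAvg c n (𝒢.ofCc f))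
    rwa [← orbitAvg_diagElt_mul, h1, h2, h4] at h5
  have h4 := ((tendsto_orbitAvg_zero c hf).norm.const_mul C)
  rw [norm_zero, mul_zero] at h4
  exact norm_le_zero_iff.1 (ge_of_tendsto' h4 h3)

omit [LocallyCompactSpace G] in
theorem exists_eq_diag_add {f : C_c(G, ℂ)} (hf : tsupport f ⊆ Set.range 𝒢.unit) :
    ∃ p q : C_c(X, ℝ), f = 𝒢.diag p + Complex.I • 𝒢.diag q := by
  have hK : HasCompactSupport fun x => f (𝒢.unit x) :=
    f.hasCompactSupport.comp_isClosedEmbedding 𝒢.isClosedEmbedding_unit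
  have hc : Continuous fun x => f (𝒢.unit x) := f.continuous.comp 𝒢.continuous_unit
  refine ⟨⟨⟨fun x => (f (𝒢.unit x)).re, Complex.continuous_re.comp hc⟩, hK.comp_left (g := Complex.re) rfl⟩,
    ⟨⟨fun x => (f (𝒢.unit x)).im, Complex.continuous_im.comp hc⟩, hK.comp_left (g := Complex.im) rfl⟩,
    CompactlySupportedContinuousMap.ext fun g => ?_⟩
  rw [CompactlySupportedContinuousMap.add_apply, CompactlySupportedContinuousMap.smul_apply]
  by_cases hg : g ∈ Set.range 𝒢.unit
  · obtain ⟨x, rfl⟩ := hg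
    rw [diag_unit, diag_unit, smul_eq_mul, mul_comm]
    exact (Complex.re_add_im _).symm
  · rw [diag_of_notMem _ _ hg, diag_of_notMem _ _ hg, smul_zero, add_zero,
      image_eq_zero_of_notMem_tsupport fun h => hg (hf h)]

omit [LocallyCompactSpace G] in
theorem integrable_unit [MeasurableSpace X] [BorelSpace X] (m : Measure X)
    [IsFiniteMeasureOnCompacts m] (f : C_c(G, ℂ)) : Integrable (fun x => f (𝒢.unit x)) m := by
  exact (f.continuous.comp 𝒢.continuous_unit).integrable_of_hasCompactSupport
    (f.hasCompactSupport.comp_isClosedEmbedding 𝒢.isClosedEmbedding_unit)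

/-- A KMS weight is given on `C_c(G)` by its restriction to `C_c(X)`. -/
theorem apply_ofCc_eq_integral [MeasurableSpace X] [BorelSpace X] {m : Measure X}
    [IsFiniteMeasureOnCompacts m]
    (htriv : ∀ x : X, {g : G | c g = 0} ∩ {g : G | 𝒢.r g = x ∧ 𝒢.s g = x} = {𝒢.unit x})
    (hopen : IsOpen {g | c g = 0}) (hψ : IsKMSWeight ψ (sigma c) β)
    (hΛ : IsWeightFunctional ψ Λ) (hkms : IsKMSFunctional ψ (sigma c) β Λ)
    (hm : ∀ p : C_c(X, ℝ), Λ (𝒢.diagElt p) = ((∫ x, p x ∂m : ℝ) : ℂ)) (f : C_c(G, ℂ)) :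
    Λ (𝒢.ofCc f) = ∫ x, f (𝒢.unit x) ∂m := by
  have := 𝒢.t2Space_units
  refine compactlySupported_induction (fun f => Λ (𝒢.ofCc f) = ∫ x, f (𝒢.unit x) ∂m)
    ?_ (fun f h hf hh => ?_) (fun g => ?_) f
  · simp only [CompactlySupportedContinuousMap.zero_apply, integral_zero]
    exact (congrArg Λ (map_zero 𝒢.ofCcLin)).trans (map_zero Λ)
  · simp only [CompactlySupportedContinuousMap.add_apply]
    rw [integral_add (integrable_unit m f) (integrable_unit m h), ofCc_add, map_add, hf, hh]
  -- Each arrow has `r g ≠ s g`, or `c g ≠ 0`, or is isotropy in `ker c` and so a unit. In the first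
  -- two cases both sides vanish for functions supported near `g`.
  · by_cases hrs : 𝒢.r g = 𝒢.s g
    · by_cases hc : c g = 0
      · have hg : g ∈ Set.range 𝒢.unit := by
          have : g ∈ ({𝒢.unit (𝒢.r g)} : Set G) := by
            rw [← htriv]
            exact ⟨hc, rfl, hrs.symm⟩
          exact ⟨𝒢.r g, this.symm⟩
        refine ⟨Set.range 𝒢.unit, 𝒢.isOpen_range_unit, hg, fun f hf => ?_⟩
        obtain ⟨p, q, rfl⟩ := exists_eq_diag_add hf
        rw [ofCc_add, ofCc_smul, map_add, map_smul]
        change Λ (𝒢.diagElt p) + Complex.I • Λ (𝒢.diagElt q) = _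
        rw [hm, hm]
        have := integral_add (integrable_unit (𝒢 := 𝒢) m (𝒢.diag p))
          ((integrable_unit (𝒢 := 𝒢) m (𝒢.diag q)).smul Complex.I)
        simp only [CompactlySupportedContinuousMap.add_apply,
          CompactlySupportedContinuousMap.smul_apply, Pi.smul_apply] at this ⊢
        rw [this, integral_smul]
        simp only [diag_unit, integral_complex_ofReal]
      · refine ⟨{g | c g ≠ 0}, isOpen_ne.preimage c.continuous_toFun, hc, fun f hf => ?_⟩
        rw [apply_ofCc_eq_zero_of_ne hopen hψ hΛ hf]
        refine (integral_eq_zero_of_ae (Eventually.of_forall fun x => ?_)).symm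
        exact image_eq_zero_of_notMem_tsupport fun h => hf h (c.map_unit x)
    · obtain ⟨V, V', hV, hV', hgV, hgV', hd⟩ := t2_separation hrs
      refine ⟨𝒢.r ⁻¹' V ∩ 𝒢.s ⁻¹' V', (hV.preimage 𝒢.continuous_r).inter
        (hV'.preimage 𝒢.continuous_s), ⟨hgV, hgV'⟩, fun f hf => ?_⟩
      rw [apply_ofCc_eq_zero_of_disjoint hopen hψ hkms hV hd hf]
      refine (integral_eq_zero_of_ae (Eventually.of_forall fun x => ?_)).symm
      refine image_eq_zero_of_notMem_tsupport fun h => ?_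
      obtain ⟨h1, h2⟩ := hf h
      rw [Set.mem_preimage, 𝒢.r_unit] at h1
      rw [Set.mem_preimage, 𝒢.s_unit] at h2
      exact Set.disjoint_left.1 hd h1 h2

theorem integrable_mul_mul_condExp [MeasurableSpace X] [BorelSpace X] (m : Measure X)
    [IsFiniteMeasureOnCompacts m] (q p : C_c(X, ℝ)) (a : 𝒢.ReducedCStar) :
    Integrable (fun x => (q x : ℂ) * p x * 𝒢.condExp a x) m := by
  have := q.toContinuousMap.continuous
  have := p.continuous
  have := 𝒢.continuous_condExp a
  have hs : HasCompactSupport fun x => (q x : ℂ) := q.hasCompactSupport.comp_left (g := Complex.ofReal) rfl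
  exact Continuous.integrable_of_hasCompactSupport (by fun_prop) (hs.mul_right.mul_right)

/-- Both sides are norm continuous in `a` because of the compactly supported factors `q` and `p`, so
the identity extends from `C_c(G)` by density. -/
theorem apply_mul_mul_eq_integral [MeasurableSpace X] [BorelSpace X] {m : Measure X}
    [IsFiniteMeasureOnCompacts m]
    (htriv : ∀ x : X, {g : G | c g = 0} ∩ {g : G | 𝒢.r g = x ∧ 𝒢.s g = x} = {𝒢.unit x})
    (hopen : IsOpen {g | c g = 0}) (hψ : IsKMSWeight ψ (sigma c) β)
    (hΛ : IsWeightFunctional ψ Λ) (hkms : IsKMSFunctional ψ (sigma c) β Λ)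
    (hm : ∀ p : C_c(X, ℝ), Λ (𝒢.diagElt p) = ((∫ x, p x ∂m : ℝ) : ℂ)) (q p : C_c(X, ℝ))
    (a : 𝒢.ReducedCStar) :
    Λ (𝒢.diagElt q * a * 𝒢.diagElt p) = ∫ x, (q x : ℂ) * p x * 𝒢.condExp a x ∂m := by
  have hcc : ∀ f, Λ (𝒢.diagElt q * 𝒢.ofCc f * 𝒢.diagElt p) =
      ∫ x, (q x : ℂ) * p x * 𝒢.condExp (𝒢.ofCc f) x ∂m := fun f => by
    have h1 : 𝒢.diagElt q * 𝒢.ofCc f * 𝒢.diagElt p =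
      𝒢.ofCc (𝒢.conv (𝒢.conv (𝒢.diag q) f) (𝒢.diag p)) := by
      rw [ofCc_conv, ofCc_conv]
      rfl
    rw [h1, apply_ofCc_eq_integral htriv hopen hψ hΛ hkms hm]
    refine integral_congr_ae (Eventually.of_forall fun x => ?_)
    beta_reduce
    rw [← condExp_diagElt_mul_mul, h1, condExp_ofCc]
  obtain ⟨C, hC⟩ := hΛ.exists_norm_apply_le hψ.proper (a := 𝒢.diagElt q) (b := 𝒢.diagElt p)
    (by rw [star_diagElt]; exact diagElt_mem_weightN hopen hψ q) (diagElt_mem_weightN hopen hψ p)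
  set D : ℝ := ∫ x, ‖(q x : ℂ) * p x‖ ∂m with hD
  have hint : Integrable (fun x => (q x : ℂ) * p x) m := by
    have := q.toContinuousMap.continuous
    have := p.continuous
    have hs : HasCompactSupport fun x => (q x : ℂ) :=
      q.hasCompactSupport.comp_left (g := Complex.ofReal) rfl
    exact Continuous.integrable_of_hasCompactSupport (by fun_prop) hs.mul_right
  have hbound : ∀ b : 𝒢.ReducedCStar, ‖∫ x, (q x : ℂ) * p x * 𝒢.condExp b x ∂m‖ ≤ D * ‖b‖ := by
    intro b
    rw [hD, ← integral_mul_const]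
    refine norm_integral_le_of_norm_le (hint.norm.mul_const _) (Eventually.of_forall fun x => ?_)
    rw [norm_mul]
    gcongr
    exact 𝒢.norm_condExp_apply_le b x
  refine eq_of_forall_dist_le fun ε hε => ?_
  obtain ⟨_, ⟨f, rfl⟩, hf⟩ := Metric.mem_closure_iff.1 (𝒢.denseRange_ofCc a)
    (ε / (|C| + |D| + 1)) (by positivity)
  rw [dist_eq_norm] at hf
  have hsub : Λ (𝒢.diagElt q * a * 𝒢.diagElt p) - ∫ x, (q x : ℂ) * p x * 𝒢.condExp a x ∂m =
      Λ (𝒢.diagElt q * (a - 𝒢.ofCc f) * 𝒢.diagElt p) -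
        ∫ x, (q x : ℂ) * p x * 𝒢.condExp (a - 𝒢.ofCc f) x ∂m := by
    simp only [condExp_sub, mul_sub, sub_mul, map_sub]
    rw [integral_sub (integrable_mul_mul_condExp m q p a) (integrable_mul_mul_condExp m q p _), hcc]
    ring
  rw [dist_eq_norm, hsub]
  refine (norm_sub_le _ _).trans ((add_le_add (hC _) (hbound _)).trans ?_)
  rw [← add_mul]
  calc (C + D) * ‖a - 𝒢.ofCc f‖ ≤ (|C| + |D| + 1) * (ε / (|C| + |D| + 1)) := by
        refine mul_le_mul ?_ hf.le (norm_nonneg _) (by positivity)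
        linarith [le_abs_self C, le_abs_self D]
    _ = ε := by field_simp

end Disintegration

/-! ### Equality of the weight with the one given by its measure -/

section Identification

variable {G X : Type*} [TopologicalSpace G] [TopologicalSpace X] [T2Space G] [LocallyCompactSpace G]
  {𝒢 : EtaleGroupoid G X} {c : 𝒢.RealHom} {β : ℝ} {ψ : {a : 𝒢.ReducedCStar // 0 ≤ a} → ℝ≥0∞}
  {Λ : 𝒢.ReducedCStar →ₗ[ℂ] ℂ} [MeasurableSpace X] [BorelSpace X] {m : Measure X}
  [IsFiniteMeasureOnCompacts m]

/-- Writing `a = b*b`, the element `bp` lies in `𝒩_ψ`, so `p a p` has finite weight whatever the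
weight of `a`, and its value can be read off from `Λ`. -/
theorem posExt_conj_eq (hopen : IsOpen {g | c g = 0}) (hψ : IsKMSWeight ψ (sigma c) β)
    (hΛ : IsWeightFunctional ψ Λ)
    (hd : ∀ q p a, Λ (𝒢.diagElt q * a * 𝒢.diagElt p) = ∫ x, (q x : ℂ) * p x * 𝒢.condExp a x ∂m)
    (p : C_c(X, ℝ)) {a : 𝒢.ReducedCStar} (ha : 0 ≤ a) :
    posExt ψ (𝒢.diagElt p * a * 𝒢.diagElt p) < ∞ ∧ posExt ψ (𝒢.diagElt p * a * 𝒢.diagElt p) =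
      posExt (𝒢.weightOf m) (𝒢.diagElt p * a * 𝒢.diagElt p) := by
  have hfin : posExt ψ (𝒢.diagElt p * a * 𝒢.diagElt p) < ∞ := by
    obtain ⟨b, rfl⟩ := CStarAlgebra.nonneg_iff_eq_star_mul_self.1 ha
    have h := mem_weightN.1 (hψ.proper.mul_mem_weightN b (diagElt_mem_weightN hopen hψ p))
    rw [star_mul, star_diagElt] at h
    simpa only [_root_.mul_assoc] using h
  refine ⟨hfin, ?_⟩
  have h1 := hΛ _ hfin
  have h2 : ∀ x, (p x : ℂ) * p x * 𝒢.condExp a x =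
      ((𝒢.condExp (𝒢.diagElt p * a * 𝒢.diagElt p) x).re : ℂ) := fun x => by
    rw [← condExp_diagElt_mul_mul]
    exact (𝒢.condExp_nonneg (𝒢.diagElt_conj_nonneg p ha) x).2
  have h3 := integrable_mul_mul_condExp m p p a
  rw [hd] at h1
  simp only [h2] at h1 h3
  rw [integral_complex_ofReal] at h1
  rw [posExt_weightOf _ _ (𝒢.diagElt_conj_nonneg p ha), ← ofReal_integral_eq_lintegral_ofReal
    (by simpa using h3.re) (Eventually.of_forall fun x =>
      (𝒢.condExp_nonneg (𝒢.diagElt_conj_nonneg p ha) x).1), Complex.ofReal_injective h1,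
    ENNReal.ofReal_toReal hfin.ne]

omit [BorelSpace X] [IsFiniteMeasureOnCompacts m] in
theorem posExt_weightOf_conj_le {p : C_c(X, ℝ)} (hp : ∀ x, 0 ≤ p x ∧ p x ≤ 1)
    {a : 𝒢.ReducedCStar} (ha : 0 ≤ a) : posExt (𝒢.weightOf m) (𝒢.diagElt p * a * 𝒢.diagElt p) ≤
      posExt (𝒢.weightOf m) a := by
  rw [posExt_weightOf _ _ (𝒢.diagElt_conj_nonneg p ha), posExt_weightOf _ _ ha]
  refine lintegral_mono fun x => ENNReal.ofReal_le_ofReal ?_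
  rw [condExp_diagElt_conj_re]
  exact mul_le_of_le_one_left (𝒢.condExp_nonneg ha x).1 (pow_le_one₀ (hp x).1 (hp x).2)

/-- Compression by a function `0 ≤ p ≤ 1` in `C_c(X)` decreases a KMS weight. -/
theorem posExt_conj_le (hopen : IsOpen {g | c g = 0}) (hψ : IsKMSWeight ψ (sigma c) β)
    (hΛ : IsWeightFunctional ψ Λ) (hkms : IsKMSFunctional ψ (sigma c) β Λ)
    (hd : ∀ q p a, Λ (𝒢.diagElt q * a * 𝒢.diagElt p) = ∫ x, (q x : ℂ) * p x * 𝒢.condExp a x ∂m)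
    {p : C_c(X, ℝ)} (hp : ∀ x, 0 ≤ p x ∧ p x ≤ 1) {a : 𝒢.ReducedCStar} (ha : 0 ≤ a) :
    posExt ψ (𝒢.diagElt p * a * 𝒢.diagElt p) ≤ posExt ψ a := by
  have := 𝒢.t2Space_units
  have := 𝒢.locallyCompactSpace_units
  rcases eq_or_ne (posExt ψ a) ∞ with hinf | hfin
  · rw [hinf]
    exact le_top
  have hfin : posExt ψ a < ∞ := hfin.lt_top
  obtain ⟨b, hb⟩ := CStarAlgebra.nonneg_iff_eq_star_mul_self.1 ha
  have hbN : b ∈ weightN ψ := by rwa [mem_weightN, ← hb]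
  obtain ⟨q, hq1, -, -⟩ := exists_bump p.hasCompactSupport.isCompact isOpen_univ (Set.subset_univ _)
  have hqp' : ∀ x, q x * p x = p x := fun x => by
    by_cases hx : x ∈ tsupport p
    · rw [hq1 x hx, one_mul]
    · rw [image_eq_zero_of_notMem_tsupport hx, mul_zero]
  have hqp : 𝒢.diagElt q * 𝒢.diagElt p = 𝒢.diagElt p := by
    rw [← diagElt_mul]
    congr 1
    exact CompactlySupportedContinuousMap.ext hqp'
  have hpq : 𝒢.diagElt p * 𝒢.diagElt q = 𝒢.diagElt p := by
    have := congrArg star hqp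
    rwa [star_mul, star_diagElt, star_diagElt] at this
  have hN : ∀ p : C_c(X, ℝ), 𝒢.diagElt p ∈ weightN ψ := diagElt_mem_weightN hopen hψ
  have hN' : ∀ p : C_c(X, ℝ), star (𝒢.diagElt p) ∈ weightN ψ := fun p => by
    rw [star_diagElt]
    exact hN p
  have haN : a ∈ weightN ψ := hψ.proper.mem_weightN_of_posExt_lt hfin
  have has : star a = a := (IsSelfAdjoint.of_nonneg ha).star_eq
  -- The integral formula needs factors from `C_c(X)` on both sides. The missing one comes from `p =
  -- pq` by moving the centralizer element `q` around.
  have h1 : Λ (a * 𝒢.diagElt p) = Λ (𝒢.diagElt q * a * 𝒢.diagElt p) := by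
    have h := hkms.apply_mul_comm (a := a * 𝒢.diagElt p) (b := 𝒢.diagElt q)
      (hψ.proper.mul_mem_weightN _ (hN p))
      (by rw [star_mul, has]; exact hψ.proper.mul_mem_weightN _ haN) (hN q) (hN' q)
      fun t => 𝒢.sigma_diagElt c t q
    rwa [_root_.mul_assoc, hpq, ← _root_.mul_assoc] at h
  have h2 : Λ (𝒢.diagElt p * a) = Λ (𝒢.diagElt p * a * 𝒢.diagElt q) := by
    have h := hkms.apply_mul_comm (a := 𝒢.diagElt p * a) (b := 𝒢.diagElt q)
      (hψ.proper.mul_mem_weightN _ haN)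
      (by rw [star_mul, has]; exact hψ.proper.mul_mem_weightN _ (hN' p)) (hN q) (hN' q)
      fun t => 𝒢.sigma_diagElt c t q
    rw [h, ← _root_.mul_assoc, hqp]
  obtain ⟨hcfin, -⟩ := posExt_conj_eq hopen hψ hΛ hd p ha
  -- Expanding `0 ≤ ψ(w*w)` for `w = b - bp` gives `ψ(a) ≥ 2∫ p P(a) dm - ψ(pap)`. Moreover `ψ(pap)
  -- = ∫ p² P(a) dm ≤ ∫ p P(a) dm`, so `ψ(a) ≥ ψ(pap)`.
  have hwN : b - b * 𝒢.diagElt p ∈ weightN ψ :=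
    hψ.proper.sub_mem_weightN hbN (hψ.proper.mul_mem_weightN _ (hN p))
  have hw : star (b - b * 𝒢.diagElt p) * (b - b * 𝒢.diagElt p) =
      a - 𝒢.diagElt p * a - (a * 𝒢.diagElt p - 𝒢.diagElt p * a * 𝒢.diagElt p) := by
    rw [star_sub, star_mul, star_diagElt, hb]
    simp only [mul_sub, sub_mul, _root_.mul_assoc]
  have h3 := hΛ _ (mem_weightN.1 hwN)
  rw [hw, map_sub, map_sub, map_sub, h1, h2, hd, hd, hΛ _ hfin] at h3
  have hre : ∀ x, (p x : ℂ) * 𝒢.condExp a x = ((p x * (𝒢.condExp a x).re : ℝ) : ℂ) := fun x => by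
    rw [Complex.ofReal_mul, ← (𝒢.condExp_nonneg ha x).2]
  have hqpC : ∀ x, (q x : ℂ) * p x = p x := fun x => by rw [← Complex.ofReal_mul, hqp']
  have hpqC : ∀ x, (p x : ℂ) * q x = p x := fun x => by rw [mul_comm, hqpC]
  have hi1 := integrable_mul_mul_condExp m q p a
  have hi2 := integrable_mul_mul_condExp m p p a
  have hre2 : ∀ x, (p x : ℂ) * p x * 𝒢.condExp a x = ((p x * p x * (𝒢.condExp a x).re : ℝ) : ℂ) :=
    fun x => by rw [Complex.ofReal_mul, ← (𝒢.condExp_nonneg ha x).2, Complex.ofReal_mul]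
  have h4 := hd p p a
  rw [hΛ _ hcfin] at h4
  rw [hΛ _ hcfin] at h3
  simp only [hqpC, hpqC, hre, hre2] at h3 h4 hi1 hi2
  rw [integral_complex_ofReal] at h3 h4
  have h5 : (posExt ψ (𝒢.diagElt p * a * 𝒢.diagElt p)).toReal ≤ ∫ x, p x * (𝒢.condExp a x).re ∂m := by
    rw [Complex.ofReal_injective h4]
    refine integral_mono (by simpa using hi2.re) (by simpa using hi1.re) fun x => ?_
    exact mul_le_mul_of_nonneg_right (mul_le_of_le_one_left (hp x).1 (hp x).2) (𝒢.condExp_nonneg ha x).1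
  have h6 : (posExt ψ a).toReal - ∫ x, p x * (𝒢.condExp a x).re ∂m -
      (∫ x, p x * (𝒢.condExp a x).re ∂m - (posExt ψ (𝒢.diagElt p * a * 𝒢.diagElt p)).toReal) =
      _ := Complex.ofReal_injective (by push_cast; exact h3)
  have h7 : 0 ≤ (posExt ψ (star (b - b * 𝒢.diagElt p) * (b - b * 𝒢.diagElt p))).toReal :=
    ENNReal.toReal_nonneg
  rw [hw] at h7
  rw [← ENNReal.toReal_le_toReal hcfin.ne hfin.ne]
  linarith

/-- Compressions of `a` by approximate units tend to `a`, have the same value under both weights,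
and exceed neither value at `a`; lower semicontinuity of each weight gives one inequality. The bound
of `ψ` by `φ_m` comes first, since it yields `m ≠ 0`, on which properness of `φ_m` depends. -/
theorem eq_weightOf [SecondCountableTopology G] (hopen : IsOpen {g | c g = 0})
    (hψ : IsKMSWeight ψ (sigma c) β)
    (hΛ : IsWeightFunctional ψ Λ) (hkms : IsKMSFunctional ψ (sigma c) β Λ)
    (hd : ∀ q p a, Λ (𝒢.diagElt q * a * 𝒢.diagElt p) = ∫ x, (q x : ℂ) * p x * 𝒢.condExp a x ∂m) :
    m ≠ 0 ∧ ψ = 𝒢.weightOf m := by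
  have happ : ∀ a : 𝒢.ReducedCStar, ∃ p : ℕ → C_c(X, ℝ), (∀ n x, 0 ≤ p n x ∧ p n x ≤ 1) ∧
      Tendsto (fun n => 𝒢.diagElt (p n) * a * 𝒢.diagElt (p n)) atTop (𝓝 a) := fun a => by
    choose p hp hpa using fun n : ℕ =>
      𝒢.exists_approx_unit a (ε := 1 / ((n : ℝ) + 1)) (by positivity)
    refine ⟨p, hp, tendsto_iff_norm_sub_tendsto_zero.2 ?_⟩
    exact squeeze_zero (fun _ => norm_nonneg _) (fun n => (hpa n).le)
      tendsto_one_div_add_atTop_nhds_zero_nat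
  have hle : ∀ a : 𝒢.ReducedCStar, 0 ≤ a → posExt ψ a ≤ posExt (𝒢.weightOf m) a := fun a ha => by
    obtain ⟨p, hp, hpa⟩ := happ a
    refine hψ.proper.posExt_le_of_tendsto hpa fun n => ?_
    rw [(posExt_conj_eq hopen hψ hΛ hd (p n) ha).2]
    exact posExt_weightOf_conj_le (hp n) ha
  have hm : m ≠ 0 := by
    rintro rfl
    obtain ⟨⟨a, ha⟩, hne⟩ := hψ.proper.nonzero
    refine hne (le_antisymm ?_ bot_le)
    have h := hle a ha
    rwa [posExt_of_nonneg ha, posExt_weightOf _ _ ha, lintegral_zero_measure] at h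
  refine ⟨hm, funext fun ⟨a, ha⟩ => ?_⟩
  rw [← posExt_of_nonneg (ψ := ψ) ha, ← posExt_of_nonneg (ψ := 𝒢.weightOf m) ha]
  refine le_antisymm (hle a ha) ?_
  obtain ⟨p, hp, hpa⟩ := happ a
  refine (𝒢.isProperWeight_weightOf m hm).posExt_le_of_tendsto hpa fun n => ?_
  rw [← (posExt_conj_eq hopen hψ hΛ hd (p n) ha).2]
  exact posExt_conj_le hopen hψ hΛ hkms hd (hp n) ha

end Identification

open Filter Topology MeasureTheory

/-! ### Conformality of the measure and injectivity -/

section Conformality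

variable {G X : Type*} [TopologicalSpace G] [TopologicalSpace X] [T2Space G] [LocallyCompactSpace G]
  [SecondCountableTopology G] [MeasurableSpace X] [BorelSpace X] {𝒢 : EtaleGroupoid G X}
  {c : 𝒢.RealHom} {β : ℝ} {m : Measure X} [IsLocallyFiniteMeasure m]
  {Λ : 𝒢.ReducedCStar →ₗ[ℂ] ℂ}

theorem integrable_conj_mul_exp [MeasurableSpace G] [BorelSpace G] (c : 𝒢.RealHom) (β : ℝ)
    (k : C_c(G, ℂ)) : Integrable (fun g => starRingEnd ℂ (k g) * k g) (𝒢.fibreMeasure m) ∧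
      Integrable (fun g => Real.exp (-β * c g) • (starRingEnd ℂ (k g) * k g))
        (𝒢.fibreMeasure m) := by
  have hcont : Continuous fun g => starRingEnd ℂ (k g) * k g :=
    (Complex.continuous_conj.comp k.continuous).mul k.continuous
  have hsupp : HasCompactSupport fun g => starRingEnd ℂ (k g) * k g :=
    HasCompactSupport.mul_left k.hasCompactSupport
  refine ⟨hcont.integrable_of_hasCompactSupport hsupp, ?_⟩
  have hexp : Continuous fun g => Real.exp (-β * c g) := by
    have := c.continuous_toFun
    fun_prop
  exact (hexp.smul hcont).integrable_of_hasCompactSupport hsupp.smul_left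

/-- For the pair `k*`, `k` the KMS function and the strip transform of `|k|²` agree on the real
line, hence at `iβ` by uniqueness. There the one is the integral over inverses and the other carries
the density `e^{-βc}`. -/
theorem integral_norm_sq_inv [MeasurableSpace G] [BorelSpace G] (hopen : IsOpen {g | c g = 0})
    (hψ : IsKMSWeight (𝒢.weightOf m) (sigma c) β)
    (hkms : IsKMSFunctional (𝒢.weightOf m) (sigma c) β Λ)
    (hcc : ∀ f, Λ (𝒢.ofCc f) = ∫ x, f (𝒢.unit x) ∂m) (k : C_c(G, ℂ)) :
    ∫ g, starRingEnd ℂ (k (𝒢.inv g)) * k (𝒢.inv g) ∂(𝒢.fibreMeasure m) =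
      ∫ g, Real.exp (-β * c g) • (starRingEnd ℂ (k g) * k g) ∂(𝒢.fibreMeasure m) := by
  have hN := ofCc_mem_weightN hopen hψ k
  have hN' := star_ofCc_mem_weightN hopen hψ k
  have hN'' : star (star (𝒢.ofCc k)) ∈ weightN (𝒢.weightOf m) := by rwa [star_star]
  have hl : ∀ t, Λ (star (𝒢.ofCc k) * sigma c t (𝒢.ofCc k)) =
      ∫ x, 𝒢.condExp (star (𝒢.ofCc k) * sigma c t (𝒢.ofCc k)) x ∂m := fun t => by
    rw [sigma_ofCc, ← ofCc_invol, ← ofCc_conv, hcc]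
    simp only [condExp_ofCc]
  have hr : ∀ t, Λ (sigma c t (𝒢.ofCc k) * star (𝒢.ofCc k)) =
      ∫ x, 𝒢.condExp (sigma c t (𝒢.ofCc k) * star (𝒢.ofCc k)) x ∂m := fun t => by
    rw [sigma_ofCc, ← ofCc_invol, ← ofCc_conv, hcc]
    simp only [condExp_ofCc]
  obtain ⟨F, hF1, ⟨C, hF2⟩, hF3, hF4⟩ := hkms _ _ hN' hN'' hN hN'
  have hl' := fun t => integral_phase_mul (m := m) c t hN'' hN
  have hr' := fun t => integral_phase_mul_inv (m := m) c t hN' hN'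
  simp only [star_star, coef_ofCc] at hl' hr'
  obtain ⟨h1, h2⟩ := integrable_conj_mul_exp (m := m) c β k
  have hmeas := c.continuous_toFun.measurable
  have h3 := eq_zero_on_edge_of_eq_zero_on_real
    (hF1.sub (continuousOn_stripTransform hmeas h1 h2))
    ⟨_, fun z hz => (norm_sub_le _ _).trans (add_le_add (hF2 z hz) (norm_stripTransform_le h1 h2 hz))⟩
    (hF3.sub (differentiableOn_stripTransform hmeas h1 h2))
    (fun t => by
      rw [Pi.sub_apply, (hF4 t).1, hl, ← hl', sub_eq_zero]
      rfl) 0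
  rw [Pi.sub_apply, (hF4 0).2, hr, ← hr', sub_eq_zero] at h3
  have h4 : ∀ g, phase c 0 g = 1 := fun g => by simp [phase]
  simp only [h4, one_mul, cexp_add_I_mul, mul_one] at h3
  simpa only [Complex.real_smul] using h3

/-- A locally finite measure whose weight is a KMS weight is conformal. -/
theorem isConformal_of_isKMSWeight (hopen : IsOpen {g | c g = 0})
    (hψ : IsKMSWeight (𝒢.weightOf m) (sigma c) β)
    (hkms : IsKMSFunctional (𝒢.weightOf m) (sigma c) β Λ)
    (hcc : ∀ f, Λ (𝒢.ofCc f) = ∫ x, f (𝒢.unit x) ∂m) : IsConformal c β m := by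
  borelize G
  have := TopologicalSpace.metrizableSpace_of_t3_secondCountable G
  have hcont := c.continuous_toFun
  have : (𝒢.fibreMeasure m).Regular := .of_sigmaCompactSpace_of_isLocallyFiniteMeasure _
  have hreg : ((𝒢.fibreMeasure m).map 𝒢.inv).Regular := Measure.Regular.map 𝒢.invHomeo
  have : IsLocallyFiniteMeasure ((𝒢.fibreMeasure m).withDensity fun g =>
      ENNReal.ofReal (Real.exp (-β * c g))) :=
    IsLocallyFiniteMeasure.withDensity_ofReal (by fun_prop)
  have hreg' : ((𝒢.fibreMeasure m).withDensity fun g =>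
      ENNReal.ofReal (Real.exp (-β * c g))).Regular :=
    .of_sigmaCompactSpace_of_isLocallyFiniteMeasure _
  refine (isConformal_iff c β m).2
    (Measure.ext_of_integral_eq_on_compactlySupported_nnreal fun f => ?_)
  -- Both measures are regular, so integrals of nonnegative `f ∈ C_c(G)` suffice; `k = √f` gives
  -- `|k|² = f`.
  let k : C_c(G, ℂ) := f.compLeft
    (⟨fun t => ((Real.sqrt t : ℝ) : ℂ), by fun_prop⟩ : C(NNReal, ℂ))
  have hk : ∀ g, starRingEnd ℂ (k g) * k g = ((f g : ℝ) : ℂ) := fun g => by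
    have : k g = ((Real.sqrt (f g) : ℝ) : ℂ) :=
      CompactlySupportedContinuousMap.compLeft_apply (by simp) _ _
    rw [this, Complex.conj_ofReal, ← Complex.ofReal_mul, Real.mul_self_sqrt (f g).coe_nonneg]
  have h := integral_norm_sq_inv hopen hψ hkms hcc k
  simp only [hk, Complex.real_smul, ← Complex.ofReal_mul, integral_complex_ofReal] at h
  have h' := integral_withDensity_eq_integral_toReal_smul (μ := 𝒢.fibreMeasure m)
    (measurable_exp_cocycle c β) (Eventually.of_forall fun g => ENNReal.ofReal_lt_top)
    (fun g => (f g : ℝ))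
  simp only [ENNReal.toReal_ofReal (Real.exp_pos _).le, smul_eq_mul] at h'
  rw [h', ← Complex.ofReal_injective h]
  exact 𝒢.invHomeo.measurableEmbedding.integral_map (fun g => (f g : ℝ))

-- For nonnegative `p ∈ C_c(X)` one has `P(p) = p`, so the weight determines `∫ p dm`, and these
-- integrals determine a regular measure.
omit [SecondCountableTopology G] in
theorem weightOf_injOn_regular {m m' : Measure X} [m.Regular] [m'.Regular]
    (h : 𝒢.weightOf m = 𝒢.weightOf m') : m = m' := by
  have := 𝒢.t2Space_units
  have := 𝒢.locallyCompactSpace_units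
  refine Measure.ext_of_integral_eq_on_compactlySupported_nnreal fun f => ?_
  let p : C_c(X, ℝ) := f.compLeft (⟨fun t => (t : ℝ), by fun_prop⟩ : C(NNReal, ℝ))
  have hp : ∀ x, p x = f x := fun x =>
    CompactlySupportedContinuousMap.compLeft_apply (by simp) _ _
  have hpos : 0 ≤ 𝒢.diagElt p := by
    obtain ⟨q, hq⟩ := exists_mul_self_eq (p := p) fun x => by
      rw [hp]
      exact (f x).2
    have h1 := star_mul_self_nonneg (𝒢.diagElt q)
    rwa [star_diagElt, ← diagElt_mul, ← hq] at h1
  have h1 := congrFun h ⟨_, hpos⟩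
  simp only [weightOf, condExp_diagElt, Complex.ofReal_re, hp] at h1
  have hf : Continuous fun x => (f x : ℝ) := by
    have := f.toContinuousMap.continuous
    exact NNReal.continuous_coe.comp this
  rw [integral_eq_lintegral_of_nonneg_ae (Eventually.of_forall fun x => (f x).coe_nonneg)
      hf.aestronglyMeasurable,
    integral_eq_lintegral_of_nonneg_ae (Eventually.of_forall fun x => (f x).coe_nonneg)
      hf.aestronglyMeasurable, h1]

end Conformality

end EtaleGroupoid

/-! ### The bijection -/

open EtaleGroupoid in
theorem corollary2p3 {G X : Type*} [TopologicalSpace G] [TopologicalSpace X] [T2Space G]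
    [LocallyCompactSpace G] [SecondCountableTopology G] [MeasurableSpace X] [BorelSpace X]
    (𝒢 : EtaleGroupoid G X) (c : 𝒢.RealHom) (β : ℝ)
    (htriv : ∀ x : X, {g : G | c g = 0} ∩ {g : G | 𝒢.r g = x ∧ 𝒢.s g = x} = {𝒢.unit x})
    (hopen : IsOpen {g : G | c g = 0}) :
    Set.BijOn 𝒢.weightOf
      {m : MeasureTheory.Measure X | m.Regular ∧ m ≠ 0 ∧ EtaleGroupoid.IsConformal c β m}
      {ψ : {a : 𝒢.ReducedCStar // 0 ≤ a} → ENNReal |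
        IsKMSWeight ψ (EtaleGroupoid.sigma c) β} := by
  have := 𝒢.t2Space_units
  have := 𝒢.locallyCompactSpace_units
  have := 𝒢.isClosedEmbedding_unit.isEmbedding.secondCountableTopology
  refine ⟨?_, ?_, fun ψ hψ => ?_⟩
  · rintro m ⟨hreg, hm, hconf⟩
    exact isKMSWeight_weightOf hm hconf
  · rintro m ⟨hreg, -, -⟩ m' ⟨hreg', -, -⟩ h
    exact weightOf_injOn_regular h
  · obtain ⟨Λ, hΛ, hkms⟩ := hψ.exists_functional
    obtain ⟨m, hreg, hm⟩ := exists_measure hopen hψ hΛ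
    obtain ⟨hm0, rfl⟩ := eq_weightOf hopen hψ hΛ hkms
      (apply_mul_mul_eq_integral htriv hopen hψ hΛ hkms hm)
    exact ⟨m, ⟨hreg, hm0, isConformal_of_isKMSWeight hopen hψ hkms
      (apply_ofCc_eq_integral htriv hopen hψ hΛ hkms hm)⟩, rfl⟩
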